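/- **Setting.** A *signed graph* $G=(V,E^+,E^-,L)$ consists of a finite set $V$ of vertices, two sets $E^+,E^-$ of $2$-element subsets of $V$ (positive and negative edges; a pair may belong to both), and a set $L\subseteq V$ of loops. A subgraph of $G$ is a signed graph whose vertices, positive edges, negative edges and loops are among those of $G$; isomorphisms are bijections of vertices that preserve positive edges, negative edges and loops. The switching of $G$ by $\sigma\colon V\to\{\pm1\}$ multiplies the sign of each edge $\{i,j\}$ by $\sigma(i)\sigma(j)$ and leaves the loops unchanged. $\overline{K}$ denotes any switching of $K$. The *signed graphic arrangement* $\mathcal A(G)$ in $\mathbb C^V$ consists of the hyperplanes $x_i-x_j=0$ for $\{i,j\}\in E^+$, $x_i+x_j=0$ for $\{i,j\}\in E^-$, and $x_i=0$ for $i\in L$. For a finite set $\mathcal A=\{H_1,\dots,H_n\}$ of linear hyperplanes, let $E=\bigwedge\big(\bigoplus_{i=1}^n\mathbb Ce_i\big)$ be graded in the usual way, let $\partial$ be the antiderivation of $E$ of degree $-1$ with $\partial e_i=1$ for all $i$, and let $I$ be the ideal of $E$ generated by all $\partial(e_{i_1}\wedge\dots\wedge e_{i_p})$ such that $H_{i_1},\dots,H_{i_p}$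 are distinct and linear forms defining them are linearly dependent. The *Falk invariant* of $\mathcal A$ is $$\phi_3=\dim_{\mathbb C}\ker\big(E^1\otimes I^2\to E^3,\ a\otimes b\mapsto a\wedge b\big),\qquad I^2=I\cap E^2 .$$ On the vertex set $\{1,\dots,l\}$ let $K_l$ have all positive edges, no negative edges and no loops; let $K_l^l$ have all positive edges, no negative edges and all loops; let $D_l$, $D_l^1$ and $B_l$ have all positive and all negative edges and, respectively, no loop, exactly one loop (at the vertex $1$), and all loops. Let $G_\circ$ be the signed graph on $\{1,2,3\}$ with all three positive edges, the negative edges $\{1,2\}$ and $\{2,3\}$, and a loop at $2$. **Theorem.** Let $G$ be a signed graph with no subgraph isomorphic to $B_2$. Then the Falk invariant of $\mathcal A(G)$ is $$\phi_3=2\,(k_3+k_4+d_3+d_{2,1}+k_{2,2}+k_{3,3}+g_\circ)+5\,d_{3,1},$$ where $k_l$ is the number of subgraphs of $G$ isomorphic to a $\overline{K_l}$; $k_{l,l}$ is the number of subgraphs isomorphic to a $\overline{K_l^l}$; $d_{l,1}$ is the number of subgraphs isomorphic to $D_l^1$; $d_3$ is the number of subgraphs isomorphic to $D_3$ that are not contained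 in a subgraph of $G$ isomorphic to $D_3^1$; and $g_\circ$ is the number of subgraphs isomorphic to a $\overline{G_\circ}$ that are not contained in a subgraph of $G$ isomorphic to $D_3^1$. -/

import Mathlib

open scoped TensorProduct

noncomputable section

/-! ### Orlik-Solomon ideal and Falk invariant of a central hyperplane arrangement over a field -/

namespace Arrangement

variable {𝕜 : Type*} [Field 𝕜] {W : Type*} [AddCommGroup W] [Module 𝕜 W]

/-- The free module `E¹` with one generator for each hyperplane of the arrangement `𝒜`
(a set of linear hyperplanes). -/
abbrev E1 (𝒜 : Set (Submodule 𝕜 W)) : Type _ := 𝒜 →₀ 𝕜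

/-- The exterior algebra `E = ⋀ E¹`. -/
abbrev E (𝒜 : Set (Submodule 𝕜 W)) : Type _ := ExteriorAlgebra 𝕜 (E1 𝒜)

/-- The generator of `E¹` that corresponds to a hyperplane. -/
def gen (𝒜 : Set (Submodule 𝕜 W)) (H : 𝒜) : E1 𝒜 := Finsupp.single H 1

/-- The monomial `e_{s 0} ∧ ⋯ ∧ e_{s (p-1)}`. -/
def monomial (𝒜 : Set (Submodule 𝕜 W)) {p : ℕ} (s : Fin p → 𝒜) : E 𝒜 :=
  ExteriorAlgebra.ιMulti 𝕜 p (fun k => gen 𝒜 (s k))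

/-- The differential of `E`: the antiderivation of degree `-1` with `∂ e_H = 1` for all `H`,
that is, contraction with the linear form on `E¹` which is `1` on every generator. -/
def differential (𝒜 : Set (Submodule 𝕜 W)) : E 𝒜 →ₗ[𝕜] E 𝒜 :=
  CliffordAlgebra.contractLeft (Q := (0 : QuadraticForm 𝕜 (E1 𝒜)))
    (Finsupp.linearCombination 𝕜 (fun _ : 𝒜 => (1 : 𝕜)))

/-- A tuple of hyperplanes is dependent if linear forms that define them are linearly dependent
(the defining forms are unique up to nonzero scalars, so their choice does not matter). -/
def Dependent {𝒜 : Set (Submodule 𝕜 W)} {p : ℕ} (s : Fin p → 𝒜) : Prop :=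
  ∃ α : Fin p → Module.Dual 𝕜 W,
    (∀ k, LinearMap.ker (α k) = (s k : Submodule 𝕜 W)) ∧ ¬ LinearIndependent 𝕜 α

/-- The Orlik-Solomon ideal of a central arrangement: the two-sided ideal of `E` generated by
all `∂ e_S` with `S` dependent. Enumerating `S` in different orders changes `e_S` only by
a sign. -/
def osIdeal (𝒜 : Set (Submodule 𝕜 W)) : TwoSidedIdeal (E 𝒜) :=
  TwoSidedIdeal.span {x | ∃ (p : ℕ) (s : Fin p → 𝒜),
    Function.Injective s ∧ Dependent s ∧ x = differential 𝒜 (monomial 𝒜 s)}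

/-- The homogeneous component `I² = I ∩ E²` of the Orlik-Solomon ideal. -/
def osIdealTwo (𝒜 : Set (Submodule 𝕜 W)) : Submodule 𝕜 (E 𝒜) :=
  (TwoSidedIdeal.asIdeal (osIdeal 𝒜)).restrictScalars 𝕜 ⊓ ⋀[𝕜]^2 (E1 𝒜)

/-- The map `d : E¹ ⊗ I² → E³ ⊆ E`, `a ⊗ b ↦ a ∧ b` (with codomain extended from `E³` to `E`). -/
def falkMap (𝒜 : Set (Submodule 𝕜 W)) : (⋀[𝕜]^1 (E1 𝒜)) ⊗[𝕜] (osIdealTwo 𝒜) →ₗ[𝕜] E 𝒜 :=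
  Submodule.mulMap (⋀[𝕜]^1 (E1 𝒜)) (osIdealTwo 𝒜)

/-- The Falk invariant `φ₃ = dim ker d`. -/
def falkInvariant (𝒜 : Set (Submodule 𝕜 W)) : ℕ :=
  Module.finrank 𝕜 (LinearMap.ker (falkMap 𝒜))

end Arrangement

/-! ### Signed graphs -/

/-- A signed graph on `V`: positive edges, negative edges (a pair of vertices may carry both),
and a set of vertices that carry a loop. -/
@[ext]
structure SignedGraph (V : Type*) where
  pos : SimpleGraph V
  neg : SimpleGraph V
  loops : Set V

namespace SignedGraph

variable {V : Type*} {W : Type*}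

/-- The signed graphic arrangement in `𝕜^V`. -/
def arrangement (𝕜 : Type*) [Field 𝕜] (G : SignedGraph V) : Set (Submodule 𝕜 (V → 𝕜)) :=
  {H | ∃ i j, G.pos.Adj i j ∧
      H = LinearMap.ker ((LinearMap.proj i : (V → 𝕜) →ₗ[𝕜] 𝕜) - LinearMap.proj j)} ∪
  {H | ∃ i j, G.neg.Adj i j ∧
      H = LinearMap.ker ((LinearMap.proj i : (V → 𝕜) →ₗ[𝕜] 𝕜) + LinearMap.proj j)} ∪
  {H | ∃ i ∈ G.loops, H = LinearMap.ker (LinearMap.proj i : (V → 𝕜) →ₗ[𝕜] 𝕜)}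

/-- The switching of `G` by `σ`: the sign of an edge `{i, j}` is multiplied by `σ i * σ j`;
the loops stay (negative) loops. -/
def switch (G : SignedGraph V) (σ : V → ℤˣ) : SignedGraph V where
  pos :=
    { Adj := fun a b => (σ a = σ b ∧ G.pos.Adj a b) ∨ (σ a ≠ σ b ∧ G.neg.Adj a b)
      symm := ⟨fun _ _ h => h.imp (fun h => ⟨h.1.symm, h.2.symm⟩) (fun h => ⟨h.1.symm, h.2.symm⟩)⟩
      loopless := ⟨fun a h => h.elim (fun h => G.pos.loopless.irrefl a h.2)
        (fun h => h.1 rfl)⟩ }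
  neg :=
    { Adj := fun a b => (σ a = σ b ∧ G.neg.Adj a b) ∨ (σ a ≠ σ b ∧ G.pos.Adj a b)
      symm := ⟨fun _ _ h => h.imp (fun h => ⟨h.1.symm, h.2.symm⟩) (fun h => ⟨h.1.symm, h.2.symm⟩)⟩
      loopless := ⟨fun a h => h.elim (fun h => G.neg.loopless.irrefl a h.2)
        (fun h => h.1 rfl)⟩ }
  loops := G.loops

/-- Isomorphism of signed graphs. -/
def IsIsomorphic (G : SignedGraph V) (H : SignedGraph W) : Prop :=
  ∃ e : V ≃ W, (∀ a b, G.pos.Adj a b ↔ H.pos.Adj (e a) (e b)) ∧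
    (∀ a b, G.neg.Adj a b ↔ H.neg.Adj (e a) (e b)) ∧
    (∀ a, a ∈ G.loops ↔ e a ∈ H.loops)

/-- A subgraph of a signed graph: a set of vertices, and sets of positive edges, negative edges
and loops of `G` with end points among these vertices. -/
@[ext]
structure Subgraph (G : SignedGraph V) where
  verts : Set V
  pos : SimpleGraph V
  neg : SimpleGraph V
  loops : Set V
  pos_le : pos ≤ G.pos
  neg_le : neg ≤ G.neg
  loops_subset : loops ⊆ G.loops
  pos_verts : ∀ a b, pos.Adj a b → a ∈ verts ∧ b ∈ verts
  neg_verts : ∀ a b, neg.Adj a b → a ∈ verts ∧ b ∈ verts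
  loops_verts : loops ⊆ verts

namespace Subgraph

variable {G : SignedGraph V}

/-- A subgraph as a signed graph on its own vertex set. -/
def coe (H : G.Subgraph) : SignedGraph H.verts where
  pos := H.pos.comap Subtype.val
  neg := H.neg.comap Subtype.val
  loops := {v | (v : V) ∈ H.loops}

/-- One subgraph is contained in another one. -/
def IsContainedIn (H H' : G.Subgraph) : Prop :=
  H.verts ⊆ H'.verts ∧ H.pos ≤ H'.pos ∧ H.neg ≤ H'.neg ∧ H.loops ⊆ H'.loops

end Subgraph

/-- The subgraphs of `G` that are isomorphic to `K`. -/
def copies (G : SignedGraph V) (K : SignedGraph W) : Set G.Subgraph :=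
  {H | H.coe.IsIsomorphic K}

/-- The subgraphs of `G` that are isomorphic to some signed graph switching equivalent
to `K`. -/
def switchingCopies (G : SignedGraph V) (K : SignedGraph W) : Set G.Subgraph :=
  {H | ∃ σ : W → ℤˣ, H.coe.IsIsomorphic (K.switch σ)}

/-- `K_l`: the complete graph with all edges positive, no loops. -/
def K (l : ℕ) : SignedGraph (Fin l) := ⟨⊤, ⊥, ∅⟩

/-- `D_l`: all positive and all negative edges, no loops. -/
def D (l : ℕ) : SignedGraph (Fin l) := ⟨⊤, ⊤, ∅⟩

/-- `B_l`: all positive and all negative edges, all loops. -/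
def B (l : ℕ) : SignedGraph (Fin l) := ⟨⊤, ⊤, Set.univ⟩

/-- `K_l^l`: the complete graph with all edges positive, all loops. -/
def KLoops (l : ℕ) : SignedGraph (Fin l) := ⟨⊤, ⊥, Set.univ⟩

/-- `D_l^1`: all positive and all negative edges, a loop at one vertex. -/
def DLoop (l : ℕ) : SignedGraph (Fin l) := ⟨⊤, ⊤, {v | v.val = 0}⟩

/-- `G_∘`: the triangle `0, 1, 2` with double edges `{0, 1}` and `{1, 2}`, a positive edge
`{0, 2}`, and a loop at the common vertex `1` of the two double edges. -/
def GCirc : SignedGraph (Fin 3) := ⟨⊤, SimpleGraph.fromEdgeSet {s(0, 1), s(1, 2)}, {1}⟩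

/-- `k_l`. -/
def numK (G : SignedGraph V) (l : ℕ) : ℕ := (G.switchingCopies (K l)).ncard

/-- `k_{l,l}`. -/
def numKLoops (G : SignedGraph V) (l : ℕ) : ℕ := (G.switchingCopies (KLoops l)).ncard

/-- `d_{l,1}`. -/
def numDLoop (G : SignedGraph V) (l : ℕ) : ℕ := (G.copies (DLoop l)).ncard

/-- `d_l`: copies of `D_l` that are not contained in a copy of `D_l^1`. -/
def numD (G : SignedGraph V) (l : ℕ) : ℕ :=
  {H | H ∈ G.copies (D l) ∧ ¬ ∃ H' ∈ G.copies (DLoop l), H.IsContainedIn H'}.ncard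

/-- `g_∘`: copies of `G_∘` up to switching that are not contained in a copy of `D_3^1`. -/
def numGCirc (G : SignedGraph V) : ℕ :=
  {H | H ∈ G.switchingCopies GCirc ∧
    ¬ ∃ H' ∈ G.copies (DLoop 3), H.IsContainedIn H'}.ncard

end SignedGraph

end

/-! The Falk invariant is first turned into the dimension of a space of functions that depends only
on which triples of hyperplanes are dependent. That space is then cut into pieces, one for each
small configuration of hyperplanes.

Linearisation. In degree two the Orlik-Solomon ideal is spanned by the `∂(e_a ∧ e_b ∧ e_c)` over
dependent triples (`osIdealTwo_eq`). Without `B_2` no four hyperplanes lie on a line of the matroid,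
so a pair of hyperplanes belongs to at most one triple. An element of `I²` is then an alternating
function `w(a, b)`, zero on pairs that lie on no line, with `w(a, b) = w(b, c) = w(c, a)` on every
line `abc`. An element of `E¹ ⊗ I²` is a function `z(h; a, b)`, and multiplication kills it exactly
when `z(h; a, b) + z(a; b, h) + z(b; h, a) = 0` for all `h, a, b`
(`Arrangement.falkInvariant_eq_finrank_relationSpace`).

Combinatorial model. A hyperplane is recorded by a symbol: an edge of the double cover with vertices
`V × {±1}`, modulo the antipodal map, a loop being an edge from `u` to `-u`. Lines are the triangles
of the double cover together with the triples made of an edge and the loops at its ends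
(`collinear_of_dependent`, `Collinear.exists_dependent`). On the graph these are the balanced
triangles, the double edges with a loop at one end and the edges with loops at both ends, which are
counted by `k_3`, `d_{2,1}` and `k_{2,2}`.

Pieces. The equations only link entries whose indices `h, a, b` generate the same set of symbols
under taking third points of lines. A line carries a plane of relations. A complete quadrilateral
(six points, four lines, the matroid of `K_4`) also carries a plane; among symbols it appears as
`K_4`, `K_3^3`, `D_3` and `G_∘`. The graph `D_3^1` is a non-Fano configuration with seven points,
six lines and three quadrilaterals, and carries five dimensions (`IsNonFano.finrank_pieceSpace`). A
`D_3` or `G_∘` inside a `D_3^1` is not closed under lines and its relations are already among these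
five, whence the exclusions in `d_3` and `g_∘`. All the relations that are needed have the form `(p
f₁ + q f₂) ⊗ (f₁ ∧ f₂)`, where `f₁, f₂` come from a labelling of points by three classes
(`labelRelation_mem`).

Completeness and disjointness. A relation with no component on lines and quadrilaterals is zero
(`IsReduced.eq_zero`): the cyclic equation compares an entry with two others, and these vanish
unless the vertices involved carry one of the listed configurations. Two different configurations
never share a block, because each nonlocal one is generated by any of its lines and any further
point (`component_eq`). Summing dimensions gives `finrank_relationSpace`.

Counting. A subgraph without isolated vertices is the same as its set of symbols, and the switching
copies of `K` correspond to the images of `K` under maps to signed vertices that are injective on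
the underlying vertices (`bijOn_symbols`). -/

noncomputable section

/-! ### Contractions and coefficients of multivectors -/

namespace ExteriorAlgebra

variable {𝕜 : Type*} [Field 𝕜] {ι : Type*}

/-- Contraction of a multivector with the coordinate form of index `x`. -/
def contractCoord (x : ι) : ExteriorAlgebra 𝕜 (ι →₀ 𝕜) →ₗ[𝕜] ExteriorAlgebra 𝕜 (ι →₀ 𝕜) :=
  CliffordAlgebra.contractLeft (Q := (0 : QuadraticForm 𝕜 (ι →₀ 𝕜))) (Finsupp.lapply x)

lemma contractCoord_ι_mul (x : ι) (a : ι →₀ 𝕜) (b : ExteriorAlgebra 𝕜 (ι →₀ 𝕜)) :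
    contractCoord x (ExteriorAlgebra.ι 𝕜 a * b) =
      a x • b - ExteriorAlgebra.ι 𝕜 a * contractCoord x b :=
  CliffordAlgebra.contractLeft_ι_mul _ _ _

lemma contractCoord_ι (x : ι) (a : ι →₀ 𝕜) :
    contractCoord x (ExteriorAlgebra.ι 𝕜 a) = algebraMap 𝕜 _ (a x) :=
  CliffordAlgebra.contractLeft_ι _ _ _

lemma contractCoord_comm (x y : ι) (b : ExteriorAlgebra 𝕜 (ι →₀ 𝕜)) :
    contractCoord x (contractCoord y b) = -contractCoord y (contractCoord x b) :=
  CliffordAlgebra.contractLeft_comm _ _ _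

lemma ι_mul_mem_exteriorPower {M : Type*} [AddCommGroup M] [Module 𝕜 M] (a : M) {n : ℕ}
    {b : ExteriorAlgebra 𝕜 M} (hb : b ∈ ⋀[𝕜]^n M) :
    ExteriorAlgebra.ι 𝕜 a * b ∈ ⋀[𝕜]^(n + 1) M := by
  rw [exteriorPower, pow_succ']
  exact Submodule.mul_mem_mul (LinearMap.mem_range_self _ a) hb

lemma exteriorPower_succ_induction {M : Type*} [AddCommGroup M] [Module 𝕜 M] {n : ℕ}
    {p : ExteriorAlgebra 𝕜 M → Prop}
    (hm : ∀ a, ∀ b ∈ ⋀[𝕜]^n M, p (ExteriorAlgebra.ι 𝕜 a * b))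
    (ha : ∀ x y, p x → p y → p (x + y)) {x : ExteriorAlgebra 𝕜 M} (hx : x ∈ ⋀[𝕜]^(n + 1) M) :
    p x := by
  rw [exteriorPower, pow_succ'] at hx
  refine Submodule.mul_induction_on hx ?_ ha
  rintro _ ⟨a, rfl⟩ b hb
  exact hm a b hb

lemma contractLeft_mem_exteriorPower {M : Type*} [AddCommGroup M] [Module 𝕜 M]
    (d : Module.Dual 𝕜 M) (n : ℕ) {b : ExteriorAlgebra 𝕜 M} (hb : b ∈ ⋀[𝕜]^(n + 1) M) :
    CliffordAlgebra.contractLeft (Q := (0 : QuadraticForm 𝕜 M)) d b ∈ ⋀[𝕜]^n M := by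
  induction n generalizing b with
  | zero =>
    refine exteriorPower_succ_induction (p := fun b =>
      CliffordAlgebra.contractLeft (Q := (0 : QuadraticForm 𝕜 M)) d b ∈ ⋀[𝕜]^0 M)
      ?_ (fun x y hx hy => by rw [map_add]; exact add_mem hx hy) hb
    intro a b hb
    rw [exteriorPower, pow_zero] at hb ⊢
    obtain ⟨c, rfl⟩ := Submodule.mem_one.1 hb
    refine Submodule.mem_one.2 ⟨d a * c, ?_⟩
    have := CliffordAlgebra.contractLeft_ι_mul (Q := (0 : QuadraticForm 𝕜 M)) d a
      (algebraMap 𝕜 _ c)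
    refine Eq.trans ?_ this.symm
    rw [CliffordAlgebra.contractLeft_algebraMap, mul_zero, sub_zero, map_mul, Algebra.smul_def]
  | succ n ih =>
    refine exteriorPower_succ_induction (p := fun b =>
      CliffordAlgebra.contractLeft (Q := (0 : QuadraticForm 𝕜 M)) d b ∈ ⋀[𝕜]^(n + 1) M)
      ?_ (fun x y hx hy => by rw [map_add]; exact add_mem hx hy) hb
    intro a b hb
    have := CliffordAlgebra.contractLeft_ι_mul (Q := (0 : QuadraticForm 𝕜 M)) d a b
    rw [show ExteriorAlgebra.ι 𝕜 a = CliffordAlgebra.ι (0 : QuadraticForm 𝕜 M) a from rfl, this]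
    exact sub_mem (Submodule.smul_mem _ _ hb) (ι_mul_mem_exteriorPower a (ih hb))

lemma contractCoord_mem_exteriorPower (x : ι) (n : ℕ) {b : ExteriorAlgebra 𝕜 (ι →₀ 𝕜)}
    (hb : b ∈ ⋀[𝕜]^(n + 1) (ι →₀ 𝕜)) : contractCoord x b ∈ ⋀[𝕜]^n (ι →₀ 𝕜) :=
  contractLeft_mem_exteriorPower _ n hb

/-- Euler's formula: contracting and then multiplying back by the same generator counts the degree.
In the induction the antiderivation rule yields the new factor once, and the remaining terms change
sign twice. -/
lemma sum_ι_single_mul_contractCoord [Fintype ι] (n : ℕ) {b : ExteriorAlgebra 𝕜 (ι →₀ 𝕜)}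
    (hb : b ∈ ⋀[𝕜]^n (ι →₀ 𝕜)) :
    ∑ x, ExteriorAlgebra.ι 𝕜 (Finsupp.single x 1) * contractCoord x b = (n : 𝕜) • b := by
  induction n generalizing b with
  | zero =>
    rw [exteriorPower, pow_zero] at hb
    obtain ⟨c, rfl⟩ := Submodule.mem_one.1 hb
    have : ∀ x : ι, contractCoord x (algebraMap 𝕜 (ExteriorAlgebra 𝕜 (ι →₀ 𝕜)) c) = 0 :=
      fun x => CliffordAlgebra.contractLeft_algebraMap _ _ _
    simp [this]
  | succ n ih =>
    refine exteriorPower_succ_induction (p := fun b =>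
      ∑ x, ExteriorAlgebra.ι 𝕜 (Finsupp.single x 1) * contractCoord x b
        = ((n + 1 : ℕ) : 𝕜) • b) ?_ (fun x y hx hy => ?_) hb
    · intro a b hb
      have h1 : ∑ x, ExteriorAlgebra.ι 𝕜 (Finsupp.single x (1 : 𝕜)) * (a x • b)
          = ExteriorAlgebra.ι 𝕜 a * b := by
        have : a = ∑ x, a x • Finsupp.single x (1 : 𝕜) := by
          ext y; simp
        conv_rhs => rw [this, map_sum, Finset.sum_mul]
        exact Finset.sum_congr rfl fun x _ => by rw [map_smul, smul_mul_assoc, mul_smul_comm]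
      have h2 : ∑ x, ExteriorAlgebra.ι 𝕜 (Finsupp.single x (1 : 𝕜)) *
          (ExteriorAlgebra.ι 𝕜 a * contractCoord x b)
          = -(ExteriorAlgebra.ι 𝕜 a * ((n : 𝕜) • b)) := by
        rw [← ih hb, Finset.mul_sum, ← Finset.sum_neg_distrib]
        refine Finset.sum_congr rfl fun x _ => ?_
        rw [← mul_assoc, ← mul_assoc, ← neg_mul]
        congr 1
        exact eq_neg_of_add_eq_zero_left (ExteriorAlgebra.ι_add_mul_swap _ _)
      simp only [contractCoord_ι_mul, mul_sub, Finset.sum_sub_distrib, h1, h2]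
      push_cast
      rw [add_smul, one_smul, mul_smul_comm]
      abel
    · simp only [map_add, mul_add, Finset.sum_add_distrib, smul_add, hx, hy]

/-- Euler's formula recovers `(n + 1) b` from the contractions, and `n + 1` is invertible in
characteristic zero. -/
lemma eq_zero_of_contractCoord_eq_zero [CharZero 𝕜] [Finite ι] {n : ℕ}
    {b : ExteriorAlgebra 𝕜 (ι →₀ 𝕜)} (hb : b ∈ ⋀[𝕜]^(n + 1) (ι →₀ 𝕜))
    (h : ∀ x, contractCoord x b = 0) : b = 0 := by
  have := Fintype.ofFinite ι
  have h1 := sum_ι_single_mul_contractCoord (n + 1) hb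
  simp only [h, mul_zero, Finset.sum_const_zero] at h1
  exact (smul_eq_zero.1 h1.symm).resolve_left (by exact_mod_cast Nat.succ_ne_zero n)

lemma eq_zero_of_algebraMapInv_eq_zero {M : Type*} [AddCommGroup M] [Module 𝕜 M]
    {b : ExteriorAlgebra 𝕜 M} (hb : b ∈ ⋀[𝕜]^0 M)
    (h : ExteriorAlgebra.algebraMapInv b = (0 : 𝕜)) : b = 0 := by
  rw [exteriorPower, pow_zero] at hb
  obtain ⟨c, rfl⟩ := Submodule.mem_one.1 hb
  rw [ExteriorAlgebra.algebraMap_leftInverse] at h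
  rw [h, map_zero]

/-- The coefficient of `e_x ∧ e_y` in a multivector. -/
def coeffTwo (x y : ι) : ExteriorAlgebra 𝕜 (ι →₀ 𝕜) →ₗ[𝕜] 𝕜 :=
  ExteriorAlgebra.algebraMapInv.toLinearMap ∘ₗ contractCoord y ∘ₗ contractCoord x

/-- The coefficient of `e_x ∧ e_y ∧ e_z` in a multivector. -/
def coeffThree (x y z : ι) : ExteriorAlgebra 𝕜 (ι →₀ 𝕜) →ₗ[𝕜] 𝕜 :=
  ExteriorAlgebra.algebraMapInv.toLinearMap ∘ₗ contractCoord z ∘ₗ contractCoord y ∘ₗ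
    contractCoord x

lemma coeffTwo_swap (x y : ι) (b : ExteriorAlgebra 𝕜 (ι →₀ 𝕜)) :
    coeffTwo y x b = -coeffTwo x y b := by
  simp only [coeffTwo, LinearMap.comp_apply]
  rw [contractCoord_comm x y, map_neg]

lemma eq_zero_of_coeffTwo [CharZero 𝕜] [Finite ι] {b : ExteriorAlgebra 𝕜 (ι →₀ 𝕜)}
    (hb : b ∈ ⋀[𝕜]^2 (ι →₀ 𝕜)) (h : ∀ x y, coeffTwo x y b = 0) : b = 0 :=
  eq_zero_of_contractCoord_eq_zero hb fun x =>
    have hx := contractCoord_mem_exteriorPower x 1 hb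
    eq_zero_of_contractCoord_eq_zero hx fun y =>
      eq_zero_of_algebraMapInv_eq_zero (contractCoord_mem_exteriorPower y 0 hx) (h x y)

lemma eq_zero_of_coeffThree [CharZero 𝕜] [Finite ι] {b : ExteriorAlgebra 𝕜 (ι →₀ 𝕜)}
    (hb : b ∈ ⋀[𝕜]^3 (ι →₀ 𝕜)) (h : ∀ x y z, coeffThree x y z b = 0) : b = 0 :=
  eq_zero_of_contractCoord_eq_zero hb fun x =>
    have hx := contractCoord_mem_exteriorPower x 2 hb
    eq_zero_of_contractCoord_eq_zero hx fun y =>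
      have hy := contractCoord_mem_exteriorPower y 1 hx
      eq_zero_of_contractCoord_eq_zero hy fun z =>
        eq_zero_of_algebraMapInv_eq_zero (contractCoord_mem_exteriorPower z 0 hy) (h x y z)

lemma algebraMapInv_ι_mul (a : ι →₀ 𝕜) (b : ExteriorAlgebra 𝕜 (ι →₀ 𝕜)) :
    ExteriorAlgebra.algebraMapInv (ExteriorAlgebra.ι 𝕜 a * b) = (0 : 𝕜) := by
  rw [map_mul, ExteriorAlgebra.algebraMapInv, ExteriorAlgebra.lift_ι_apply]
  simp

/-- The cyclic arrangement of the indices removes all signs; it becomes the fourth condition of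
`relationSpace`. -/
lemma coeffThree_ι_mul (a : ι →₀ 𝕜) (b : ExteriorAlgebra 𝕜 (ι →₀ 𝕜)) (x y z : ι) :
    coeffThree x y z (ExteriorAlgebra.ι 𝕜 a * b) =
      a x * coeffTwo y z b + a y * coeffTwo z x b + a z * coeffTwo x y b := by
  rw [coeffTwo_swap x z]
  simp only [coeffThree, coeffTwo, LinearMap.comp_apply, contractCoord_ι_mul, map_sub, map_smul,
    AlgHom.toLinearMap_apply, algebraMapInv_ι_mul, smul_eq_mul]
  ring

lemma coeffTwo_ι_mul_ι (a b : ι →₀ 𝕜) (x y : ι) :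
    coeffTwo x y (ExteriorAlgebra.ι 𝕜 a * ExteriorAlgebra.ι 𝕜 b) = a x * b y - b x * a y := by
  simp only [coeffTwo, LinearMap.comp_apply, contractCoord_ι_mul, contractCoord_ι, map_sub,
    map_smul, AlgHom.toLinearMap_apply, smul_eq_mul, ← Algebra.commutes (b x),
    ← Algebra.smul_def, ExteriorAlgebra.algebraMap_leftInverse (ι →₀ 𝕜) _]

end ExteriorAlgebra
end

/-! ### The Orlik-Solomon ideal in degree two and the Falk invariant as a dimension of relations -/

noncomputable section

/-- Coefficients of the elements of `E¹ ⊗ I²` that are killed by multiplication, for a set `A` of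
points and a ternary relation `tri` of collinearity on it all of whose lines have at most three
points: `z h a b` is the coefficient of `e_h ⊗ (e_a ∧ e_b)`. -/
def relationSpace (𝕜 : Type*) [Field 𝕜] {ι : Type*} (A : Set ι) (tri : ι → ι → ι → Prop) :
    Submodule 𝕜 (ι → ι → ι → 𝕜) where
  -- The first three conditions place each `z h` in `I²`: alternating, constant around a line, zero
  -- off the lines. The fourth says that the coefficient of `e_h ∧ e_a ∧ e_b` in the product
  -- vanishes. The last confines `h` to the points of `A`.
  carrier := {z | (∀ h a b, z h b a = -z h a b) ∧ (∀ h a b c, tri a b c → z h b c = z h a b) ∧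
    (∀ h a b, (∀ c, ¬tri a b c) → z h a b = 0) ∧ (∀ h a b, z h a b + z a b h + z b h a = 0) ∧
    ∀ h a b, h ∉ A → z h a b = 0}
  zero_mem' := by simp
  add_mem' := by
    rintro x y ⟨h1, h2, h3, h4, h5⟩ ⟨k1, k2, k3, k4, k5⟩
    refine ⟨fun h a b => ?_, fun h a b c t => ?_, fun h a b t => ?_, fun h a b => ?_,
      fun h a b t => ?_⟩ <;> simp only [Pi.add_apply]
    · rw [h1, k1]; ring
    · rw [h2 h a b c t, k2 h a b c t]
    · rw [h3 h a b t, k3 h a b t, add_zero]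
    · linear_combination h4 h a b + k4 h a b
    · rw [h5 h a b t, k5 h a b t, add_zero]
  smul_mem' := by
    rintro r x ⟨h1, h2, h3, h4, h5⟩
    refine ⟨fun h a b => ?_, fun h a b c t => ?_, fun h a b t => ?_, fun h a b => ?_,
      fun h a b t => ?_⟩ <;> simp only [Pi.smul_apply, smul_eq_mul]
    · rw [h1]; ring
    · rw [h2 h a b c t]
    · rw [h3 h a b t, mul_zero]
    · linear_combination r * h4 h a b
    · rw [h5 h a b t, mul_zero]

lemma mem_relationSpace {𝕜 : Type*} [Field 𝕜] {ι : Type*} {A : Set ι} {tri : ι → ι → ι → Prop}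
    {z : ι → ι → ι → 𝕜} : z ∈ relationSpace 𝕜 A tri ↔
    (∀ h a b, z h b a = -z h a b) ∧ (∀ h a b c, tri a b c → z h b c = z h a b) ∧
    (∀ h a b, (∀ c, ¬tri a b c) → z h a b = 0) ∧ (∀ h a b, z h a b + z a b h + z b h a = 0) ∧
    ∀ h a b, h ∉ A → z h a b = 0 := Iff.rfl

namespace Arrangement

open ExteriorAlgebra

variable {𝕜 : Type*} [Field 𝕜] {W : Type*} [AddCommGroup W] [Module 𝕜 W]
  {𝒜 : Set (Submodule 𝕜 W)}

/-- Three distinct dependent hyperplanes. -/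
def DependentTriple (𝒜 : Set (Submodule 𝕜 W)) (a b c : 𝒜) : Prop :=
  a ≠ b ∧ b ≠ c ∧ a ≠ c ∧ Dependent ![a, b, c]

/-- The element `∂(e_a ∧ e_b ∧ e_c)`. -/
def tripleRelation (a b c : 𝒜) : E 𝒜 :=
  ExteriorAlgebra.ι 𝕜 (gen 𝒜 b) * ExteriorAlgebra.ι 𝕜 (gen 𝒜 c)
    - ExteriorAlgebra.ι 𝕜 (gen 𝒜 a) * ExteriorAlgebra.ι 𝕜 (gen 𝒜 c)
    + ExteriorAlgebra.ι 𝕜 (gen 𝒜 a) * ExteriorAlgebra.ι 𝕜 (gen 𝒜 b)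

lemma differential_ι_mul (a : E1 𝒜) (b : E 𝒜) :
    differential 𝒜 (ExteriorAlgebra.ι 𝕜 a * b) =
      Finsupp.linearCombination 𝕜 (fun _ : 𝒜 => (1 : 𝕜)) a • b
        - ExteriorAlgebra.ι 𝕜 a * differential 𝒜 b :=
  CliffordAlgebra.contractLeft_ι_mul _ _ _

lemma differential_ι (a : E1 𝒜) :
    differential 𝒜 (ExteriorAlgebra.ι 𝕜 a) =
      algebraMap 𝕜 _ (Finsupp.linearCombination 𝕜 (fun _ : 𝒜 => (1 : 𝕜)) a) :=
  CliffordAlgebra.contractLeft_ι _ _ _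

lemma differential_monomial_three (s : Fin 3 → 𝒜) :
    differential 𝒜 (monomial 𝒜 s) = tripleRelation (s 0) (s 1) (s 2) := by
  have : monomial 𝒜 s = ExteriorAlgebra.ι 𝕜 (gen 𝒜 (s 0)) *
      (ExteriorAlgebra.ι 𝕜 (gen 𝒜 (s 1)) * ExteriorAlgebra.ι 𝕜 (gen 𝒜 (s 2))) := by
    rw [monomial, ExteriorAlgebra.ιMulti_apply]
    simp only [List.ofFn_succ, List.ofFn_zero, List.prod_cons, List.prod_nil, mul_one]
    rfl
  rw [this, differential_ι_mul, differential_ι_mul, differential_ι]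
  simp only [gen, Finsupp.linearCombination_single, smul_eq_mul, mul_one, one_smul, map_one,
    tripleRelation, mul_sub]
  abel

lemma tripleRelation_mem (a b c : 𝒜) : tripleRelation a b c ∈ ⋀[𝕜]^2 (E1 𝒜) := by
  have key : ∀ x y : E1 𝒜, ExteriorAlgebra.ι 𝕜 x * ExteriorAlgebra.ι 𝕜 y ∈ ⋀[𝕜]^2 (E1 𝒜) := by
    intro x y
    refine ι_mul_mem_exteriorPower x ?_
    rw [exteriorPower, pow_one]
    exact LinearMap.mem_range_self _ y
  exact add_mem (sub_mem (key _ _) (key _ _)) (key _ _)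

lemma not_dependent_zero (s : Fin 0 → 𝒜) : ¬Dependent s := by
  rintro ⟨α, -, h⟩
  exact h linearIndependent_empty_type

lemma not_dependent_one (h𝒜 : ∀ H ∈ 𝒜, H ≠ ⊤) (s : Fin 1 → 𝒜) : ¬Dependent s := by
  rintro ⟨α, hα, h⟩
  refine h (LinearIndependent.of_subsingleton 0 fun h0 => h𝒜 _ (s 0).2 ?_)
  rw [← hα, h0, LinearMap.ker_zero]

/-- Proportional nonzero forms have the same kernel. -/
lemma not_dependent_two (h𝒜 : ∀ H ∈ 𝒜, H ≠ ⊤) (s : Fin 2 → 𝒜) (hs : Function.Injective s) :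
    ¬Dependent s := by
  rintro ⟨α, hα, h⟩
  have h0 : ∀ k, α k ≠ 0 := fun k h0 => h𝒜 _ (s k).2 (by rw [← hα, h0, LinearMap.ker_zero])
  apply h
  rw [linearIndependent_fin2]
  refine ⟨h0 1, fun a ha => ?_⟩
  have ha0 : a ≠ 0 := by
    rintro rfl
    exact h0 0 (by rw [← ha, zero_smul])
  have : s 0 = s 1 := Subtype.ext (by rw [← hα, ← hα, ← ha, LinearMap.ker_smul _ _ ha0])
  exact absurd (hs this) (by decide)

/-- The span of the relations `∂(e_a ∧ e_b ∧ e_c)`. -/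
def tripleSpan (𝒜 : Set (Submodule 𝕜 W)) : Submodule 𝕜 (E 𝒜) :=
  Submodule.span 𝕜 {x | ∃ a b c, DependentTriple 𝒜 a b c ∧ x = tripleRelation a b c}

lemma tripleSpan_le : tripleSpan 𝒜 ≤ ⋀[𝕜]^2 (E1 𝒜) := by
  refine Submodule.span_le.2 ?_
  rintro _ ⟨a, b, c, -, rfl⟩
  exact tripleRelation_mem a b c

/-- The multivectors of degree at least three. -/
def degreeGeThree (𝒜 : Set (Submodule 𝕜 W)) : Submodule 𝕜 (E 𝒜) :=
  ⨆ n : ℕ, ⋀[𝕜]^(n + 3) (E1 𝒜)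

lemma ι_mem_exteriorPower_one (v : E1 𝒜) : ExteriorAlgebra.ι 𝕜 v ∈ ⋀[𝕜]^1 (E1 𝒜) := by
  rw [exteriorPower, pow_one]
  exact LinearMap.mem_range_self _ v

lemma mul_mem_exteriorPower {i j : ℕ} {x y : E 𝒜} (hx : x ∈ ⋀[𝕜]^i (E1 𝒜))
    (hy : y ∈ ⋀[𝕜]^j (E1 𝒜)) : x * y ∈ ⋀[𝕜]^(i + j) (E1 𝒜) := by
  rw [exteriorPower, pow_add]
  exact Submodule.mul_mem_mul hx hy

lemma ι_mul_mem_sup (v : E1 𝒜) {x : E 𝒜} (hx : x ∈ tripleSpan 𝒜 ⊔ degreeGeThree 𝒜) :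
    ExteriorAlgebra.ι 𝕜 v * x ∈ degreeGeThree 𝒜 := by
  suffices tripleSpan 𝒜 ⊔ degreeGeThree 𝒜 ≤
      (degreeGeThree 𝒜).comap (LinearMap.mulLeft 𝕜 (ExteriorAlgebra.ι 𝕜 v)) from this hx
  refine sup_le (fun y hy => ?_) (iSup_le fun n y hy => ?_)
  · exact Submodule.mem_iSup_of_mem 0 (ι_mul_mem_exteriorPower v (tripleSpan_le hy))
  · exact Submodule.mem_iSup_of_mem (n + 1) (ι_mul_mem_exteriorPower v hy)

lemma mul_ι_mem_sup (v : E1 𝒜) {x : E 𝒜} (hx : x ∈ tripleSpan 𝒜 ⊔ degreeGeThree 𝒜) :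
    x * ExteriorAlgebra.ι 𝕜 v ∈ degreeGeThree 𝒜 := by
  suffices tripleSpan 𝒜 ⊔ degreeGeThree 𝒜 ≤
      (degreeGeThree 𝒜).comap (LinearMap.mulRight 𝕜 (ExteriorAlgebra.ι 𝕜 v)) from this hx
  refine sup_le (fun y hy => ?_) (iSup_le fun n y hy => ?_)
  · have := mul_mem_exteriorPower (tripleSpan_le hy) (ι_mem_exteriorPower_one v)
    exact Submodule.mem_iSup_of_mem 0 this
  · have := mul_mem_exteriorPower hy (ι_mem_exteriorPower_one v)
    rw [add_right_comm] at this
    exact Submodule.mem_iSup_of_mem (n + 1) this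

/-- Multiplication by a vector sends both summands into degree at least three, so their sum absorbs
the whole algebra. `mem_sup_mul` is the version on the right. -/
lemma mul_mem_sup (a : E 𝒜) : ∀ x ∈ tripleSpan 𝒜 ⊔ degreeGeThree 𝒜,
    a * x ∈ tripleSpan 𝒜 ⊔ degreeGeThree 𝒜 := by
  induction a using ExteriorAlgebra.induction with
  | algebraMap r => intro x hx; rw [← Algebra.smul_def]; exact Submodule.smul_mem _ _ hx
  | ι v => intro x hx; exact Submodule.mem_sup_right (ι_mul_mem_sup v hx)
  | mul a b ha hb => intro x hx; rw [mul_assoc]; exact ha _ (hb _ hx)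
  | add a b ha hb => intro x hx; rw [add_mul]; exact add_mem (ha _ hx) (hb _ hx)

lemma mem_sup_mul (a : E 𝒜) : ∀ x ∈ tripleSpan 𝒜 ⊔ degreeGeThree 𝒜,
    x * a ∈ tripleSpan 𝒜 ⊔ degreeGeThree 𝒜 := by
  induction a using ExteriorAlgebra.induction with
  | algebraMap r =>
    intro x hx; rw [← Algebra.commutes, ← Algebra.smul_def]; exact Submodule.smul_mem _ _ hx
  | ι v => intro x hx; exact Submodule.mem_sup_right (mul_ι_mem_sup v hx)
  | mul a b ha hb => intro x hx; rw [← mul_assoc]; exact hb _ (ha _ hx)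
  | add a b ha hb => intro x hx; rw [mul_add]; exact add_mem (ha _ hx) (hb _ hx)

/-- Sort the generators by length: tuples with at most two members are independent, triples give the
degree-two relations, and from four members on the differential has degree at least three. -/
lemma osIdeal_le_sup (h𝒜 : ∀ H ∈ 𝒜, H ≠ ⊤) {x : E 𝒜} (hx : x ∈ osIdeal 𝒜) :
    x ∈ tripleSpan 𝒜 ⊔ degreeGeThree 𝒜 := by
  refine TwoSidedIdeal.span_induction (p := fun x _ => x ∈ tripleSpan 𝒜 ⊔ degreeGeThree 𝒜)
    ?_ (zero_mem _) (fun x y _ _ hx hy => add_mem hx hy) (fun x _ hx => neg_mem hx)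
    (fun a x _ hx => mul_mem_sup a x hx) (fun a x _ hx => mem_sup_mul a x hx) hx
  rintro _ ⟨p, s, hs, hd, rfl⟩
  match p with
  | 0 => exact absurd hd (not_dependent_zero s)
  | 1 => exact absurd hd (not_dependent_one h𝒜 s)
  | 2 => exact absurd hd (not_dependent_two h𝒜 s hs)
  | 3 =>
    refine Submodule.mem_sup_left (Submodule.subset_span ⟨s 0, s 1, s 2, ⟨?_, ?_, ?_, ?_⟩,
      differential_monomial_three s⟩)
    · exact hs.ne (by decide)
    · exact hs.ne (by decide)
    · exact hs.ne (by decide)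
    · convert hd using 1
      ext i; fin_cases i <;> rfl
  | n + 4 =>
    refine Submodule.mem_sup_right (Submodule.mem_iSup_of_mem n ?_)
    refine contractLeft_mem_exteriorPower _ (n + 3) ?_
    exact ExteriorAlgebra.ιMulti_range 𝕜 (n + 4) ⟨_, rfl⟩

/-- Project the inclusion of `osIdeal_le_sup` to degree two, where the part of higher degree
disappears. -/
lemma osIdealTwo_eq (h𝒜 : ∀ H ∈ 𝒜, H ≠ ⊤) : osIdealTwo 𝒜 = tripleSpan 𝒜 := by
  apply le_antisymm
  · rintro x ⟨hx, hx2⟩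
    obtain ⟨s, hs, r, hr, rfl⟩ := Submodule.mem_sup.1
      (osIdeal_le_sup h𝒜 (TwoSidedIdeal.mem_asIdeal.1 hx))
    have hr2 : r ∈ ⋀[𝕜]^2 (E1 𝒜) := by simpa using sub_mem hx2 (tripleSpan_le hs)
    have : degreeGeThree 𝒜 ≤
        LinearMap.ker (GradedAlgebra.proj (fun i : ℕ => ⋀[𝕜]^i (E1 𝒜)) 2) := by
      refine iSup_le fun n y hy => ?_
      rw [LinearMap.mem_ker, GradedAlgebra.proj_apply]
      exact DirectSum.decompose_of_mem_ne (fun i : ℕ => ⋀[𝕜]^i (E1 𝒜)) hy (by omega)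
    have h0 := this hr
    rw [LinearMap.mem_ker, GradedAlgebra.proj_apply,
      DirectSum.decompose_of_mem_same (fun i : ℕ => ⋀[𝕜]^i (E1 𝒜)) hr2] at h0
    rwa [h0, add_zero]
  · refine le_inf (Submodule.span_le.2 ?_) tripleSpan_le
    rintro _ ⟨a, b, c, ⟨h1, h2, h3, h4⟩, rfl⟩
    refine TwoSidedIdeal.mem_asIdeal.2 (TwoSidedIdeal.subset_span ⟨3, ![a, b, c], ?_, h4, ?_⟩)
    · intro i j hij
      fin_cases i <;> fin_cases j <;> first | rfl | simp_all
    · rw [differential_monomial_three]; rfl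

lemma coeffTwo_gen_mul_gen (a b x y : 𝒜) [DecidableEq 𝒜] :
    coeffTwo x y (ExteriorAlgebra.ι 𝕜 (gen 𝒜 a) * ExteriorAlgebra.ι 𝕜 (gen 𝒜 b)) =
      (if a = x then 1 else 0) * (if b = y then 1 else 0)
        - (if b = x then 1 else 0) * (if a = y then 1 else 0) := by
  rw [coeffTwo_ι_mul_ι]
  simp [gen, Finsupp.single_apply]

lemma DependentTriple.rotate {a b c : 𝒜} (h : DependentTriple 𝒜 a b c) :
    DependentTriple 𝒜 b c a := by
  obtain ⟨h1, h2, h3, α, hα, hd⟩ := h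
  refine ⟨h2, h3.symm, h1.symm, ![α 1, α 2, α 0], ?_, ?_⟩
  · intro k
    fin_cases k
    exacts [hα 1, hα 2, hα 0]
  · intro hi
    refine hd ?_
    have := hi.comp ![(2 : Fin 3), 0, 1] (by decide)
    convert this using 1
    ext i; fin_cases i <;> rfl

lemma DependentTriple.swap {a b c : 𝒜} (h : DependentTriple 𝒜 a b c) :
    DependentTriple 𝒜 b a c := by
  obtain ⟨h1, h2, h3, α, hα, hd⟩ := h
  refine ⟨h1.symm, h3, h2, ![α 1, α 0, α 2], ?_, ?_⟩
  · intro k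
    fin_cases k
    exacts [hα 1, hα 0, hα 2]
  · intro hi
    refine hd ?_
    have := hi.comp ![(1 : Fin 3), 0, 2] (by decide)
    convert this using 1
    ext i; fin_cases i <;> rfl

section Coefficients

variable (hu : ∀ a b c d, DependentTriple 𝒜 a b c → DependentTriple 𝒜 a b d → c = d)

include hu in
-- It is enough to test one relation `∂(e_p ∧ e_q ∧ e_r)`. By `hu` another triple that shares two
-- points with `pqr` is `pqr` itself, so no pair receives contributions from two lines.
lemma coeffTwo_of_mem_tripleSpan {w : E 𝒜} (hw : w ∈ tripleSpan 𝒜) :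
    (∀ a b c, DependentTriple 𝒜 a b c → coeffTwo b c w = coeffTwo a b w) ∧
      ∀ a b, (∀ c, ¬DependentTriple 𝒜 a b c) → coeffTwo a b w = 0 := by
  classical
  induction hw using Submodule.span_induction with
  | zero => simp
  | add x y _ _ hx hy =>
    refine ⟨fun a b c h => ?_, fun a b h => ?_⟩
    · rw [map_add, map_add, hx.1 a b c h, hy.1 a b c h]
    · rw [map_add, hx.2 a b h, hy.2 a b h, add_zero]
  | smul r x _ hx =>
    refine ⟨fun a b c h => ?_, fun a b h => ?_⟩
    · rw [map_smul, map_smul, hx.1 a b c h]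
    · rw [map_smul, hx.2 a b h, smul_zero]
  | mem x h =>
    obtain ⟨p, q, r, hpqr, rfl⟩ := h
    have h1 := hpqr.rotate
    have h2 := h1.rotate
    have h3 := hpqr.swap
    have h4 := h1.swap
    have h5 := h2.swap
    simp only [tripleRelation, map_add, map_sub, coeffTwo_gen_mul_gen]
    obtain ⟨hpq, hqr, hpr, -⟩ := id hpqr
    refine ⟨fun a b c h => ?_, fun a b h => ?_⟩
    · obtain ⟨hab, hbc, hac, -⟩ := id h
      have k1 := h.rotate
      have k2 := k1.rotate
      -- Every way in which two of `p, q, r` can meet two consecutive points of the triple forces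
      -- the third points to agree.
      have e1 : p = a → q = b → r = c := by rintro rfl rfl; exact hu _ _ _ _ hpqr h
      have e2 : q = a → p = b → r = c := by rintro rfl rfl; exact hu _ _ _ _ h3 h
      have e3 : q = a → r = b → p = c := by rintro rfl rfl; exact hu _ _ _ _ h1 h
      have e4 : r = a → q = b → p = c := by rintro rfl rfl; exact hu _ _ _ _ h4 h
      have e5 : r = a → p = b → q = c := by rintro rfl rfl; exact hu _ _ _ _ h2 h
      have e6 : p = a → r = b → q = c := by rintro rfl rfl; exact hu _ _ _ _ h5 h
      have f1 : p = b → q = c → r = a := by rintro rfl rfl; exact hu _ _ _ _ hpqr k1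
      have f2 : q = b → p = c → r = a := by rintro rfl rfl; exact hu _ _ _ _ h3 k1
      have f3 : q = b → r = c → p = a := by rintro rfl rfl; exact hu _ _ _ _ h1 k1
      have f4 : r = b → q = c → p = a := by rintro rfl rfl; exact hu _ _ _ _ h4 k1
      have f5 : r = b → p = c → q = a := by rintro rfl rfl; exact hu _ _ _ _ h2 k1
      have f6 : p = b → r = c → q = a := by rintro rfl rfl; exact hu _ _ _ _ h5 k1
      clear h1 h2 h3 h4 h5 k1 k2 hpqr h hu
      grind
    · have e1 : p = a → q = b → False := by rintro rfl rfl; exact h _ hpqr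
      have e2 : q = a → p = b → False := by rintro rfl rfl; exact h _ h3
      have e3 : q = a → r = b → False := by rintro rfl rfl; exact h _ h1
      have e4 : r = a → q = b → False := by rintro rfl rfl; exact h _ h4
      have e5 : r = a → p = b → False := by rintro rfl rfl; exact h _ h2
      have e6 : p = a → r = b → False := by rintro rfl rfl; exact h _ h5
      clear h1 h2 h3 h4 h5 hpqr h hu
      grind

include hu in
-- Converse of `coeffTwo_of_mem_tripleSpan`: the two conditions there characterise the coefficient
-- functions of the span.
lemma exists_mem_tripleSpan [CharZero 𝕜] [Finite 𝒜] (w : 𝒜 → 𝒜 → 𝕜)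
    (h1 : ∀ a b, w b a = -w a b) (h2 : ∀ a b c, DependentTriple 𝒜 a b c → w b c = w a b)
    (h3 : ∀ a b, (∀ c, ¬DependentTriple 𝒜 a b c) → w a b = 0) :
    ∃ x ∈ tripleSpan 𝒜, ∀ a b, coeffTwo a b x = w a b := by
  classical
  have := Fintype.ofFinite 𝒜
  let g : 𝒜 → 𝒜 → E 𝒜 := fun a b =>
    ExteriorAlgebra.ι 𝕜 (gen 𝒜 a) * ExteriorAlgebra.ι 𝕜 (gen 𝒜 b)
  let χ : 𝒜 → 𝒜 → 𝒜 → 𝕜 := fun a b c => if DependentTriple 𝒜 a b c then w a b else 0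
  have hχ : ∀ a b c, χ b c a = χ a b c := by
    intro a b c
    simp only [χ]
    by_cases h : DependentTriple 𝒜 a b c
    · rw [if_pos h, if_pos h.rotate, h2 a b c h]
    · rw [if_neg h, if_neg fun k => h k.rotate.rotate]
  have hsum : ∀ a b, ∑ c, χ a b c = w a b := by
    intro a b
    by_cases h : ∃ c, DependentTriple 𝒜 a b c
    · obtain ⟨c, hc⟩ := h
      rw [Finset.sum_eq_single c (fun d _ hd => if_neg fun h => hd (hu _ _ _ _ h hc)) (by simp)]
      exact if_pos hc
    · rw [h3 a b (not_exists.1 h)]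
      exact Finset.sum_eq_zero fun c _ => if_neg fun hc => h ⟨c, hc⟩
  -- Each line occurs in its six orderings, all with the same contribution, since both the weight
  -- and the relation change sign under a transposition.
  refine ⟨(6 : 𝕜)⁻¹ • ∑ a, ∑ b, ∑ c, χ a b c • tripleRelation a b c, ?_, ?_⟩
  · refine Submodule.smul_mem _ _ (sum_mem fun a _ => sum_mem fun b _ => sum_mem fun c _ => ?_)
    by_cases h : DependentTriple 𝒜 a b c
    · exact Submodule.smul_mem _ _ (Submodule.subset_span ⟨a, b, c, h, rfl⟩)
    · simp [χ, h]
  · have hg : ∀ a b, g b a = -g a b := fun a b =>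
      eq_neg_of_add_eq_zero_left (ExteriorAlgebra.ι_add_mul_swap _ _)
    have key : ∑ a, ∑ b, ∑ c, χ a b c • tripleRelation a b c = (3 : 𝕜) • ∑ a, ∑ b, w a b • g a b := by
      have e : ∀ a b c : 𝒜, tripleRelation a b c = g b c + g c a + g a b := by
        intro a b c
        rw [hg a c]
        simp only [tripleRelation, g]
        abel
      have s1 : ∑ a, ∑ b, ∑ c, χ a b c • g a b = ∑ a, ∑ b, w a b • g a b := by
        simp only [← Finset.sum_smul, hsum]
      have s2 : ∑ a, ∑ b, ∑ c, χ a b c • g b c = ∑ a, ∑ b, w a b • g a b := by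
        rw [← s1, Finset.sum_comm]
        refine Finset.sum_congr rfl fun b _ => ?_
        rw [Finset.sum_comm]
        refine Finset.sum_congr rfl fun c _ => Finset.sum_congr rfl fun a _ => ?_
        rw [hχ a b c]
      have s3 : ∑ a, ∑ b, ∑ c, χ a b c • g c a = ∑ a, ∑ b, w a b • g a b := by
        rw [← s2, Finset.sum_comm]
        refine Finset.sum_congr rfl fun b _ => ?_
        rw [Finset.sum_comm]
        refine Finset.sum_congr rfl fun c _ => Finset.sum_congr rfl fun a _ => ?_
        rw [hχ a b c]
      simp only [e, smul_add, Finset.sum_add_distrib, s1, s2, s3]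
      module
    intro a b
    have hc : coeffTwo a b (∑ x, ∑ y, w x y • g x y) = 2 * w a b := by
      simp only [map_sum, map_smul, g, coeffTwo_gen_mul_gen, smul_eq_mul, mul_sub,
        Finset.sum_sub_distrib]
      have t1 : ∑ x, ∑ y, w x y * ((if x = a then 1 else 0) * (if y = b then 1 else 0)) = w a b := by
        simp [mul_ite, Finset.sum_ite_eq']
      have t2 : ∑ x, ∑ y, w x y * ((if y = a then 1 else 0) * (if x = b then 1 else 0)) = w b a := by
        simp [mul_ite, Finset.sum_ite_eq']
      rw [t1, t2, h1 a b]
      ring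
    rw [key, map_smul, map_smul, hc]
    simp only [smul_eq_mul]
    field_simp
    norm_num

/-- `E¹ ⊗ I²` as the space of families of elements of `I²`. -/
def tensorEquiv (𝒜 : Set (Submodule 𝕜 W)) :
    (⋀[𝕜]^1 (E1 𝒜)) ⊗[𝕜] (osIdealTwo 𝒜) ≃ₗ[𝕜] (𝒜 →₀ osIdealTwo 𝒜) := by
  classical
  exact (TensorProduct.congr (exteriorPower.oneEquiv 𝕜 (E1 𝒜)) (LinearEquiv.refl 𝕜 _)).trans
    (TensorProduct.finsuppScalarLeft 𝕜 (osIdealTwo 𝒜) 𝒜)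

lemma falkMap_tensorEquiv_symm [Fintype 𝒜] (f : 𝒜 →₀ osIdealTwo 𝒜) :
    falkMap 𝒜 ((tensorEquiv 𝒜).symm f) =
      ∑ h, ExteriorAlgebra.ι 𝕜 (gen 𝒜 h) * (f h : E 𝒜) := by
  classical
  induction f using Finsupp.induction_linear with
  | zero => simp
  | add f g hf hg => simp [map_add, hf, hg, mul_add, Finset.sum_add_distrib]
  | single h w =>
    rw [Finset.sum_eq_single h (fun b _ hb => by simp [Finsupp.single_eq_of_ne hb]) (by simp),
      Finsupp.single_eq_same]
    have : (tensorEquiv 𝒜).symm (Finsupp.single h w) =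
        (exteriorPower.oneEquiv 𝕜 (E1 𝒜)).symm (gen 𝒜 h) ⊗ₜ w := by
      simp [tensorEquiv, TensorProduct.finsuppScalarLeft_symm_apply_single, gen]
    rw [this, falkMap, Submodule.mulMap_tmul]
    congr 1
    rw [exteriorPower.oneEquiv_symm_apply]
    simp [ExteriorAlgebra.ιMulti_apply]

include hu in
/-- The Falk invariant of an arrangement without four hyperplanes on a line of the matroid. -/
theorem falkInvariant_eq_finrank_relationSpace [CharZero 𝕜] [Finite 𝒜]
    (h𝒜 : ∀ H ∈ 𝒜, H ≠ ⊤) :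
    falkInvariant 𝒜 = Module.finrank 𝕜 (relationSpace 𝕜 Set.univ (DependentTriple 𝒜)) := by
  have := Fintype.ofFinite 𝒜
  have hI := osIdealTwo_eq h𝒜
  let Ψ : (𝒜 →₀ osIdealTwo 𝒜) →ₗ[𝕜] (𝒜 → 𝒜 → 𝒜 → 𝕜) :=
    { toFun := fun f h x y => coeffTwo x y (f h : E 𝒜)
      map_add' := fun f g => by ext; simp
      map_smul' := fun r f => by ext; simp }
  have hΨ : Function.Injective Ψ := by
    intro f g hfg
    ext1 h
    refine Subtype.ext (sub_eq_zero.1 (eq_zero_of_coeffTwo (f h - g h).2.2 fun x y => ?_))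
    have : coeffTwo x y (f h : E 𝒜) = coeffTwo x y (g h : E 𝒜) :=
      congr_fun (congr_fun (congr_fun hfg h) x) y
    rw [map_sub, this, sub_self]
  -- The coefficients of the product in `E³` are the cyclic sums, and they determine the product.
  have hmul : ∀ f : 𝒜 →₀ osIdealTwo 𝒜, falkMap 𝒜 ((tensorEquiv 𝒜).symm f) = 0 ↔
      ∀ h a b, Ψ f h a b + Ψ f a b h + Ψ f b h a = 0 := by
    classical
    intro f
    have hc : ∀ x y z, coeffThree x y z (falkMap 𝒜 ((tensorEquiv 𝒜).symm f)) =
        Ψ f x y z + Ψ f y z x + Ψ f z x y := by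
      intro x y z
      rw [falkMap_tensorEquiv_symm, map_sum]
      simp only [coeffThree_ι_mul, Finset.sum_add_distrib, gen, Finsupp.single_apply, ite_mul,
        one_mul, zero_mul, Finset.sum_ite_eq', Finset.mem_univ, if_true]
      rfl
    constructor
    · intro h a b c
      rw [← hc, h, map_zero]
    · intro h
      refine eq_zero_of_coeffThree ?_ fun x y z => by rw [hc]; exact h x y z
      rw [falkMap_tensorEquiv_symm]
      exact sum_mem fun h _ => ι_mul_mem_exteriorPower _ (f h).2.2
  have hmap : ((LinearMap.ker (falkMap 𝒜)).map (tensorEquiv 𝒜).toLinearMap).map Ψ =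
      relationSpace 𝕜 Set.univ (DependentTriple 𝒜) := by
    ext z
    rw [mem_relationSpace]
    constructor
    · rintro ⟨_, ⟨t, ht, rfl⟩, rfl⟩
      have ht' := (hmul (tensorEquiv 𝒜 t)).1 (by simpa using ht)
      have hm : ∀ h, ((tensorEquiv 𝒜 t) h : E 𝒜) ∈ tripleSpan 𝒜 := fun h =>
        hI ▸ ((tensorEquiv 𝒜 t) h).2
      exact ⟨fun h a b => coeffTwo_swap _ _ _,
        fun h => (coeffTwo_of_mem_tripleSpan hu (hm h)).1,
        fun h => (coeffTwo_of_mem_tripleSpan hu (hm h)).2, ht',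
        fun h a b hh => absurd (Set.mem_univ h) hh⟩
    · rintro ⟨h1, h2, h3, h4, -⟩
      choose x hx hxz using fun h => exists_mem_tripleSpan hu (z h) (h1 h) (h2 h) (h3 h)
      let f : 𝒜 →₀ osIdealTwo 𝒜 :=
        Finsupp.equivFunOnFinite.symm fun h => ⟨x h, hI ▸ hx h⟩
      have hf : Ψ f = z := by
        ext h a b
        exact hxz h a b
      refine ⟨f, ⟨(tensorEquiv 𝒜).symm f, ?_, by simp⟩, hf⟩
      exact (hmul f).2 (by rw [hf]; exact h4)
  rw [← hmap, ← (Submodule.equivMapOfInjective Ψ hΨ _).finrank_eq, falkInvariant]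
  exact ((tensorEquiv 𝒜).finrank_map_eq _).symm

end Coefficients
end Arrangement
end

/-! ### Signed vertices, symbols and collinearity -/

noncomputable section

/-- The antipode of a signed vertex. -/
def SignedGraph.opp {V : Type*} (u : V × ℤˣ) : V × ℤˣ := (u.1, -u.2)

/-- The symbols `x_i = ε x_j`; the loops are `x_i = -x_i`. -/
abbrev SignedGraph.Symbol (V : Type*) := Sym2 V × ℤˣ

namespace SignedGraph

variable {V : Type*}

/-- The symbol of the hyperplane on which the coordinates of two signed vertices agree. -/
def sym (u v : V × ℤˣ) : Symbol V := (s(u.1, v.1), u.2 * v.2)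

@[simp] lemma opp_fst (u : V × ℤˣ) : (opp u).1 = u.1 := rfl

@[simp] lemma opp_opp (u : V × ℤˣ) : opp (opp u) = u := by simp [opp]

lemma opp_ne (u : V × ℤˣ) : opp u ≠ u := by
  intro h
  have := congr_arg Prod.snd h
  rcases Int.units_eq_one_or u.2 with h1 | h1 <;> simp [opp, h1] at this

lemma eq_or_eq_opp {u v : V × ℤˣ} (h : u.1 = v.1) : u = v ∨ u = opp v := by
  obtain ⟨i, s⟩ := u
  obtain ⟨j, t⟩ := v
  obtain rfl : i = j := h
  rcases Int.units_eq_one_or s with rfl | rfl <;> rcases Int.units_eq_one_or t with rfl | rfl <;>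
    simp [opp]

lemma sym_comm (u v : V × ℤˣ) : sym u v = sym v u := by
  simp [sym, Sym2.eq_swap, mul_comm]

@[simp] lemma sym_opp_opp (u v : V × ℤˣ) : sym (opp u) (opp v) = sym u v := by
  simp [sym, opp]

lemma sym_opp_left (u v : V × ℤˣ) : sym (opp u) v = sym u (opp v) := by
  simp [sym, opp]

/-- A symbol is an unordered edge of the double cover modulo the antipodal map: two orders times two
lifts. -/
lemma sym_eq_iff {u v w x : V × ℤˣ} : sym u v = sym w x ↔
    (u = w ∧ v = x) ∨ (u = x ∧ v = w) ∨ (u = opp w ∧ v = opp x) ∨ (u = opp x ∧ v = opp w) := by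
  constructor
  · intro h
    obtain ⟨i, s⟩ := u
    obtain ⟨j, t⟩ := v
    obtain ⟨k, p⟩ := w
    obtain ⟨l, q⟩ := x
    simp only [sym, Prod.mk.injEq, Sym2.eq_iff] at h
    obtain ⟨h1, h2⟩ := h
    rcases h1 with ⟨rfl, rfl⟩ | ⟨rfl, rfl⟩ <;>
    rcases Int.units_eq_one_or s with rfl | rfl <;> rcases Int.units_eq_one_or t with rfl | rfl <;>
    rcases Int.units_eq_one_or p with rfl | rfl <;> rcases Int.units_eq_one_or q with rfl | rfl <;>
    simp_all [opp]
  · rintro (⟨rfl, rfl⟩ | ⟨rfl, rfl⟩ | ⟨rfl, rfl⟩ | ⟨rfl, rfl⟩)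
    · rfl
    · exact sym_comm _ _
    · exact sym_opp_opp _ _
    · rw [sym_opp_opp, sym_comm]

lemma exists_eq_sym (x : Symbol V) : ∃ u v, x = sym u v := by
  obtain ⟨p, ε⟩ := x
  induction p using Sym2.ind with
  | _ i j => exact ⟨(i, 1), (j, ε), by simp [sym]⟩

/-- Either lift of a vertex of the symbol can serve as starting point, because both ends may be
replaced by their antipodes at once. -/
lemma exists_eq_sym_of_mem {x : Symbol V} {u : V × ℤˣ} (h : u.1 ∈ x.1) : ∃ v, x = sym u v := by
  obtain ⟨v, w, rfl⟩ := exists_eq_sym x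
  rcases Sym2.mem_iff.1 h with h | h <;> rcases eq_or_eq_opp h with rfl | rfl
  · exact ⟨w, rfl⟩
  · exact ⟨opp w, (sym_opp_opp _ _).symm⟩
  · exact ⟨v, sym_comm _ _⟩
  · exact ⟨opp v, by rw [sym_opp_opp, sym_comm]⟩

lemma mem_sym {i : V} {u v : V × ℤˣ} : i ∈ (sym u v).1 ↔ i = u.1 ∨ i = v.1 := Sym2.mem_iff

lemma eq_sym_of_mem_of_mem {x : Symbol V} {u v : V × ℤˣ} (huv : u.1 ≠ v.1) (hu : u.1 ∈ x.1)
    (hv : v.1 ∈ x.1) : x = sym u v ∨ x = sym u (opp v) := by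
  obtain ⟨w, rfl⟩ := exists_eq_sym_of_mem hu
  rcases mem_sym.1 hv with h | h
  · exact absurd h.symm huv
  · rcases eq_or_eq_opp h.symm with rfl | rfl <;> simp

/-- Three distinct symbols whose hyperplanes have a common intersection of codimension two:
`x = y`, `y = z`, `z = x` for signed coordinates `x`, `y`, `z`, or `x = 0`, `y = 0`, `x = y`. -/
def Collinear (a b c : Symbol V) : Prop :=
  (∃ u v w, u ≠ v ∧ v ≠ w ∧ u ≠ w ∧ a = sym u v ∧ b = sym v w ∧ c = sym w u) ∨
  ∃ u v, u.1 ≠ v.1 ∧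
    ((a = sym u v ∧ b = sym u (opp u) ∧ c = sym v (opp v)) ∨
     (a = sym u (opp u) ∧ b = sym u v ∧ c = sym v (opp v)) ∨
     (a = sym u (opp u) ∧ b = sym v (opp v) ∧ c = sym u v))

lemma Collinear.swap {a b c : Symbol V} (h : Collinear a b c) : Collinear b a c := by
  rcases h with ⟨u, v, w, h1, h2, h3, rfl, rfl, rfl⟩ |
    ⟨u, v, h, ⟨rfl, rfl, rfl⟩ | ⟨rfl, rfl, rfl⟩ | ⟨rfl, rfl, rfl⟩⟩
  · exact Or.inl ⟨w, v, u, h2.symm, h1.symm, h3.symm, sym_comm _ _, sym_comm _ _, sym_comm _ _⟩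
  · exact Or.inr ⟨u, v, h, by simp⟩
  · exact Or.inr ⟨u, v, h, by simp⟩
  · exact Or.inr ⟨v, u, h.symm, by simp [sym_comm u v]⟩

lemma Collinear.rotate {a b c : Symbol V} (h : Collinear a b c) : Collinear b c a := by
  rcases h with ⟨u, v, w, h1, h2, h3, rfl, rfl, rfl⟩ |
    ⟨u, v, h, ⟨rfl, rfl, rfl⟩ | ⟨rfl, rfl, rfl⟩ | ⟨rfl, rfl, rfl⟩⟩
  · exact Or.inl ⟨v, w, u, h2, h3.symm, h1.symm, rfl, rfl, rfl⟩
  · exact Or.inr ⟨u, v, h, by simp⟩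
  · exact Or.inr ⟨v, u, h.symm, by simp [sym_comm u v]⟩
  · exact Or.inr ⟨v, u, h.symm, by simp [sym_comm u v]⟩

lemma Collinear.ne {a b c : Symbol V} (h : Collinear a b c) : a ≠ b := by
  have k1 := @opp_ne V
  rcases h with ⟨u, v, w, h1, h2, h3, rfl, rfl, rfl⟩ |
    ⟨u, v, h, ⟨rfl, rfl, rfl⟩ | ⟨rfl, rfl, rfl⟩ | ⟨rfl, rfl, rfl⟩⟩ <;> rw [Ne, sym_eq_iff]
  · grind [opp_opp]
  · grind [opp_fst]
  · grind [opp_fst]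
  · grind [opp_fst]

lemma collinear_sym {u v w : V × ℤˣ} (h1 : u ≠ v) (h2 : v ≠ w) (h3 : u ≠ w) :
    Collinear (sym u v) (sym v w) (sym u w) :=
  Or.inl ⟨u, v, w, h1, h2, h3, rfl, rfl, sym_comm _ _⟩

lemma collinear_loops {u v : V × ℤˣ} (h : u.1 ≠ v.1) :
    Collinear (sym u (opp u)) (sym v (opp v)) (sym u v) :=
  Or.inr ⟨u, v, h, by simp⟩

/-- The third points of lines through two symbols with a common vertex. -/
lemma Collinear.eq_of_sym_sym {u v w : V × ℤˣ} {c : Symbol V}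
    (h : Collinear (sym u v) (sym v w) c) (hu : u ≠ v) (hw : v ≠ w) (huw : u ≠ w) : c = sym u w ∨
    (w = opp v ∧ c = sym u (opp u)) ∨ (u = opp v ∧ c = sym w (opp w)) ∨
    (u = opp w ∧ c = sym v (opp v)) := by
  rcases h with ⟨u', v', w', h1, h2, h3, ha, hb, rfl⟩ |
    ⟨u', v', h, ⟨ha, hb, rfl⟩ | ⟨ha, hb, rfl⟩ | ⟨ha, hb, rfl⟩⟩ <;>
  rw [sym_eq_iff] at ha hb
  · rcases ha with ⟨rfl, rfl⟩ | ⟨rfl, rfl⟩ | ⟨rfl, rfl⟩ | ⟨rfl, rfl⟩ <;>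
    grind [opp_opp, opp_ne, sym_comm, sym_opp_opp]
  · rcases ha with ⟨rfl, rfl⟩ | ⟨rfl, rfl⟩ | ⟨rfl, rfl⟩ | ⟨rfl, rfl⟩ <;>
    grind [opp_opp, opp_ne, sym_comm, sym_opp_opp]
  · rcases ha with ⟨rfl, rfl⟩ | ⟨rfl, rfl⟩ | ⟨rfl, rfl⟩ | ⟨rfl, rfl⟩ <;>
    grind [opp_opp, opp_ne, sym_comm, sym_opp_opp]
  · rcases ha with ⟨rfl, rfl⟩ | ⟨rfl, rfl⟩ | ⟨rfl, rfl⟩ | ⟨rfl, rfl⟩ <;>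
    grind [opp_opp, opp_ne, sym_comm, sym_opp_opp, opp_fst]

/-- Every vertex of a line belongs to two of its symbols. -/
lemma Collinear.mem_or_mem {a b c : Symbol V} (h : Collinear a b c) {i : V} (hi : i ∈ a.1) :
    i ∈ b.1 ∨ i ∈ c.1 := by
  rcases h with ⟨u', v', w', h1, h2, h3, rfl, rfl, rfl⟩ |
    ⟨u', v', h, ⟨rfl, rfl, rfl⟩ | ⟨rfl, rfl, rfl⟩ | ⟨rfl, rfl, rfl⟩⟩ <;>
  simp only [mem_sym, opp_fst] at * <;> tauto

lemma Collinear.eq_of_loops {u v : V × ℤˣ} {c : Symbol V} (huv : u.1 ≠ v.1)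
    (h : Collinear (sym u (opp u)) (sym v (opp v)) c) : c = sym u v ∨ c = sym u (opp v) := by
  refine eq_sym_of_mem_of_mem huv ?_ ?_
  · have := h.mem_or_mem (i := u.1) (by simp [mem_sym])
    simpa [mem_sym, huv] using this
  · have := h.swap.mem_or_mem (i := v.1) (by simp [mem_sym])
    simpa [mem_sym, huv.symm] using this

/-- A symbol on two vertices and a symbol on other vertices do not lie on a line. -/
lemma not_collinear_of_disjoint {u v : V × ℤˣ} {b c : Symbol V} (huv : u.1 ≠ v.1)
    (hu : u.1 ∉ b.1) (hv : v.1 ∉ b.1) : ¬Collinear (sym u v) b c := by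
  intro h
  have h1 := (h.mem_or_mem (i := u.1) (by simp [mem_sym])).resolve_left hu
  have h2 := (h.mem_or_mem (i := v.1) (by simp [mem_sym])).resolve_left hv
  obtain ⟨w, x, rfl⟩ := exists_eq_sym b
  have h3 := (h.swap.mem_or_mem (i := w.1) (by simp [mem_sym]))
  rcases eq_sym_of_mem_of_mem huv h1 h2 with rfl | rfl <;>
  · simp only [mem_sym, opp_fst] at *
    grind

/-- The combinatorial trace of a linear relation with three nonzero coefficients: a coordinate that
occurs in one form must occur in another. Besides lines, only unbalanced triangles pass this test,
and signs rule them out in `collinear_of_dependent`. -/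
lemma collinear_of_mem_or_mem {a b c : Symbol V} (hab : a ≠ b) (hbc : b ≠ c) (hac : a ≠ c)
    (ha : ∀ u, a ≠ sym u u) (hb : ∀ u, b ≠ sym u u) (hc : ∀ u, c ≠ sym u u)
    (h1 : ∀ i ∈ a.1, i ∈ b.1 ∨ i ∈ c.1) (h2 : ∀ i ∈ b.1, i ∈ a.1 ∨ i ∈ c.1)
    (h3 : ∀ i ∈ c.1, i ∈ a.1 ∨ i ∈ b.1) : Collinear a b c ∨
      ∃ u v w, u.1 ≠ v.1 ∧ v.1 ≠ w.1 ∧ u.1 ≠ w.1 ∧ a = sym u v ∧ b = sym v w ∧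
        c = sym u (opp w) := by
  have loop : ∀ (x : Symbol V) (v : V × ℤˣ), (∀ u, x ≠ sym u u) → (∀ i ∈ x.1, i = v.1) →
      x = sym v (opp v) := by
    intro x v hx hi
    obtain ⟨y, t, rfl⟩ := exists_eq_sym x
    have e1 := hi y.1 (by simp [mem_sym])
    have e2 := hi t.1 (by simp [mem_sym])
    rcases eq_or_eq_opp e1 with rfl | rfl <;> rcases eq_or_eq_opp e2 with rfl | rfl
    · exact absurd rfl (hx _)
    · rfl
    · exact sym_comm _ _
    · exact absurd (sym_opp_opp _ _) (hx _)
  -- With a common vertex lifted to `v`, the symbols are `a = uv` and `b = vw`; the coincidences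
  -- among the vertices below `u`, `v`, `w` decide the type.
  by_cases hs : ∃ i, i ∈ a.1 ∧ i ∈ b.1
  · obtain ⟨i, hia, hib⟩ := hs
    obtain ⟨u, hu⟩ := exists_eq_sym_of_mem (u := (i, 1)) hia
    obtain ⟨w, rfl⟩ := exists_eq_sym_of_mem (u := (i, 1)) hib
    generalize hv : ((i, 1) : V × ℤˣ) = v at *
    rw [sym_comm] at hu
    subst hu
    clear hia hib hv
    have huv : u ≠ v := by rintro rfl; exact ha _ rfl
    have hvw : v ≠ w := by rintro rfl; exact hb _ rfl
    have huw : u ≠ w := by rintro rfl; exact hab (sym_comm _ _)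
    simp only [mem_sym, forall_eq_or_imp, forall_eq, true_or, or_true, true_and, and_true] at h1 h2 h3
    by_cases e1 : u.1 = v.1
    · obtain rfl := (eq_or_eq_opp e1).resolve_left huv
      have e3 : v.1 ≠ w.1 := by
        intro e
        rcases eq_or_eq_opp e with rfl | rfl
        · exact hvw rfl
        · simp at huw
      have hw : w.1 ∈ c.1 := by
        simpa [e3.symm] using h2
      by_cases e4 : v.1 ∈ c.1
      · rcases eq_sym_of_mem_of_mem e3 e4 hw with rfl | rfl
        · exact absurd rfl hbc
        · left
          exact Or.inl ⟨opp v, v, w, huv, hvw, huw, rfl, rfl, by rw [sym_comm, sym_opp_left]⟩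
      · have := loop c w hc fun i hi => by
          rcases h3 i hi with h | h
          · simp only [opp_fst, or_self] at h; subst h; exact absurd hi e4
          · rcases h with h | h
            · subst h; exact absurd hi e4
            · exact h
        subst this
        left
        exact Or.inr ⟨v, w, e3, Or.inr (Or.inl ⟨sym_comm _ _, rfl, rfl⟩)⟩
    · by_cases e2 : v.1 = w.1
      · obtain rfl : w = opp v := (eq_or_eq_opp e2.symm).resolve_left hvw.symm
        have hu : u.1 ∈ c.1 := by simpa [e1] using h1
        by_cases e4 : v.1 ∈ c.1
        · rcases eq_sym_of_mem_of_mem e1 hu e4 with rfl | rfl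
          · exact absurd rfl hac
          · left
            exact Or.inl ⟨u, v, opp v, huv, hvw, huw, rfl, rfl, sym_comm _ _⟩
        · have := loop c u hc fun i hi => by
            rcases h3 i hi with h | h
            · rcases h with h | h
              · exact h
              · subst h; exact absurd hi e4
            · simp only [opp_fst, or_self] at h; subst h; exact absurd hi e4
          subst this
          left
          exact Or.inr ⟨v, u, fun h => e1 h.symm, Or.inl ⟨sym_comm _ _, rfl, rfl⟩⟩
      · by_cases e3 : u.1 = w.1
        · obtain rfl : w = opp u := (eq_or_eq_opp e3.symm).resolve_left huw.symm
          by_cases e4 : v.1 ∈ c.1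
          · by_cases e5 : u.1 ∈ c.1
            · rcases eq_sym_of_mem_of_mem e1 e5 e4 with rfl | rfl
              · exact absurd rfl hac
              · exact absurd (by rw [sym_comm, sym_opp_left]) hbc
            · have := loop c v hc fun i hi => by
                rcases h3 i hi with h | h <;> rcases h with h | h
                · subst h; exact absurd hi e5
                · exact h
                · exact h
                · rw [opp_fst] at h; subst h; exact absurd hi e5
              subst this
              left
              exact Or.inl ⟨v, u, opp v, huv.symm, fun h => e1 (by rw [h]; rfl), (opp_ne v).symm,
                sym_comm _ _, by rw [sym_comm, sym_opp_left], sym_comm _ _⟩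
          · have := loop c u hc fun i hi => by
              rcases h3 i hi with h | h <;> rcases h with h | h
              · exact h
              · subst h; exact absurd hi e4
              · subst h; exact absurd hi e4
              · exact h
            subst this
            left
            exact Or.inl ⟨u, v, opp u, huv, hvw, huw, rfl, rfl, sym_comm _ _⟩
        · have hu : u.1 ∈ c.1 := by simpa [e1, e3] using h1
          have hw : w.1 ∈ c.1 := by simpa [Ne.symm e2, Ne.symm e3] using h2
          rcases eq_sym_of_mem_of_mem e3 hu hw with rfl | rfl
          · exact Or.inl (collinear_sym huv hvw huw)
          · exact Or.inr ⟨u, v, w, e1, e2, e3, rfl, rfl, rfl⟩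
  -- Without a common vertex `c` contains all vertices of `a` and `b`. It has at most two, so `a`
  -- and `b` are loops and `c` joins them.
  · obtain ⟨u, v, rfl⟩ := exists_eq_sym a
    obtain ⟨w, x, rfl⟩ := exists_eq_sym b
    simp only [mem_sym, not_exists, not_and, forall_eq_or_imp, forall_eq] at *
    obtain ⟨⟨n1, n2⟩, n3, n4⟩ : (¬(u.1 = w.1) ∧ ¬(u.1 = x.1)) ∧ ¬(v.1 = w.1) ∧ ¬(v.1 = x.1) := by
      grind
    have hu : u.1 ∈ c.1 := by grind
    have hv : v.1 ∈ c.1 := by grind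
    have hw : w.1 ∈ c.1 := by grind
    have hx : x.1 ∈ c.1 := by grind
    obtain ⟨y, t, rfl⟩ := exists_eq_sym c
    simp only [mem_sym] at hu hv hw hx
    have e1 : v.1 = u.1 := by grind
    have e2 : x.1 = w.1 := by grind
    obtain rfl : v = opp u := (eq_or_eq_opp e1).resolve_left (by rintro rfl; exact ha _ rfl)
    obtain rfl : x = opp w := (eq_or_eq_opp e2).resolve_left (by rintro rfl; exact hb _ rfl)
    left
    rcases eq_sym_of_mem_of_mem (x := sym y t) n1 (mem_sym.2 hu) (mem_sym.2 hw) with h | h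
    · rw [h]; exact collinear_loops n1
    · rw [h]
      have := collinear_loops (u := u) (v := opp w) n1
      rwa [opp_opp, sym_comm (opp w)] at this

end SignedGraph
end

/-! ### Hyperplanes of symbols: linear dependence is collinearity -/

noncomputable section

/-- Transport of `relationSpace` along an injection of the points. -/
lemma finrank_relationSpace_eq {𝕜 : Type*} [Field 𝕜] {ι κ : Type*} (f : ι → κ)
    (hf : Function.Injective f) {A : Set κ} (hA : Set.range f = A) {tri : ι → ι → ι → Prop}
    {tri' : κ → κ → κ → Prop} (h : ∀ a b c, tri a b c ↔ tri' (f a) (f b) (f c))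
    (hA' : ∀ a b c, tri' a b c → a ∈ A ∧ b ∈ A ∧ c ∈ A) :
    Module.finrank 𝕜 (relationSpace 𝕜 Set.univ tri) =
      Module.finrank 𝕜 (relationSpace 𝕜 A tri') := by
  classical
  subst hA
  let Ψ : (κ → κ → κ → 𝕜) →ₗ[𝕜] (ι → ι → ι → 𝕜) :=
    { toFun := fun z a b c => z (f a) (f b) (f c)
      map_add' := fun _ _ => rfl
      map_smul' := fun _ _ => rfl }
  have zero : ∀ z ∈ relationSpace 𝕜 (Set.range f) tri', ∀ a b c,
      (a ∉ Set.range f ∨ b ∉ Set.range f ∨ c ∉ Set.range f) → z a b c = 0 := by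
    rintro z ⟨-, -, h3, -, h5⟩ a b c (h | h | h)
    · exact h5 _ _ _ h
    · exact h3 _ _ _ fun d hd => h (hA' _ _ _ hd).1
    · exact h3 _ _ _ fun d hd => h (hA' _ _ _ hd).2.1
  let Φ : relationSpace 𝕜 (Set.range f) tri' →ₗ[𝕜] relationSpace 𝕜 Set.univ tri :=
    (Ψ.domRestrict _).codRestrict _ (by
      rintro ⟨z, h1, h2, h3, h4, h5⟩
      refine ⟨fun _ _ _ => h1 _ _ _, fun x a b c t => h2 _ _ _ _ ((h _ _ _).1 t),
        fun x a b t => h3 _ _ _ ?_, fun _ _ _ => h4 _ _ _, fun _ _ _ h => absurd trivial h⟩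
      intro d hd
      obtain ⟨d, rfl⟩ := (hA' _ _ _ hd).2.2
      exact t d ((h _ _ _).2 hd))
  refine (LinearEquiv.ofBijective Φ ⟨?_, ?_⟩).finrank_eq.symm
  · rintro ⟨z, hz⟩ ⟨w, hw⟩ hzw
    have hzw' : ∀ a b c, z (f a) (f b) (f c) = w (f a) (f b) (f c) := fun a b c =>
      congr_fun (congr_fun (congr_fun (congr_arg Subtype.val hzw) a) b) c
    refine Subtype.ext (funext fun a => funext fun b => funext fun c => ?_)
    by_cases hh : a ∉ Set.range f ∨ b ∉ Set.range f ∨ c ∉ Set.range f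
    · exact (zero z hz a b c hh).trans (zero w hw a b c hh).symm
    · push Not at hh
      obtain ⟨⟨a, rfl⟩, ⟨b, rfl⟩, ⟨c, rfl⟩⟩ := hh
      exact hzw' a b c
  · rintro ⟨z, h1, h2, h3, h4, h5⟩
    let w : κ → κ → κ → 𝕜 := fun a b c =>
      if h : a ∈ Set.range f ∧ b ∈ Set.range f ∧ c ∈ Set.range f then
        z h.1.choose h.2.1.choose h.2.2.choose else 0
    have hw : ∀ a b c, w (f a) (f b) (f c) = z a b c := by
      intro a b c
      have hh : f a ∈ Set.range f ∧ f b ∈ Set.range f ∧ f c ∈ Set.range f :=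
        ⟨⟨a, rfl⟩, ⟨b, rfl⟩, ⟨c, rfl⟩⟩
      simp only [w, dif_pos hh]
      rw [hf hh.1.choose_spec, hf hh.2.1.choose_spec, hf hh.2.2.choose_spec]
    have hw0 : ∀ a b c, (a ∉ Set.range f ∨ b ∉ Set.range f ∨ c ∉ Set.range f) → w a b c = 0 := by
      intro a b c hh
      exact dif_neg (by tauto)
    refine ⟨⟨w, ?_, ?_, ?_, ?_, ?_⟩, ?_⟩
    · intro x a b
      by_cases hh : x ∉ Set.range f ∨ a ∉ Set.range f ∨ b ∉ Set.range f
      · rw [hw0 _ _ _ hh, hw0 _ _ _ (by tauto), neg_zero]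
      · push Not at hh
        obtain ⟨⟨x, rfl⟩, ⟨a, rfl⟩, ⟨b, rfl⟩⟩ := hh
        rw [hw, hw, h1]
    · intro x a b c t
      obtain ⟨⟨a, rfl⟩, ⟨b, rfl⟩, ⟨c, rfl⟩⟩ := hA' _ _ _ t
      by_cases hh : x ∈ Set.range f
      · obtain ⟨x, rfl⟩ := hh
        rw [hw, hw, h2 x a b c ((h _ _ _).2 t)]
      · rw [hw0 _ _ _ (Or.inl hh), hw0 _ _ _ (Or.inl hh)]
    · intro x a b t
      by_cases hh : x ∉ Set.range f ∨ a ∉ Set.range f ∨ b ∉ Set.range f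
      · rw [hw0 _ _ _ hh]
      · push Not at hh
        obtain ⟨⟨x, rfl⟩, ⟨a, rfl⟩, ⟨b, rfl⟩⟩ := hh
        rw [hw, h3 x a b fun c hc => t _ ((h _ _ _).1 hc)]
    · intro x a b
      by_cases hh : x ∉ Set.range f ∨ a ∉ Set.range f ∨ b ∉ Set.range f
      · rw [hw0 _ _ _ hh, hw0 _ _ _ (by tauto), hw0 _ _ _ (by tauto)]; simp
      · push Not at hh
        obtain ⟨⟨x, rfl⟩, ⟨a, rfl⟩, ⟨b, rfl⟩⟩ := hh
        rw [hw, hw, hw, h4]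
    · intro x a b hx
      exact hw0 _ _ _ (Or.inl hx)
    · refine Subtype.ext (funext fun a => funext fun b => funext fun c => ?_)
      exact hw a b c

namespace SignedGraph

variable {V : Type*} {𝕜 : Type*} [Field 𝕜]

variable (𝕜) in
/-- The coordinate of a signed vertex. -/
def signedCoord (u : V × ℤˣ) : Module.Dual 𝕜 (V → 𝕜) :=
  ((u.2 : ℤ) : 𝕜) • LinearMap.proj u.1

lemma signedCoord_apply (u : V × ℤˣ) (x : V → 𝕜) :
    signedCoord 𝕜 u x = ((u.2 : ℤ) : 𝕜) * x u.1 := rfl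

@[simp] lemma signedCoord_opp (u : V × ℤˣ) : signedCoord 𝕜 (opp u) = -signedCoord 𝕜 u := by
  ext1 x
  rw [LinearMap.neg_apply, signedCoord_apply, signedCoord_apply]
  simp [opp]

variable (𝕜) in
/-- The linear form of a symbol. -/
def symForm (u v : V × ℤˣ) : Module.Dual 𝕜 (V → 𝕜) := signedCoord 𝕜 u - signedCoord 𝕜 v

variable (𝕜) in
/-- The hyperplane of a symbol. -/
def plane (x : Symbol V) : Submodule 𝕜 (V → 𝕜) :=
  ⨅ (p : (V × ℤˣ) × (V × ℤˣ)) (_ : x = sym p.1 p.2), LinearMap.ker (symForm 𝕜 p.1 p.2)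

/-- The forms of the four representatives agree up to sign, so the infimum is the kernel of any one
of them. -/
lemma plane_sym (u v : V × ℤˣ) : plane 𝕜 (sym u v) = LinearMap.ker (symForm 𝕜 u v) := by
  apply le_antisymm
  · exact iInf_le_of_le (u, v) (iInf_le_of_le rfl le_rfl)
  · refine le_iInf₂ fun p hp x hx => ?_
    obtain ⟨p, q⟩ := p
    simp only [symForm, LinearMap.mem_ker, LinearMap.sub_apply, sub_eq_zero] at hx ⊢
    rcases sym_eq_iff.1 hp with ⟨rfl, rfl⟩ | ⟨rfl, rfl⟩ | ⟨rfl, rfl⟩ | ⟨rfl, rfl⟩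
    · exact hx
    · exact hx.symm
    · simpa using hx
    · simpa using hx.symm

lemma mem_plane_sym {u v : V × ℤˣ} {x : V → 𝕜} :
    x ∈ plane 𝕜 (sym u v) ↔ signedCoord 𝕜 u x = signedCoord 𝕜 v x := by
  rw [plane_sym, LinearMap.mem_ker, symForm, LinearMap.sub_apply, sub_eq_zero]

lemma unit_cast_ne_zero (s : ℤˣ) : ((s : ℤ) : 𝕜) ≠ 0 := by
  rcases Int.units_eq_one_or s with rfl | rfl <;> simp

lemma unit_cast_mul_self (s : ℤˣ) : ((s : ℤ) : 𝕜) * ((s : ℤ) : 𝕜) = 1 := by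
  rcases Int.units_eq_one_or s with rfl | rfl <;> simp

/-- Basis vectors detect the vertices of a symbol. For a loop the form is twice a coordinate, hence
the use of characteristic zero. -/
lemma single_mem_plane [CharZero 𝕜] [DecidableEq V] {a : Symbol V} (ha : ∀ u, a ≠ sym u u)
    {i : V} : Pi.single i (1 : 𝕜) ∈ plane 𝕜 a ↔ i ∉ a.1 := by
  constructor
  · intro h hi
    obtain ⟨v, rfl⟩ := exists_eq_sym_of_mem (u := (i, 1)) hi
    rw [mem_plane_sym, signedCoord_apply, signedCoord_apply] at h
    by_cases hv : v.1 = i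
    · obtain rfl : v = opp (i, 1) :=
        (eq_or_eq_opp (u := v) (v := (i, 1)) hv).resolve_left (by rintro rfl; exact ha _ rfl)
      simp only [Units.val_one, Int.cast_one, Pi.single_eq_same, mul_one, opp, Units.val_neg,
        Int.cast_neg] at h
      exact two_ne_zero (α := 𝕜) (by linear_combination h)
    · rw [Pi.single_eq_same, Pi.single_eq_of_ne hv] at h
      simp at h
  · intro hi
    obtain ⟨u, v, rfl⟩ := exists_eq_sym a
    rw [mem_sym, not_or] at hi
    rw [mem_plane_sym, signedCoord_apply, signedCoord_apply,
      Pi.single_eq_of_ne (Ne.symm hi.1), Pi.single_eq_of_ne (Ne.symm hi.2), mul_zero, mul_zero]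

lemma plane_ne_top [CharZero 𝕜] {a : Symbol V} (ha : ∀ u, a ≠ sym u u) : plane 𝕜 a ≠ ⊤ := by
  classical
  intro h
  obtain ⟨u, v, e⟩ := exists_eq_sym a
  have h1 := (single_mem_plane (𝕜 := 𝕜) ha (i := u.1)).1 (h ▸ Submodule.mem_top)
  exact h1 (by rw [e, mem_sym]; exact Or.inl rfl)

/-- Basis vectors recover the vertices. For an edge the remaining ambiguity is the sign, settled by
the vector on which both signed coordinates are `1`. -/
lemma plane_injOn [CharZero 𝕜] {a b : Symbol V} (ha : ∀ u, a ≠ sym u u) (hb : ∀ u, b ≠ sym u u)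
    (h : plane 𝕜 a = plane 𝕜 b) : a = b := by
  classical
  have hs : ∀ i, i ∈ a.1 ↔ i ∈ b.1 := fun i => by
    rw [← not_iff_not, ← single_mem_plane (𝕜 := 𝕜) ha, ← single_mem_plane (𝕜 := 𝕜) hb, h]
  obtain ⟨u, v, rfl⟩ := exists_eq_sym a
  by_cases huv : u.1 = v.1
  · obtain rfl := (eq_or_eq_opp huv).resolve_left (by rintro rfl; exact ha _ rfl)
    obtain ⟨w, rfl⟩ := exists_eq_sym_of_mem (u := v) ((hs v.1).1 (by simp [mem_sym]))
    have hw : w.1 = v.1 := by simpa [mem_sym] using (hs w.1).2 (by simp [mem_sym])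
    rcases eq_or_eq_opp hw with rfl | rfl
    · exact absurd rfl (hb _)
    · exact sym_comm _ _
  · rcases eq_sym_of_mem_of_mem huv ((hs u.1).1 (by simp [mem_sym]))
      ((hs v.1).1 (by simp [mem_sym])) with rfl | rfl
    · rfl
    · exfalso
      have h1 : (((u.2 : ℤ) : 𝕜) • Pi.single u.1 (1 : 𝕜) + ((v.2 : ℤ) : 𝕜) • Pi.single v.1 (1 : 𝕜)
          : V → 𝕜) ∈ plane 𝕜 (sym u v) := by
        rw [mem_plane_sym]
        simp [signedCoord_apply, huv, Ne.symm huv, unit_cast_mul_self]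
      rw [h, mem_plane_sym, signedCoord_opp] at h1
      simp [signedCoord_apply, huv, Ne.symm huv, unit_cast_mul_self] at h1
      exact two_ne_zero (α := 𝕜) (by linear_combination h1)

lemma eq_zero_of_smul_add_smul {W : Type*} [AddCommGroup W] [Module 𝕜 W]
    {α β : Module.Dual 𝕜 W} (hα : α ≠ 0) (hβ : β ≠ 0)
    (h : LinearMap.ker α ≠ LinearMap.ker β) {p q : 𝕜} (hpq : p • α + q • β = 0) :
    p = 0 ∧ q = 0 := by
  by_cases hp : p = 0
  · subst hp
    rw [zero_smul, zero_add, smul_eq_zero] at hpq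
    exact ⟨rfl, hpq.resolve_right hβ⟩
  · by_cases hq : q = 0
    · subst hq
      rw [zero_smul, add_zero, smul_eq_zero] at hpq
      exact ⟨hpq.resolve_right hα, rfl⟩
    · exfalso
      apply h
      rw [← LinearMap.ker_smul α p hp, ← LinearMap.ker_smul β q hq, eq_neg_of_add_eq_zero_left hpq]
      ext x
      simp

/-- The planes are pairwise distinct, so all three coefficients of a relation are nonzero.
Evaluation at basis vectors then gives the covering conditions of `collinear_of_mem_or_mem`. -/
lemma collinear_of_dependent [CharZero 𝕜] {a b c : Symbol V} (hab : a ≠ b) (hbc : b ≠ c)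
    (hac : a ≠ c) (ha : ∀ u, a ≠ sym u u) (hb : ∀ u, b ≠ sym u u) (hc : ∀ u, c ≠ sym u u)
    {α : Fin 3 → Module.Dual 𝕜 (V → 𝕜)} (h0 : LinearMap.ker (α 0) = plane 𝕜 a)
    (h1 : LinearMap.ker (α 1) = plane 𝕜 b) (h2 : LinearMap.ker (α 2) = plane 𝕜 c)
    (hα : ¬LinearIndependent 𝕜 α) : Collinear a b c := by
  classical
  have ne : ∀ (β : Module.Dual 𝕜 (V → 𝕜)) (x : Symbol V), (∀ u, x ≠ sym u u) →
      LinearMap.ker β = plane 𝕜 x → β ≠ 0 := by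
    rintro β x hx hβ rfl
    exact plane_ne_top hx (by rw [← hβ, LinearMap.ker_zero])
  have nea := ne _ _ ha h0
  have neb := ne _ _ hb h1
  have nec := ne _ _ hc h2
  have kab : LinearMap.ker (α 0) ≠ LinearMap.ker (α 1) := by
    rw [h0, h1]; exact fun h => hab (plane_injOn ha hb h)
  have kbc : LinearMap.ker (α 1) ≠ LinearMap.ker (α 2) := by
    rw [h1, h2]; exact fun h => hbc (plane_injOn hb hc h)
  have kac : LinearMap.ker (α 0) ≠ LinearMap.ker (α 2) := by
    rw [h0, h2]; exact fun h => hac (plane_injOn ha hc h)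
  rw [Fintype.linearIndependent_iff] at hα
  push Not at hα
  obtain ⟨g, hg, k, hk⟩ := hα
  rw [Fin.sum_univ_three] at hg
  have all : ¬(g 0 = 0 ∧ g 1 = 0 ∧ g 2 = 0) := by
    rintro ⟨e0, e1, e2⟩
    fin_cases k
    exacts [hk e0, hk e1, hk e2]
  have g0 : g 0 ≠ 0 := by
    intro e
    rw [e, zero_smul, zero_add] at hg
    exact all ⟨e, eq_zero_of_smul_add_smul neb nec kbc hg⟩
  have g1 : g 1 ≠ 0 := by
    intro e
    rw [e, zero_smul, add_zero] at hg
    have := eq_zero_of_smul_add_smul nea nec kac hg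
    exact all ⟨this.1, e, this.2⟩
  have g2 : g 2 ≠ 0 := by
    intro e
    rw [e, zero_smul, add_zero] at hg
    have := eq_zero_of_smul_add_smul nea neb kab hg
    exact all ⟨this.1, this.2, e⟩
  have ev : ∀ x, g 0 * α 0 x + g 1 * α 1 x + g 2 * α 2 x = 0 := fun x => by
    simpa using LinearMap.congr_fun hg x
  have m0 : ∀ x, α 0 x = 0 ↔ x ∈ plane 𝕜 a := fun x => by rw [← h0, LinearMap.mem_ker]
  have m1 : ∀ x, α 1 x = 0 ↔ x ∈ plane 𝕜 b := fun x => by rw [← h1, LinearMap.mem_ker]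
  have m2 : ∀ x, α 2 x = 0 ↔ x ∈ plane 𝕜 c := fun x => by rw [← h2, LinearMap.mem_ker]
  have cov := collinear_of_mem_or_mem hab hbc hac ha hb hc ?_ ?_ ?_
  · refine cov.resolve_right ?_
    rintro ⟨u, v, w, huv, hvw, huw, rfl, rfl, rfl⟩
    -- All three signed coordinates of this vector are `1`: it lies on the first two planes of the
    -- unbalanced triangle but not on the third.
    let x : V → 𝕜 := ((u.2 : ℤ) : 𝕜) • Pi.single u.1 (1 : 𝕜) +
      ((v.2 : ℤ) : 𝕜) • Pi.single v.1 (1 : 𝕜) + ((w.2 : ℤ) : 𝕜) • Pi.single w.1 (1 : 𝕜)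
    have xu : signedCoord 𝕜 u x = 1 := by
      simp [signedCoord_apply, x, huv, huw, unit_cast_mul_self]
    have xv : signedCoord 𝕜 v x = 1 := by
      simp [signedCoord_apply, x, huv.symm, hvw, unit_cast_mul_self]
    have xw : signedCoord 𝕜 w x = 1 := by
      simp [signedCoord_apply, x, hvw.symm, huw.symm, unit_cast_mul_self]
    have e := ev x
    rw [(m0 x).2 (by rw [mem_plane_sym, xu, xv]), (m1 x).2 (by rw [mem_plane_sym, xv, xw]),
      mul_zero, mul_zero, zero_add, zero_add, mul_eq_zero, m2, mem_plane_sym, signedCoord_opp,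
      LinearMap.neg_apply, xu, xw] at e
    have e' := e.resolve_left g2
    exact two_ne_zero (α := 𝕜) (by linear_combination e')
  · intro i hi
    by_contra! hcon
    have e := ev (Pi.single i 1)
    rw [(m1 _).2 ((single_mem_plane hb).2 hcon.1), (m2 _).2 ((single_mem_plane hc).2 hcon.2),
      mul_zero, mul_zero, add_zero, add_zero, mul_eq_zero, m0, single_mem_plane ha] at e
    exact e.elim g0 fun h => h hi
  · intro i hi
    by_contra! hcon
    have e := ev (Pi.single i 1)
    rw [(m0 _).2 ((single_mem_plane ha).2 hcon.1), (m2 _).2 ((single_mem_plane hc).2 hcon.2),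
      mul_zero, mul_zero, add_zero, zero_add, mul_eq_zero, m1, single_mem_plane hb] at e
    exact e.elim g1 fun h => h hi
  · intro i hi
    by_contra! hcon
    have e := ev (Pi.single i 1)
    rw [(m0 _).2 ((single_mem_plane ha).2 hcon.1), (m1 _).2 ((single_mem_plane hb).2 hcon.2),
      mul_zero, mul_zero, add_zero, zero_add, mul_eq_zero, m2, single_mem_plane hc] at e
    exact e.elim g2 fun h => h hi

lemma Collinear.exists_dependent {a b c : Symbol V} (h : Collinear a b c) :
    ∃ α : Fin 3 → Module.Dual 𝕜 (V → 𝕜), LinearMap.ker (α 0) = plane 𝕜 a ∧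
      LinearMap.ker (α 1) = plane 𝕜 b ∧ LinearMap.ker (α 2) = plane 𝕜 c ∧
      ¬LinearIndependent 𝕜 α := by
  rcases h with ⟨u, v, w, h1, h2, h3, rfl, rfl, rfl⟩ |
    ⟨u, v, h, ⟨rfl, rfl, rfl⟩ | ⟨rfl, rfl, rfl⟩ | ⟨rfl, rfl, rfl⟩⟩
  · refine ⟨![symForm 𝕜 u v, symForm 𝕜 v w, symForm 𝕜 w u], (plane_sym _ _).symm,
      (plane_sym _ _).symm, (plane_sym _ _).symm, fun hi => ?_⟩
    have := Fintype.linearIndependent_iff.1 hi ![1, 1, 1]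
      (by simp [Fin.sum_univ_three, symForm]) 0
    simp at this
  · refine ⟨![symForm 𝕜 u v, symForm 𝕜 u (opp u), symForm 𝕜 v (opp v)], (plane_sym _ _).symm,
      (plane_sym _ _).symm, (plane_sym _ _).symm, fun hi => ?_⟩
    -- The form of a loop at `u` is twice the coordinate, so the relation is `2(u - v) - 2u + 2v =
    -- 0`; the next two cases permute it.
    have := Fintype.linearIndependent_iff.1 hi ![2, -1, 1]
      (by simp [Fin.sum_univ_three, symForm]; module) 1
    simp at this
  · refine ⟨![symForm 𝕜 u (opp u), symForm 𝕜 u v, symForm 𝕜 v (opp v)], (plane_sym _ _).symm,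
      (plane_sym _ _).symm, (plane_sym _ _).symm, fun hi => ?_⟩
    have := Fintype.linearIndependent_iff.1 hi ![-1, 2, 1]
      (by simp [Fin.sum_univ_three, symForm]; module) 0
    simp at this
  · refine ⟨![symForm 𝕜 u (opp u), symForm 𝕜 v (opp v), symForm 𝕜 u v], (plane_sym _ _).symm,
      (plane_sym _ _).symm, (plane_sym _ _).symm, fun hi => ?_⟩
    have := Fintype.linearIndependent_iff.1 hi ![-1, 1, 2]
      (by simp [Fin.sum_univ_three, symForm]; module) 0
    simp at this

/-- Two signed vertices that are joined by an edge (in the double cover of the graph). -/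
def Adj (G : SignedGraph V) (u v : V × ℤˣ) : Prop :=
  (u.2 = v.2 ∧ G.pos.Adj u.1 v.1) ∨ (u.2 ≠ v.2 ∧ G.neg.Adj u.1 v.1) ∨
    (u = opp v ∧ u.1 ∈ G.loops)

lemma Adj.symm {G : SignedGraph V} {u v : V × ℤˣ} (h : G.Adj u v) : G.Adj v u := by
  rcases h with ⟨h1, h2⟩ | ⟨h1, h2⟩ | ⟨h1, h2⟩
  · exact Or.inl ⟨h1.symm, h2.symm⟩
  · exact Or.inr (Or.inl ⟨h1.symm, h2.symm⟩)
  · exact Or.inr (Or.inr ⟨by rw [h1, opp_opp], by rw [h1] at h2; exact h2⟩)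

lemma Adj.opp {G : SignedGraph V} {u v : V × ℤˣ} (h : G.Adj u v) :
    G.Adj (opp u) (SignedGraph.opp v) := by
  rcases h with ⟨h1, h2⟩ | ⟨h1, h2⟩ | ⟨h1, h2⟩
  · exact Or.inl ⟨by simp [SignedGraph.opp, h1], h2⟩
  · exact Or.inr (Or.inl ⟨by simpa [SignedGraph.opp] using h1, h2⟩)
  · exact Or.inr (Or.inr ⟨by rw [h1], h2⟩)

/-- The symbols of the edges and loops of a signed graph. -/
def symbols (G : SignedGraph V) : Set (Symbol V) := {x | ∃ u v, G.Adj u v ∧ x = sym u v}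

lemma sym_mem_symbols {G : SignedGraph V} {u v : V × ℤˣ} : sym u v ∈ G.symbols ↔ G.Adj u v := by
  constructor
  · rintro ⟨w, x, h, e⟩
    rcases sym_eq_iff.1 e with ⟨rfl, rfl⟩ | ⟨rfl, rfl⟩ | ⟨rfl, rfl⟩ | ⟨rfl, rfl⟩
    exacts [h, h.symm, h.opp, h.symm.opp]
  · exact fun h => ⟨u, v, h, rfl⟩

lemma symbols_ne {G : SignedGraph V} {x : Symbol V} (hx : x ∈ G.symbols) (u : V × ℤˣ) :
    x ≠ sym u u := by
  rintro rfl
  rcases sym_mem_symbols.1 hx with ⟨-, h⟩ | ⟨-, h⟩ | ⟨h, -⟩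
  · exact G.pos.loopless.irrefl _ h
  · exact G.neg.loopless.irrefl _ h
  · exact opp_ne u h.symm

lemma arrangement_eq [CharZero 𝕜] (G : SignedGraph V) :
    G.arrangement 𝕜 = plane 𝕜 '' G.symbols := by
  ext H
  constructor
  · rintro ((⟨i, j, h, rfl⟩ | ⟨i, j, h, rfl⟩) | ⟨i, h, rfl⟩)
    · refine ⟨sym (i, 1) (j, 1), sym_mem_symbols.2 (Or.inl ⟨rfl, h⟩), ?_⟩
      ext x
      rw [mem_plane_sym, signedCoord_apply, signedCoord_apply, LinearMap.mem_ker,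
        LinearMap.sub_apply, LinearMap.proj_apply, LinearMap.proj_apply]
      simp [sub_eq_zero]
    · refine ⟨sym (i, 1) (j, -1), sym_mem_symbols.2 (Or.inr (Or.inl ⟨by simp, h⟩)), ?_⟩
      ext x
      rw [mem_plane_sym, signedCoord_apply, signedCoord_apply, LinearMap.mem_ker,
        LinearMap.add_apply, LinearMap.proj_apply, LinearMap.proj_apply]
      simp [eq_neg_iff_add_eq_zero]
    · refine ⟨sym (i, 1) (i, -1), sym_mem_symbols.2 (Or.inr (Or.inr ⟨by simp [opp], h⟩)), ?_⟩
      ext x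
      rw [mem_plane_sym, signedCoord_apply, signedCoord_apply, LinearMap.mem_ker,
        LinearMap.proj_apply]
      simp [self_eq_neg]
  · rintro ⟨_, ⟨u, v, h, rfl⟩, rfl⟩
    obtain ⟨i, s⟩ := u
    obtain ⟨j, t⟩ := v
    rcases h with ⟨h1, h2⟩ | ⟨h1, h2⟩ | ⟨h1, h2⟩
    · refine Or.inl (Or.inl ⟨i, j, h2, ?_⟩)
      obtain rfl : s = t := h1
      ext x
      rw [mem_plane_sym, signedCoord_apply, signedCoord_apply, LinearMap.mem_ker,
        LinearMap.sub_apply, LinearMap.proj_apply, LinearMap.proj_apply, sub_eq_zero]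
      exact mul_right_inj' (unit_cast_ne_zero s)
    · refine Or.inl (Or.inr ⟨i, j, h2, ?_⟩)
      obtain rfl : t = -s := by
        rcases Int.units_eq_one_or s with rfl | rfl <;>
        rcases Int.units_eq_one_or t with rfl | rfl <;> simp_all
      ext x
      rw [mem_plane_sym, signedCoord_apply, signedCoord_apply, LinearMap.mem_ker,
        LinearMap.add_apply, LinearMap.proj_apply, LinearMap.proj_apply, ← eq_neg_iff_add_eq_zero,
        Units.val_neg, Int.cast_neg, neg_mul, ← mul_neg]
      exact mul_right_inj' (unit_cast_ne_zero s)
    · refine Or.inr ⟨i, h2, ?_⟩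
      simp only [opp, Prod.mk.injEq] at h1
      obtain ⟨rfl, rfl⟩ := h1
      ext x
      rw [mem_plane_sym, signedCoord_apply, signedCoord_apply, LinearMap.mem_ker,
        LinearMap.proj_apply, Units.val_neg, Int.cast_neg, neg_mul, neg_eq_self, mul_eq_zero]
      exact or_iff_right (unit_cast_ne_zero t)

/-- Three symbols of `A` on a line. -/
def CollinearIn (A : Set (Symbol V)) (a b c : Symbol V) : Prop :=
  a ∈ A ∧ b ∈ A ∧ c ∈ A ∧ Collinear a b c

/-- Hyperplanes and symbols correspond bijectively, and dependent triples become collinear ones; the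
hypothesis excludes lines with four points. -/
theorem falkInvariant_arrangement [CharZero 𝕜] [Finite V] (G : SignedGraph V)
    (hu : ∀ a b c d, CollinearIn G.symbols a b c → CollinearIn G.symbols a b d → c = d) :
    Arrangement.falkInvariant (G.arrangement 𝕜) =
      Module.finrank 𝕜 (relationSpace 𝕜 G.symbols (CollinearIn G.symbols)) := by
  have hsym : ∀ H : G.arrangement 𝕜, ∃ x ∈ G.symbols, plane 𝕜 x = H := fun H => by
    have h : (H : Submodule 𝕜 (V → 𝕜)) ∈ plane 𝕜 '' G.symbols := arrangement_eq (𝕜 := 𝕜) G ▸ H.2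
    exact h
  choose f hfm hf using hsym
  have hinj : Function.Injective f := fun H H' h => Subtype.ext (by rw [← hf, ← hf, h])
  have hrange : Set.range f = G.symbols := by
    ext x
    refine ⟨?_, fun hx => ?_⟩
    · rintro ⟨H, rfl⟩; exact hfm H
    · refine ⟨⟨plane 𝕜 x, by rw [arrangement_eq]; exact ⟨x, hx, rfl⟩⟩, ?_⟩
      exact plane_injOn (𝕜 := 𝕜) (symbols_ne (hfm _)) (symbols_ne hx) (hf _)
  have htri : ∀ a b c, Arrangement.DependentTriple (G.arrangement 𝕜) a b c ↔
      CollinearIn G.symbols (f a) (f b) (f c) := by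
    intro a b c
    constructor
    · rintro ⟨hab, hbc, hac, α, hα, hd⟩
      exact ⟨hfm a, hfm b, hfm c, collinear_of_dependent (𝕜 := 𝕜) (hinj.ne hab) (hinj.ne hbc)
        (hinj.ne hac) (symbols_ne (hfm a)) (symbols_ne (hfm b)) (symbols_ne (hfm c))
        ((hα 0).trans (hf a).symm) ((hα 1).trans (hf b).symm) ((hα 2).trans (hf c).symm) hd⟩
    · rintro ⟨-, -, -, h⟩
      obtain ⟨α, h0, h1, h2, hd⟩ := h.exists_dependent (𝕜 := 𝕜)
      refine ⟨fun e => h.ne (by rw [e]), fun e => h.rotate.ne (by rw [e]),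
        fun e => h.rotate.rotate.ne (by rw [e]), α, ?_, hd⟩
      intro k
      fin_cases k
      exacts [h0.trans (hf a), h1.trans (hf b), h2.trans (hf c)]
  have : Finite (G.arrangement 𝕜) := Finite.of_injective f hinj
  rw [Arrangement.falkInvariant_eq_finrank_relationSpace]
  · exact finrank_relationSpace_eq f hinj hrange htri fun a b c h => ⟨h.1, h.2.1, h.2.2.1⟩
  · intro a b c d h1 h2
    exact hinj (hu _ _ _ _ ((htri _ _ _).1 h1) ((htri _ _ _).1 h2))
  · intro H hH
    have := hf ⟨H, hH⟩
    rw [← show plane 𝕜 (f ⟨H, hH⟩) = H from this]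
    exact plane_ne_top (symbols_ne (hfm _))

end SignedGraph
end

/-! ### Relations of a triple system: blocks, labellings and the contribution of a line -/

noncomputable section

/-- A partial linear space on the points `A` whose lines have three points. -/
structure IsTripleSystem {ι : Type*} (A : Set ι) (tri : ι → ι → ι → Prop) : Prop where
  swap : ∀ {a b c}, tri a b c → tri b a c
  rotate : ∀ {a b c}, tri a b c → tri b c a
  ne : ∀ {a b c}, tri a b c → a ≠ b
  unique : ∀ {a b c d}, tri a b c → tri a b d → c = d
  mem : ∀ {a b c}, tri a b c → a ∈ A

variable {𝕜 : Type*} [Field 𝕜] {ι : Type*} {A : Set ι} {tri : ι → ι → ι → Prop}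

variable (𝕜 A tri) in
/-- The elements of `relationSpace 𝕜 A tri` that are supported on `blk`. -/
def pieceSpace (blk : ι → ι → ι → Prop) : Submodule 𝕜 (ι → ι → ι → 𝕜) :=
  relationSpace 𝕜 A tri ⊓
    { carrier := {z | ∀ h a b, ¬blk h a b → z h a b = 0}
      zero_mem' := by simp
      add_mem' := by
        intro x y hx hy h a b hb
        simp [hx h a b hb, hy h a b hb]
      smul_mem' := by
        intro r x hx h a b hb
        simp [hx h a b hb] }

/-- A set of index triples that is compatible with the equations of `relationSpace`. -/
structure IsInvariantBlock (tri : ι → ι → ι → Prop) (blk : ι → ι → ι → Prop) : Prop where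
  swap : ∀ {h a b}, blk h a b → blk h b a
  rotate : ∀ {h a b}, blk h a b → blk a b h
  exchange : ∀ {h a b c}, tri a b c → blk h a b → blk h b c

open Classical in
/-- Restriction to a block, extended by zero. -/
def cutOff (blk : ι → ι → ι → Prop) : (ι → ι → ι → 𝕜) →ₗ[𝕜] (ι → ι → ι → 𝕜) where
  toFun z h a b := if blk h a b then z h a b else 0
  map_add' x y := by ext; simp only [Pi.add_apply]; split_ifs <;> simp
  map_smul' r x := by ext; simp

lemma cutOff_of {blk : ι → ι → ι → Prop} {h a b : ι} (hb : blk h a b) (z : ι → ι → ι → 𝕜) :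
    cutOff blk z h a b = z h a b := if_pos hb

lemma cutOff_of_not {blk : ι → ι → ι → Prop} {h a b : ι} (hb : ¬blk h a b)
    (z : ι → ι → ι → 𝕜) : cutOff blk z h a b = 0 := if_neg hb

/-- Each defining equation involves only entries inside the block or only entries outside it, so it
survives the restriction. -/
lemma cutOff_mem (htri : IsTripleSystem A tri) {blk : ι → ι → ι → Prop}
    (hblk : IsInvariantBlock tri blk) {z : ι → ι → ι → 𝕜} (hz : z ∈ relationSpace 𝕜 A tri) :
    cutOff blk z ∈ pieceSpace 𝕜 A tri blk := by
  obtain ⟨h1, h2, h3, h4, h5⟩ := hz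
  refine ⟨⟨fun h a b => ?_, fun h a b c t => ?_, fun h a b t => ?_, fun h a b => ?_,
    fun h a b t => ?_⟩, fun h a b hb => cutOff_of_not hb z⟩
  · by_cases hb : blk h a b
    · rw [cutOff_of hb, cutOff_of (hblk.swap hb), h1]
    · rw [cutOff_of_not hb, cutOff_of_not fun k => hb (hblk.swap k), neg_zero]
  · by_cases hb : blk h a b
    · rw [cutOff_of hb, cutOff_of (hblk.exchange t hb), h2 _ _ _ _ t]
    · rw [cutOff_of_not hb, cutOff_of_not fun k => hb (hblk.exchange (htri.rotate (htri.rotate t))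
        (hblk.exchange (htri.rotate t) k))]
  · by_cases hb : blk h a b
    · rw [cutOff_of hb, h3 _ _ _ t]
    · exact cutOff_of_not hb z
  · by_cases hb : blk h a b
    · rw [cutOff_of hb, cutOff_of (hblk.rotate hb), cutOff_of (hblk.rotate (hblk.rotate hb)), h4]
    · rw [cutOff_of_not hb, cutOff_of_not fun k => hb (hblk.rotate (hblk.rotate k)),
        cutOff_of_not fun k => hb (hblk.rotate k)]
      simp
  · by_cases hb : blk h a b
    · rw [cutOff_of hb, h5 _ _ _ t]
    · exact cutOff_of_not hb z

/-- Disjoint invariant blocks that cover the support of the relation space decompose it. -/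
theorem finrank_relationSpace_eq_sum [Finite ι] (htri : IsTripleSystem A tri) {I : Type*}
    [Fintype I] (blk : I → ι → ι → ι → Prop) (hblk : ∀ i, IsInvariantBlock tri (blk i))
    (hdisj : ∀ i j h a b c, tri a b c → blk i h a b → blk j h a b → i = j)
    (hcover : ∀ z ∈ relationSpace 𝕜 A tri, ∀ h a b, z h a b ≠ 0 → ∃ i, blk i h a b) :
    Module.finrank 𝕜 (relationSpace 𝕜 A tri) =
      ∑ i, Module.finrank 𝕜 (pieceSpace 𝕜 A tri (blk i)) := by
  let Φ : relationSpace 𝕜 A tri →ₗ[𝕜] ∀ i, pieceSpace 𝕜 A tri (blk i) :=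
    LinearMap.pi fun i => ((cutOff (blk i)).domRestrict (relationSpace 𝕜 A tri)).codRestrict _
      fun z => cutOff_mem htri (hblk i) z.2
  rw [← Module.finrank_pi_fintype]
  refine (LinearEquiv.ofBijective Φ ⟨?_, ?_⟩).finrank_eq
  · intro z w hzw
    refine sub_eq_zero.1 (Subtype.ext (funext fun h => funext fun a => funext fun b => ?_))
    by_contra hne
    obtain ⟨i, hi⟩ := hcover _ (z - w).2 h a b hne
    have : cutOff (blk i) z.1 h a b = cutOff (blk i) w.1 h a b :=
      congr_fun (congr_fun (congr_fun (congr_arg Subtype.val (congr_fun hzw i)) h) a) b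
    rw [cutOff_of hi, cutOff_of hi] at this
    exact hne (sub_eq_zero.2 this)
  · intro w
    refine ⟨⟨∑ i, (w i).1, sum_mem fun i _ => (w i).2.1⟩, ?_⟩
    refine funext fun j => Subtype.ext (funext fun h => funext fun a => funext fun b => ?_)
    change cutOff (blk j) (∑ i, (w i).1) h a b = (w j).1 h a b
    by_cases hj : blk j h a b
    · rw [cutOff_of hj]
      simp only [Finset.sum_apply]
      -- Disjointness of the blocks is only assumed for pairs `a, b` on a line; for other pairs
      -- every summand is zero anyway.
      by_cases hc : ∃ c, tri a b c
      · obtain ⟨c, hc⟩ := hc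
        refine Finset.sum_eq_single j (fun i _ hij => ?_) (by simp)
        exact (w i).2.2 h a b fun hi => hij (hdisj i j h a b c hc hi hj)
      · rw [not_exists] at hc
        rw [(w j).2.1.2.2.1 h a b hc]
        exact Finset.sum_eq_zero fun i _ => (w i).2.1.2.2.1 h a b hc
    · rw [cutOff_of_not hj, (w j).2.2 h a b hj]

/-- Three points that lie on one line. -/
def OnLine (tri : ι → ι → ι → Prop) (h a b : ι) : Prop :=
  ∃ x y t, tri x y t ∧ h ∈ ({x, y, t} : Set ι) ∧ a ∈ ({x, y, t} : Set ι) ∧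
    b ∈ ({x, y, t} : Set ι)

/-- The set of the points of a line. -/
def IsLine (tri : ι → ι → ι → Prop) (C : Set ι) : Prop := ∃ x y t, tri x y t ∧ C = {x, y, t}

/-- The index triples in `C` that span `C`. -/
def block (tri : ι → ι → ι → Prop) (C : Set ι) (h a b : ι) : Prop :=
  h ∈ C ∧ a ∈ C ∧ b ∈ C ∧ (OnLine tri h a b → IsLine tri C)

namespace IsTripleSystem

lemma mem_two (htri : IsTripleSystem A tri) {a b c : ι} (h : tri a b c) : b ∈ A :=
  htri.mem (htri.rotate h)

lemma mem_three (htri : IsTripleSystem A tri) {a b c : ι} (h : tri a b c) : c ∈ A :=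
  htri.mem (htri.rotate (htri.rotate h))

lemma ne_two (htri : IsTripleSystem A tri) {a b c : ι} (h : tri a b c) : b ≠ c :=
  htri.ne (htri.rotate h)

lemma ne_three (htri : IsTripleSystem A tri) {a b c : ι} (h : tri a b c) : a ≠ c :=
  (htri.ne (htri.rotate (htri.rotate h))).symm

/-- A line is determined by two of its points. -/
lemma eq_of_mem_of_mem (htri : IsTripleSystem A tri) {a b c x y t : ι} (h : tri a b c)
    (h' : tri x y t) (ha : a ∈ ({x, y, t} : Set ι)) (hb : b ∈ ({x, y, t} : Set ι)) :
    ({x, y, t} : Set ι) = {a, b, c} := by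
  have r1 := htri.rotate h'
  have r2 := htri.rotate r1
  have r3 := htri.swap h'
  have r4 := htri.swap r1
  have r5 := htri.swap r2
  have hne := htri.ne h
  have un := @htri.unique
  rcases ha with rfl | rfl | rfl <;> rcases hb with rfl | rfl | rfl
  · exact absurd rfl hne
  · rw [un h h']
  · rw [un h r5]; ext; simp; tauto
  · rw [un h r3]; ext; simp; tauto
  · exact absurd rfl hne
  · rw [un h r1]; ext; simp; tauto
  · rw [un h r2]; ext; simp; tauto
  · rw [un h r4]; ext; simp; tauto
  · exact absurd rfl hne

lemma onLine_iff (htri : IsTripleSystem A tri) {h a b c : ι} (hc : tri a b c) :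
    OnLine tri h a b ↔ h = a ∨ h = b ∨ h = c := by
  constructor
  · rintro ⟨x, y, t, ht, h1, h2, h3⟩
    rw [htri.eq_of_mem_of_mem hc ht h2 h3] at h1
    exact h1
  · intro hh
    exact ⟨a, b, c, hc, hh, by simp, by simp⟩

/-- Being on one line with `a, b` depends only on the line through them, so exchange preserves the
spanning condition; closedness of `C` keeps the third point inside. -/
lemma block_isInvariant (htri : IsTripleSystem A tri) {C : Set ι}
    (hC : ∀ a b c, tri a b c → a ∈ C → b ∈ C → c ∈ C) : IsInvariantBlock tri (block tri C) where
  swap := by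
    rintro h a b ⟨h1, h2, h3, h4⟩
    refine ⟨h1, h3, h2, ?_⟩
    rintro ⟨x, y, t, ht, k1, k2, k3⟩
    exact h4 ⟨x, y, t, ht, k1, k3, k2⟩
  rotate := by
    rintro h a b ⟨h1, h2, h3, h4⟩
    refine ⟨h2, h3, h1, ?_⟩
    rintro ⟨x, y, t, ht, k1, k2, k3⟩
    exact h4 ⟨x, y, t, ht, k3, k1, k2⟩
  exchange := by
    rintro h a b c hc ⟨h1, h2, h3, h4⟩
    refine ⟨h1, h3, hC _ _ _ hc h2 h3, fun hl => h4 ?_⟩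
    rw [htri.onLine_iff (htri.rotate hc)] at hl
    rw [htri.onLine_iff hc]
    tauto

lemma closed_of_isLine (htri : IsTripleSystem A tri) {C : Set ι} (hC : IsLine tri C) (a b c : ι)
    (h : tri a b c) (ha : a ∈ C) (hb : b ∈ C) : c ∈ C := by
  obtain ⟨x, y, t, ht, rfl⟩ := hC
  rw [htri.eq_of_mem_of_mem h ht ha hb]
  simp

end IsTripleSystem

/-- The coefficient of the first basic form on the classes of a labelling by `0`, `1`, `2`;
the label `3` stands for points outside. -/
def labelForm₁ : Fin 4 → ℤ := ![1, 0, -1, 0]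

/-- The coefficient of the second basic form. -/
def labelForm₂ : Fin 4 → ℤ := ![0, 1, -1, 0]

/-- The coefficients of the product of the two basic forms. -/
def labelForm (i j : Fin 4) : ℤ := labelForm₁ i * labelForm₂ j - labelForm₁ j * labelForm₂ i

/-- The relation defined by a labelling of points by three classes. -/
def labelRelation (m : ι → Fin 4) (p q : 𝕜) (h a b : ι) : 𝕜 :=
  (p * (labelForm₁ (m h) : 𝕜) + q * (labelForm₂ (m h) : 𝕜)) * (labelForm (m a) (m b) : 𝕜)

/-- The element is `(p f₁ + q f₂) ⊗ (f₁ ∧ f₂)`. Two points with different labels lie on a line whose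
third point has the third label, and this puts `f₁ ∧ f₂` into `I²`: its coefficient is `1` for each
of the label pairs `01`, `12`, `20`. -/
lemma labelRelation_mem (htri : IsTripleSystem A tri) (m : ι → Fin 4)
    (hm : ∀ x y t, tri x y t → m x ≠ 3 → m y ≠ 3 → m x ≠ m y →
      m t ≠ 3 ∧ m t ≠ m x ∧ m t ≠ m y)
    (hex : ∀ x y, m x ≠ 3 → m y ≠ 3 → m x ≠ m y → ∃ t, tri x y t)
    (hA : ∀ x, m x ≠ 3 → x ∈ A) (p q : 𝕜) :
    labelRelation m p q ∈ relationSpace 𝕜 A tri := by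
  have e0 : ∀ i j : Fin 4, i = 3 ∨ j = 3 ∨ i = j → labelForm i j = 0 := by decide
  have e1 : ∀ i j k : Fin 4, i ≠ 3 → j ≠ 3 → i ≠ j → k ≠ 3 → k ≠ i → k ≠ j →
      labelForm j k = labelForm i j := by decide
  refine ⟨fun h a b => ?_, fun h a b c t => ?_, fun h a b t => ?_, fun h a b => ?_,
    fun h a b t => ?_⟩
  · have : labelForm (m b) (m a) = -labelForm (m a) (m b) := by simp only [labelForm]; ring
    simp only [labelRelation, this]
    push_cast
    ring
  · have : labelForm (m b) (m c) = labelForm (m a) (m b) := by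
      by_cases hab : m a = 3 ∨ m b = 3 ∨ m a = m b
      · rw [e0 _ _ hab, e0]
        by_contra! hbc
        have := hm b c a (htri.rotate t) hbc.1 hbc.2.1 hbc.2.2
        rcases hab with h | h | h
        exacts [this.1 h, hbc.1 h, this.2.1 h]
      · push Not at hab
        obtain ⟨k1, k2, k3⟩ := hm a b c t hab.1 hab.2.1 hab.2.2
        exact e1 _ _ _ hab.1 hab.2.1 hab.2.2 k1 k2 k3
    simp only [labelRelation, this]
  · have : labelForm (m a) (m b) = 0 := by
      refine e0 _ _ ?_
      by_contra! hab
      obtain ⟨c, hc⟩ := hex a b hab.1 hab.2.1 hab.2.2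
      exact t c hc
    simp [labelRelation, this]
  -- The cyclic sum is a coefficient of `(p f₁ + q f₂) ∧ f₁ ∧ f₂`, which is zero.
  · simp only [labelRelation, labelForm]
    push_cast
    ring
  · have : m h = 3 := by
      by_contra hh
      exact t (hA h hh)
    simp [labelRelation, this, labelForm₁, labelForm₂]

/-- Six points and four lines, any two of which meet (the complete quadrilateral). -/
structure IsPasch (tri : ι → ι → ι → Prop) (a b c a' b' c' : ι) : Prop where
  abc : tri a b c
  ab'c' : tri a b' c'
  a'bc' : tri a' b c'
  a'b'c : tri a' b' c
  ne_a : a ≠ a'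
  ne_b : b ≠ b'
  ne_c : c ≠ c'

/-- Seven points and six lines: a complete quadrilateral, and a point `l` on two of the
diagonals but not on the third. -/
structure IsNonFano (tri : ι → ι → ι → Prop) (a b c a' b' c' l : ι) : Prop extends
    IsPasch tri a b c a' b' c' where
  laa' : tri l a a'
  lbb' : tri l b b'
  not_lcc' : ¬tri l c c'

section Pieces

variable {z : ι → ι → ι → 𝕜} {blk : ι → ι → ι → Prop}

lemma relationSpace_swap (hz : z ∈ relationSpace 𝕜 A tri) (h a b : ι) : z h b a = -z h a b :=
  hz.1 h a b

lemma relationSpace_exchange (hz : z ∈ relationSpace 𝕜 A tri) {a b c : ι} (t : tri a b c)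
    (h : ι) : z h b c = z h a b := hz.2.1 h a b c t

lemma relationSpace_sum (hz : z ∈ relationSpace 𝕜 A tri) (h a b : ι) :
    z h a b + z a b h + z b h a = 0 := hz.2.2.2.1 h a b

variable (htri : IsTripleSystem A tri)
include htri

lemma relationSpace_exchange' (hz : z ∈ relationSpace 𝕜 A tri) {a b c : ι} (t : tri a b c)
    (h : ι) : z h b c = z h a b ∧ z h c a = z h a b :=
  ⟨hz.2.1 h a b c t, by rw [hz.2.1 h b c a (htri.rotate t), hz.2.1 h a b c t]⟩

/-- For fixed `h` the entries on pairs of a line equal a single number up to sign. -/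
lemma relationSpace_zero_of_line (hz : z ∈ relationSpace 𝕜 A tri) {a b c : ι} (t : tri a b c)
    {h : ι} (h0 : z h a b = 0) :
    ∀ x ∈ ({a, b, c} : Set ι), ∀ y ∈ ({a, b, c} : Set ι), x ≠ y → z h x y = 0 := by
  obtain ⟨e1, e2⟩ := relationSpace_exchange' htri hz t h
  have s := relationSpace_swap hz
  rintro x (rfl | rfl | rfl) y (rfl | rfl | rfl) hxy
  · exact absurd rfl hxy
  · exact h0
  · rw [s, e2, h0, neg_zero]
  · rw [s, h0, neg_zero]
  · exact absurd rfl hxy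
  · rw [e1, h0]
  · rw [e2, h0]
  · rw [s, e1, h0, neg_zero]
  · exact absurd rfl hxy

omit htri in
-- If the line through `x` and `y` has its third point outside `C`, the exchange along this line
-- moves the entry out of the block.
lemma pieceSpace_zero_of_not_tri {C : Set ι} (hz : z ∈ pieceSpace 𝕜 A tri (block tri C))
    {x y : ι} (hxy : ∀ t ∈ C, ¬tri x y t) (h : ι) : z h x y = 0 := by
  by_cases ht : ∃ t, tri x y t
  · obtain ⟨t, ht⟩ := ht
    rw [← relationSpace_exchange hz.1 ht]
    exact hz.2 _ _ _ fun hb => hxy t hb.2.2.1 ht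
  · exact hz.1.2.2.1 h x y (not_exists.1 ht)

omit htri in
/-- A linear map onto `Fin n → 𝕜` without kernel computes the dimension. -/
lemma finrank_eq_of_eval {S : Submodule 𝕜 (ι → ι → ι → 𝕜)} {n : ℕ} (x : Fin n → ι × ι × ι)
    (hinj : ∀ z ∈ S, (∀ k, z (x k).1 (x k).2.1 (x k).2.2 = 0) → z = 0)
    (hsurj : ∀ v : Fin n → 𝕜, ∃ z ∈ S, ∀ k, z (x k).1 (x k).2.1 (x k).2.2 = v k) :
    Module.finrank 𝕜 S = n := by
  let Φ : S →ₗ[𝕜] (Fin n → 𝕜) :=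
    { toFun := fun z k => z.1 (x k).1 (x k).2.1 (x k).2.2
      map_add' := fun _ _ => rfl
      map_smul' := fun _ _ => rfl }
  rw [(LinearEquiv.ofBijective Φ ⟨?_, ?_⟩).finrank_eq, Module.finrank_fin_fun]
  · refine LinearMap.ker_eq_bot.1 (LinearMap.ker_eq_bot'.2 fun z hz => Subtype.ext ?_)
    exact hinj z.1 z.2 fun k => congr_fun hz k
  · intro v
    obtain ⟨z, hz, h⟩ := hsurj v
    exact ⟨⟨z, hz⟩, funext h⟩

/-- With `r(h) = z h a b`, all entries are `± r(a)`, `± r(b)`, `± r(c)`, and the only equation is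
`r(a) + r(b) + r(c) = 0`. Giving the three points three different labels realises all solutions. -/
theorem finrank_pieceSpace_line {C : Set ι} (hC : IsLine tri C) :
    Module.finrank 𝕜 (pieceSpace 𝕜 A tri (block tri C)) = 2 := by
  classical
  have hC' := hC
  obtain ⟨a, b, c, t, rfl⟩ := hC'
  have hab := htri.ne t
  have hbc := htri.ne_two t
  have hac := htri.ne_three t
  refine finrank_eq_of_eval ![(a, a, b), (b, a, b)] (fun z hz h0 => ?_) fun v => ?_
  · have ha : z a a b = 0 := h0 0
    have hb : z b a b = 0 := h0 1
    have hc : z c a b = 0 := by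
      have := relationSpace_sum hz.1 c a b
      rwa [(relationSpace_exchange' htri hz.1 t a).1, (relationSpace_exchange' htri hz.1 t b).2,
        ha, hb, add_zero, add_zero] at this
    ext h x y
    by_cases hblk : block tri {a, b, c} h x y
    · obtain ⟨h1, h2, h3, -⟩ := hblk
      by_cases hxy : x = y
      · subst hxy
        exact hz.1.2.2.1 h x x fun t ht => htri.ne ht rfl
      · refine relationSpace_zero_of_line htri hz.1 t ?_ x h2 y h3 hxy
        rcases h1 with rfl | rfl | rfl
        exacts [ha, hb, hc]
    · exact hz.2 _ _ _ hblk
  · let m : ι → Fin 4 := fun x => if x = a then 0 else if x = b then 1 else if x = c then 2 else 3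
    have ma : m a = 0 := by simp [m]
    have mb : m b = 1 := by simp [m, hab.symm]
    have mc : m c = 2 := by simp [m, hac.symm, hbc.symm]
    have m3 : ∀ x, m x ≠ 3 → x ∈ ({a, b, c} : Set ι) := by
      intro x hx
      simp only [m] at hx
      simp only [Set.mem_insert_iff, Set.mem_singleton_iff]
      split_ifs at hx <;> simp_all
    have hm : labelRelation m (v 0) (v 1) ∈ relationSpace 𝕜 A tri := by
      refine labelRelation_mem htri m ?_ ?_ ?_ _ _
      · intro x y s hs hx hy hxy
        have k := htri.eq_of_mem_of_mem hs t (m3 x hx) (m3 y hy)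
        have hsm : s ∈ ({a, b, c} : Set ι) := by rw [k]; simp
        have n1 := htri.ne_two hs
        have n2 := htri.ne_three hs
        rcases m3 x hx with rfl | rfl | rfl <;> rcases m3 y hy with rfl | rfl | rfl <;>
        rcases hsm with rfl | rfl | rfl <;> simp_all
      · have r1 := htri.rotate t
        have r2 := htri.rotate r1
        intro x y hx hy hxy
        rcases m3 x hx with rfl | rfl | rfl <;> rcases m3 y hy with rfl | rfl | rfl
        · exact absurd rfl hxy
        · exact ⟨_, t⟩
        · exact ⟨_, htri.swap r2⟩
        · exact ⟨_, htri.swap t⟩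
        · exact absurd rfl hxy
        · exact ⟨_, r1⟩
        · exact ⟨_, r2⟩
        · exact ⟨_, htri.swap r1⟩
        · exact absurd rfl hxy
      · intro x hx
        rcases m3 x hx with rfl | rfl | rfl
        exacts [htri.mem t, htri.mem_two t, htri.mem_three t]
    refine ⟨_, cutOff_mem htri (htri.block_isInvariant (htri.closed_of_isLine hC)) hm, fun k => ?_⟩
    have hb : ∀ x ∈ ({a, b, c} : Set ι), block tri {a, b, c} x a b := fun x hx =>
      ⟨hx, by simp, by simp, fun _ => hC⟩
    fin_cases k
    · refine (cutOff_of (hb a (by simp)) _).trans ?_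
      simp [labelRelation, ma, mb, labelForm, labelForm₁, labelForm₂]
    · refine (cutOff_of (hb b (by simp)) _).trans ?_
      simp [labelRelation, ma, mb, labelForm, labelForm₁, labelForm₂]

end Pieces
end

/-! ### The complete quadrilateral -/

noncomputable section

variable {𝕜 : Type*} [Field 𝕜] {ι : Type*} {A : Set ι} {tri : ι → ι → ι → Prop}

/-- The six points of a complete quadrilateral. -/
def paschSet (a b c a' b' c' : ι) : Set ι := {a, b, c, a', b', c'}

open Classical in
/-- The labelling of the points of a complete quadrilateral by the three diagonals. -/
def paschLabel (a b c a' b' c' : ι) (x : ι) : Fin 4 :=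
  if x = a ∨ x = a' then 0 else if x = b ∨ x = b' then 1 else if x = c ∨ x = c' then 2 else 3

lemma mem_paschSet_of_label {a b c a' b' c' x : ι} (h : paschLabel a b c a' b' c' x ≠ 3) :
    x ∈ paschSet a b c a' b' c' := by
  simp only [paschLabel] at h
  simp only [paschSet, Set.mem_insert_iff, Set.mem_singleton_iff]
  split_ifs at h <;> tauto

lemma paschLabel_eq_three {a b c a' b' c' x : ι} (h : x ∉ paschSet a b c a' b' c') :
    paschLabel a b c a' b' c' x = 3 := by
  by_contra hx
  exact h (mem_paschSet_of_label hx)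

/-- Two points of a complete quadrilateral lie on a diagonal or on a line. -/
lemma mem_pair_or_mem_line {a b c a' b' c' x y : ι} (hx : x ∈ paschSet a b c a' b' c')
    (hy : y ∈ paschSet a b c a' b' c') :
    (x ∈ ({a, a'} : Set ι) ∧ y ∈ ({a, a'} : Set ι)) ∨
    (x ∈ ({b, b'} : Set ι) ∧ y ∈ ({b, b'} : Set ι)) ∨
    (x ∈ ({c, c'} : Set ι) ∧ y ∈ ({c, c'} : Set ι)) ∨
    (x ∈ ({a, b, c} : Set ι) ∧ y ∈ ({a, b, c} : Set ι)) ∨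
    (x ∈ ({a, b', c'} : Set ι) ∧ y ∈ ({a, b', c'} : Set ι)) ∨
    (x ∈ ({a', b, c'} : Set ι) ∧ y ∈ ({a', b, c'} : Set ι)) ∨
    (x ∈ ({a', b', c} : Set ι) ∧ y ∈ ({a', b', c} : Set ι)) := by
  rcases hx with rfl | rfl | rfl | rfl | rfl | rfl <;>
  rcases hy with rfl | rfl | rfl | rfl | rfl | rfl <;>
  simp

namespace IsPasch

variable {a b c a' b' c' : ι}

lemma rotate (htri : IsTripleSystem A tri) (h : IsPasch tri a b c a' b' c') :
    IsPasch tri b c a b' c' a' :=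
  ⟨htri.rotate h.abc, htri.rotate h.a'bc', htri.rotate h.a'b'c, htri.rotate h.ab'c',
    h.ne_b, h.ne_c, h.ne_a⟩

lemma flip (h : IsPasch tri a b c a' b' c') : IsPasch tri a b' c' a' b c :=
  ⟨h.ab'c', h.abc, h.a'b'c, h.a'bc', h.ne_a, h.ne_b.symm, h.ne_c.symm⟩

lemma label (htri : IsTripleSystem A tri) (h : IsPasch tri a b c a' b' c') :
    paschLabel a b c a' b' c' a = 0 ∧ paschLabel a b c a' b' c' a' = 0 ∧
    paschLabel a b c a' b' c' b = 1 ∧ paschLabel a b c a' b' c' b' = 1 ∧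
    paschLabel a b c a' b' c' c = 2 ∧ paschLabel a b c a' b' c' c' = 2 := by
  have := htri.ne h.abc
  have := htri.ne_two h.abc
  have := htri.ne_three h.abc
  have := htri.ne h.ab'c'
  have := htri.ne_two h.ab'c'
  have := htri.ne_three h.ab'c'
  have := htri.ne h.a'bc'
  have := htri.ne_two h.a'bc'
  have := htri.ne_three h.a'bc'
  have := htri.ne h.a'b'c
  have := htri.ne_two h.a'b'c
  have := htri.ne_three h.a'b'c
  simp only [paschLabel]
  grind

/-- Points with different labels are on different diagonals, hence on one of the four lines, and
each of these carries all three labels. -/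
lemma exists_third (htri : IsTripleSystem A tri) (h : IsPasch tri a b c a' b' c') {x y : ι}
    (hx : paschLabel a b c a' b' c' x ≠ 3) (hy : paschLabel a b c a' b' c' y ≠ 3)
    (hxy : paschLabel a b c a' b' c' x ≠ paschLabel a b c a' b' c' y) :
    ∃ t, tri x y t ∧ paschLabel a b c a' b' c' t ≠ 3 ∧
      paschLabel a b c a' b' c' t ≠ paschLabel a b c a' b' c' x ∧
      paschLabel a b c a' b' c' t ≠ paschLabel a b c a' b' c' y := by
  obtain ⟨l1, l2, l3, l4, l5, l6⟩ := h.label htri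
  have hx' := mem_paschSet_of_label hx
  have hy' := mem_paschSet_of_label hy
  generalize paschLabel a b c a' b' c' = m at *
  have key : ∀ {p q r : ι}, tri p q r → m p ≠ 3 → m q ≠ 3 → m r ≠ 3 → m p ≠ m q → m q ≠ m r →
      m p ≠ m r → x ∈ ({p, q, r} : Set ι) → y ∈ ({p, q, r} : Set ι) →
      ∃ t, tri x y t ∧ m t ≠ 3 ∧ m t ≠ m x ∧ m t ≠ m y := by
    intro p q r t hp hq hr hpq hqr hpr hx hy
    have t1 := htri.rotate t
    have t2 := htri.rotate t1
    rcases hx with rfl | rfl | rfl <;> rcases hy with rfl | rfl | rfl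
    · exact absurd rfl hxy
    · exact ⟨_, t, hr, hpr.symm, hqr.symm⟩
    · exact ⟨_, htri.swap t2, hq, hpq.symm, hqr⟩
    · exact ⟨_, htri.swap t, hr, hqr.symm, hpr.symm⟩
    · exact absurd rfl hxy
    · exact ⟨_, t1, hp, hpq, hpr⟩
    · exact ⟨_, t2, hq, hqr, hpq.symm⟩
    · exact ⟨_, htri.swap t1, hp, hpr, hpq⟩
    · exact absurd rfl hxy
  have k1 := key h.abc (by simp [l1]) (by simp [l3]) (by simp [l5]) (by simp [l1, l3])
    (by simp [l3, l5]) (by simp [l1, l5])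
  have k2 := key h.ab'c' (by simp [l1]) (by simp [l4]) (by simp [l6]) (by simp [l1, l4])
    (by simp [l4, l6]) (by simp [l1, l6])
  have k3 := key h.a'bc' (by simp [l2]) (by simp [l3]) (by simp [l6]) (by simp [l2, l3])
    (by simp [l3, l6]) (by simp [l2, l6])
  have k4 := key h.a'b'c (by simp [l2]) (by simp [l4]) (by simp [l5]) (by simp [l2, l4])
    (by simp [l4, l5]) (by simp [l2, l5])
  have same : ∀ {p p' : ι}, m p = m p' → x ∈ ({p, p'} : Set ι) → y ∈ ({p, p'} : Set ι) → False := by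
    rintro p p' hp (rfl | rfl) (rfl | rfl)
    exacts [hxy rfl, hxy hp, hxy hp.symm, hxy rfl]
  rcases mem_pair_or_mem_line hx' hy' with h | h | h | h | h | h | h
  · exact (same (l1.trans l2.symm) h.1 h.2).elim
  · exact (same (l3.trans l4.symm) h.1 h.2).elim
  · exact (same (l5.trans l6.symm) h.1 h.2).elim
  · exact k1 h.1 h.2
  · exact k2 h.1 h.2
  · exact k3 h.1 h.2
  · exact k4 h.1 h.2

lemma subset (htri : IsTripleSystem A tri) (h : IsPasch tri a b c a' b' c') :
    paschSet a b c a' b' c' ⊆ A := by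
  rintro x (rfl | rfl | rfl | rfl | rfl | rfl)
  exacts [htri.mem h.abc, htri.mem_two h.abc, htri.mem_three h.abc, htri.mem h.a'bc',
    htri.mem_two h.ab'c', htri.mem_three h.ab'c']

lemma labelRelation_mem (htri : IsTripleSystem A tri) (h : IsPasch tri a b c a' b' c') (p q : 𝕜) :
    labelRelation (paschLabel a b c a' b' c') p q ∈ relationSpace 𝕜 A tri := by
  refine _root_.labelRelation_mem htri _ ?_ ?_ ?_ p q
  · intro x y t ht hx hy hxy
    obtain ⟨s, hs, k⟩ := h.exists_third htri hx hy hxy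
    rwa [htri.unique ht hs]
  · intro x y hx hy hxy
    obtain ⟨s, hs, -⟩ := h.exists_third htri hx hy hxy
    exact ⟨s, hs⟩
  · exact fun x hx => h.subset htri (mem_paschSet_of_label hx)

lemma not_isLine (htri : IsTripleSystem A tri) (h : IsPasch tri a b c a' b' c') {C : Set ι}
    (hC : paschSet a b c a' b' c' ⊆ C) : ¬IsLine tri C := by
  rintro ⟨x, y, t, ht, rfl⟩
  have e := htri.eq_of_mem_of_mem h.abc ht (hC (by simp [paschSet])) (hC (by simp [paschSet]))
  rw [e] at hC
  have ha : a' ∈ ({a, b, c} : Set ι) := hC (by simp [paschSet])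
  rcases ha with ha | ha | ha
  · exact h.ne_a ha.symm
  · exact htri.ne h.a'bc' ha
  · exact htri.ne_three h.a'b'c ha

end IsPasch

section

variable (htri : IsTripleSystem A tri)
include htri

/-- Elements of a block without lines vanish on pairs of a line once they vanish at the points
outside of the line. -/
lemma pieceSpace_zero_of_line {C : Set ι} (hC : ¬IsLine tri C) {z : ι → ι → ι → 𝕜}
    (hz : z ∈ pieceSpace 𝕜 A tri (block tri C)) {a b c : ι} (t : tri a b c)
    (h0 : ∀ h ∈ C, h ≠ a → h ≠ b → h ≠ c → z h a b = 0) (h : ι) :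
    ∀ x ∈ ({a, b, c} : Set ι), ∀ y ∈ ({a, b, c} : Set ι), z h x y = 0 := by
  intro x hx y hy
  by_cases hxy : x = y
  · subst hxy
    exact hz.1.2.2.1 h x x fun t ht => htri.ne ht rfl
  · refine relationSpace_zero_of_line htri hz.1 t ?_ x hx y hy hxy
    by_cases hb : block tri C h a b
    · have : ¬OnLine tri h a b := fun hl => hC (hb.2.2.2 hl)
      rw [htri.onLine_iff t] at this
      push Not at this
      exact h0 h hb.1 this.1 this.2.1 this.2.2
    · exact hz.2 _ _ _ hb

namespace IsPasch

variable {a b c a' b' c' : ι}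

/-- The coefficients at opposite points of a quadrilateral agree. -/
lemma opposite_eq {z : ι → ι → ι → 𝕜} (hz : z ∈ relationSpace 𝕜 A tri)
    (h : IsPasch tri a b c a' b' c') (ha : ∀ h, z h a a' = 0) :
    z a a' b = z a' a b ∧ z a a' b' = z a' a b ∧ z a' a b' = z a' a b := by
  have s := relationSpace_swap hz
  obtain ⟨p1, p2⟩ := relationSpace_exchange' htri hz h.abc a'
  obtain ⟨q1, q2⟩ := relationSpace_exchange' htri hz h.a'bc' a
  obtain ⟨r1, r2⟩ := relationSpace_exchange' htri hz h.a'b'c a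
  obtain ⟨t1, t2⟩ := relationSpace_exchange' htri hz h.ab'c' a'
  -- Since the column of `a, a'` vanishes, the cyclic sum on `a, a', y` reads `z a a' y = z a' a y`.
  -- This is used for `y = b, c, b'`, and the four lines link the three equations.
  have e1 := relationSpace_sum hz a' a b
  have e2 := relationSpace_sum hz a' c a
  have e3 := relationSpace_sum hz a' a b'
  have e4 := ha b
  have e5 := ha c
  have e6 := ha b'
  have s1 := s a a' b
  have s2 := s b a a'
  have s3 := s a' c a
  have s4 := s a a' c
  have s5 := s c a a'
  have s6 := s a a' b'
  have s7 := s b' a a'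
  refine ⟨?_, ?_, ?_⟩ <;> grind

/-- Each of the other four points is already joined to `a` by a line of the quadrilateral, and that
line misses `a'`. -/
lemma not_tri_diagonal (h : IsPasch tri a b c a' b' c') :
    ∀ t ∈ paschSet a b c a' b' c', ¬tri a a' t := by
  have un := @htri.unique
  have ro := @htri.rotate
  have sw := @htri.swap
  have n1 := htri.ne_two h.a'b'c
  have n2 := htri.ne_three h.a'b'c
  have n3 := htri.ne_three h.a'bc'
  have n4 := htri.ne h.a'b'c
  have n5 := htri.ne h.a'bc'
  have e : ∀ {x y}, tri a x y → tri a a' x → a' = y := fun h1 h2 =>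
    un (sw (ro (ro h2))) h1
  rintro t (rfl | rfl | rfl | rfl | rfl | rfl) ht
  · exact htri.ne_three ht rfl
  · exact n2 (e h.abc ht)
  · exact n5 (e (sw (ro (ro h.abc))) ht)
  · exact htri.ne_two ht rfl
  · exact n3 (e h.ab'c' ht)
  · exact n4 (e (sw (ro (ro h.ab'c'))) ht)

omit htri in
lemma rotate_set : paschSet b c a b' c' a' = paschSet a b c a' b' c' := by
  ext x
  simp only [paschSet, Set.mem_insert_iff, Set.mem_singleton_iff]
  tauto

/-- The relations supported on the twelve columns of a quadrilateral form a plane. -/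
theorem finrank_pieceSpace (h : IsPasch tri a b c a' b' c')
    (hC : ∀ x y t, tri x y t → x ∈ paschSet a b c a' b' c' → y ∈ paschSet a b c a' b' c' →
      t ∈ paschSet a b c a' b' c') :
    Module.finrank 𝕜 (pieceSpace 𝕜 A tri (block tri (paschSet a b c a' b' c'))) = 2 := by
  have h2 := h.rotate htri
  have h3 := h2.rotate htri
  have hline := h.not_isLine htri subset_rfl
  obtain ⟨l1, l2, l3, l4, l5, l6⟩ := h.label htri
  refine finrank_eq_of_eval ![(a', a, b), (b', a, b)] (fun z hz h0 => ?_) fun v => ?_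
  · have s := relationSpace_swap hz.1
    have ha' : z a' a b = 0 := h0 0
    have hb' : z b' a b = 0 := h0 1
    have da : ∀ x, z x a a' = 0 := pieceSpace_zero_of_not_tri hz (h.not_tri_diagonal htri)
    have db : ∀ x, z x b b' = 0 := pieceSpace_zero_of_not_tri hz
      (by rw [← rotate_set (a := a)]; exact h2.not_tri_diagonal htri)
    have dc : ∀ x, z x c c' = 0 := pieceSpace_zero_of_not_tri hz
      (by rw [← rotate_set (a := a), ← rotate_set (a := b)]; exact h3.not_tri_diagonal htri)
    -- Each diagonal carries four entries with one common value. The cyclic sum at `c', a, b` makes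
    -- the three values add up to zero, so two evaluations determine everything.
    obtain ⟨a1, a2, a3⟩ := h.opposite_eq htri hz.1 da
    obtain ⟨b1, b2, b3⟩ := h2.opposite_eq htri hz.1 db
    obtain ⟨c1, c2, c3⟩ := h3.opposite_eq htri hz.1 dc
    rw [ha'] at a1 a2 a3
    rw [(relationSpace_exchange' htri hz.1 h.abc b').1, hb'] at b1 b2 b3
    have hc' : z c' a b = 0 := by
      have e := relationSpace_sum hz.1 c' a b
      have e1 := (relationSpace_exchange' htri hz.1 h.a'bc' a).1
      have e2 := (relationSpace_exchange' htri hz.1 h.ab'c' b)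
      rw [e1, a1, e2.2, ← e2.1, b2, add_zero, add_zero] at e
      exact e
    rw [(relationSpace_exchange' htri hz.1 h.abc c').2, hc'] at c1 c2 c3
    ext x p q
    by_cases hblk : block tri (paschSet a b c a' b' c') x p q
    · have swap0 : ∀ {x p q}, z x p q = 0 → z x q p = 0 := fun {x p q} e => by
        rw [s, e, neg_zero]
      have self0 : ∀ x p, z x p p = 0 := fun x p => hz.1.2.2.1 x p p fun t ht => htri.ne ht rfl
      have k1 := pieceSpace_zero_of_line htri hline hz h.abc (by
        rintro y (rfl | rfl | rfl | rfl | rfl | rfl) n1 n2 n3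
        exacts [absurd rfl n1, absurd rfl n2, absurd rfl n3, ha', hb', hc']) x
      have k2 := pieceSpace_zero_of_line htri hline hz h.ab'c' (by
        rintro y (rfl | rfl | rfl | rfl | rfl | rfl) n1 n2 n3
        · exact absurd rfl n1
        · rwa [(relationSpace_exchange' htri hz.1 h.ab'c' _).1] at b2
        · rwa [(relationSpace_exchange' htri hz.1 h.ab'c' _).2] at c1
        · exact a3
        · exact absurd rfl n2
        · exact absurd rfl n3) x
      have k3 := pieceSpace_zero_of_line htri hline hz h.a'bc' (by
        rintro y (rfl | rfl | rfl | rfl | rfl | rfl) n1 n2 n3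
        · exact a1
        · exact absurd rfl n2
        · rwa [(relationSpace_exchange' htri hz.1 h.a'bc' _).2] at c2
        · exact absurd rfl n1
        · rwa [(relationSpace_exchange' htri hz.1 h.a'bc' _).1] at b3
        · exact absurd rfl n3) x
      have k4 := pieceSpace_zero_of_line htri hline hz h.a'b'c (by
        rintro y (rfl | rfl | rfl | rfl | rfl | rfl) n1 n2 n3
        · exact a2
        · rwa [(relationSpace_exchange' htri hz.1 h.a'b'c _).1] at b1
        · exact absurd rfl n3
        · exact absurd rfl n1
        · exact absurd rfl n2
        · rwa [(relationSpace_exchange' htri hz.1 h.a'b'c _).2] at c3) x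
      have diag : ∀ {r r' : ι}, z x r r' = 0 → p ∈ ({r, r'} : Set ι) → q ∈ ({r, r'} : Set ι) →
          z x p q = 0 := by
        rintro r r' e (rfl | rfl) (rfl | rfl)
        exacts [self0 _ _, e, swap0 e, self0 _ _]
      rcases mem_pair_or_mem_line hblk.2.1 hblk.2.2.1 with m | m | m | m | m | m | m
      · exact diag (da x) m.1 m.2
      · exact diag (db x) m.1 m.2
      · exact diag (dc x) m.1 m.2
      · exact k1 p m.1 q m.2
      · exact k2 p m.1 q m.2
      · exact k3 p m.1 q m.2
      · exact k4 p m.1 q m.2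
    · exact hz.2 _ _ _ hblk
  · refine ⟨_, cutOff_mem htri (htri.block_isInvariant hC)
      (h.labelRelation_mem htri (v 0) (v 1)), fun k => ?_⟩
    have ma : a ∈ paschSet a b c a' b' c' := by simp [paschSet]
    have mb : b ∈ paschSet a b c a' b' c' := by simp [paschSet]
    have b1 : block tri (paschSet a b c a' b' c') a' a b := by
      refine ⟨by simp [paschSet], ma, mb, fun hl => ?_⟩
      rw [htri.onLine_iff h.abc] at hl
      rcases hl with e | e | e
      exacts [absurd e.symm h.ne_a, absurd e (htri.ne h.a'bc'), absurd e (htri.ne_three h.a'b'c)]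
    have b2 : block tri (paschSet a b c a' b' c') b' a b := by
      refine ⟨by simp [paschSet], ma, mb, fun hl => ?_⟩
      rw [htri.onLine_iff h.abc] at hl
      rcases hl with e | e | e
      exacts [absurd e.symm (htri.ne h.ab'c'), absurd e.symm h.ne_b,
        absurd e (htri.ne_two h.a'b'c)]
    fin_cases k
    · refine (cutOff_of b1 _).trans ?_
      simp [labelRelation, l1, l2, l3, labelForm, labelForm₁, labelForm₂]
    · refine (cutOff_of b2 _).trans ?_
      simp [labelRelation, l1, l3, l4, labelForm, labelForm₁, labelForm₂]

end IsPasch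
end
end

/-! ### The non-Fano configuration -/

noncomputable section

variable {𝕜 : Type*} [Field 𝕜] {ι : Type*} {A : Set ι} {tri : ι → ι → ι → Prop}

/-- The seven points of a non-Fano configuration. -/
def nonFanoSet (a b c a' b' c' l : ι) : Set ι := insert l (paschSet a b c a' b' c')

namespace IsNonFano

variable {a b c a' b' c' l : ι} (htri : IsTripleSystem A tri)
include htri

lemma l_not_mem (h : IsNonFano tri a b c a' b' c' l) : l ∉ paschSet a b c a' b' c' := by
  have un := @htri.unique
  have ro := @htri.rotate
  have n1 := htri.ne h.a'bc'
  rintro (rfl | rfl | rfl | rfl | rfl | rfl)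
  · exact htri.ne h.laa' rfl
  · exact htri.ne h.lbb' rfl
  · exact n1 (un h.laa' (ro (ro h.abc)))
  · exact htri.ne_three h.laa' rfl
  · exact htri.ne_three h.lbb' rfl
  · exact htri.ne h.a'b'c (un h.laa' (ro (ro h.ab'c')))

/-- The points `l`, `c`, `c'` are on two of the six lines, the other four on three. Removing one of
the former leaves four lines that form a quadrilateral: here `c'` is removed, in `pasch_neg` it is
`c`, and in `toIsPasch` it is `l`. -/
lemma pasch_pos (h : IsNonFano tri a b c a' b' c' l) : IsPasch tri c a b l b' a' := by
  have hl := h.l_not_mem htri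
  refine ⟨htri.rotate (htri.rotate h.abc), ?_, ?_, ?_, ?_, htri.ne h.ab'c', (htri.ne h.a'bc').symm⟩
  · exact htri.swap (htri.rotate h.a'b'c)
  · exact h.laa'
  · exact htri.swap (htri.rotate (htri.rotate h.lbb'))
  · rintro rfl
    exact hl (by simp [paschSet])

lemma pasch_neg (h : IsNonFano tri a b c a' b' c' l) : IsPasch tri c' a b' l b a' := by
  have hl := h.l_not_mem htri
  refine ⟨htri.rotate (htri.rotate h.ab'c'), ?_, ?_, ?_, ?_, htri.ne h.abc,
    (htri.ne h.a'b'c).symm⟩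
  · exact htri.swap (htri.rotate h.a'bc')
  · exact h.laa'
  · exact h.lbb'
  · rintro rfl
    exact hl (by simp [paschSet])

/-- With `not_tri_l`: no two of `l`, `c`, `c'` are on a line of the configuration, so their columns
vanish in the piece. -/
lemma not_tri_third (h : IsNonFano tri a b c a' b' c' l) :
    ∀ t ∈ nonFanoSet a b c a' b' c' l, ¬tri c c' t := by
  have hp := (h.toIsPasch.rotate htri).rotate htri
  rintro t (rfl | ht) hh
  · exact h.not_lcc' (htri.rotate (htri.rotate hh))
  · exact hp.not_tri_diagonal htri t (by rw [IsPasch.rotate_set, IsPasch.rotate_set]; exact ht) hh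

lemma not_tri_l (h : IsNonFano tri a b c a' b' c' l) :
    (∀ t ∈ nonFanoSet a b c a' b' c' l, ¬tri l c t) ∧
      ∀ t ∈ nonFanoSet a b c a' b' c' l, ¬tri l c' t := by
  have un := @htri.unique
  have ro := @htri.rotate
  have sw := @htri.swap
  have k1 := (h.pasch_pos htri).not_tri_diagonal htri
  have k2 := (h.pasch_neg htri).not_tri_diagonal htri
  have ncc := h.not_lcc'
  constructor <;> rintro t (rfl | rfl | rfl | rfl | rfl | rfl | rfl) ht
  · exact htri.ne_three ht rfl
  · exact k1 _ (by simp [paschSet]) (sw ht)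
  · exact k1 _ (by simp [paschSet]) (sw ht)
  · exact htri.ne_two ht rfl
  · exact k1 _ (by simp [paschSet]) (sw ht)
  · exact k1 _ (by simp [paschSet]) (sw ht)
  · exact ncc ht
  · exact htri.ne_three ht rfl
  · exact k2 _ (by simp [paschSet]) (sw ht)
  · exact k2 _ (by simp [paschSet]) (sw ht)
  · exact ncc (sw (ro (ro ht)))
  · exact k2 _ (by simp [paschSet]) (sw ht)
  · exact k2 _ (by simp [paschSet]) (sw ht)
  · exact htri.ne_two ht rfl

/-- The relations supported on the columns of a non-Fano configuration that span it. -/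
theorem finrank_pieceSpace (h : IsNonFano tri a b c a' b' c' l)
    (hC : ∀ x y t, tri x y t → x ∈ nonFanoSet a b c a' b' c' l →
      y ∈ nonFanoSet a b c a' b' c' l → t ∈ nonFanoSet a b c a' b' c' l) :
    Module.finrank 𝕜 (pieceSpace 𝕜 A tri (block tri (nonFanoSet a b c a' b' c' l))) = 5 := by
  have hp := h.toIsPasch
  have hline := hp.not_isLine htri (Set.subset_insert l (paschSet a b c a' b' c'))
  change ¬IsLine tri (nonFanoSet a b c a' b' c' l) at hline
  refine finrank_eq_of_eval ![(a', a, b), (a', a, b'), (a, a', b), (a, a', b'), (c', a, b)]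
    (fun z hz h0 => ?_) fun v => ?_
  · have s := relationSpace_swap hz.1
    have sum := relationSpace_sum hz.1
    have u1 : z a' a b = 0 := h0 0
    have u2 : z a' a b' = 0 := h0 1
    have u3 : z a a' b = 0 := h0 2
    have u4 : z a a' b' = 0 := h0 3
    have u5 : z c' a b = 0 := h0 4
    have swap0 : ∀ {x p q}, z x p q = 0 → z x q p = 0 := fun {x p q} e => by
      rw [s, e, neg_zero]
    have self0 : ∀ x p, z x p p = 0 := fun x p => hz.1.2.2.1 x p p fun t ht => htri.ne ht rfl
    have third : ∀ {x p q}, z p q x = 0 → z q x p = 0 → z x p q = 0 := fun {x p q} e1 e2 => by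
      have := sum x p q
      rwa [e1, e2, add_zero, add_zero] at this
    have cc : ∀ x, z x c c' = 0 := pieceSpace_zero_of_not_tri hz (h.not_tri_third htri)
    have lc : ∀ x, z x l c = 0 := pieceSpace_zero_of_not_tri hz (h.not_tri_l htri).1
    have lc' : ∀ x, z x l c' = 0 := pieceSpace_zero_of_not_tri hz (h.not_tri_l htri).2
    have on : ∀ {p q r x}, tri p q r → z x p q = 0 → z x q r = 0 ∧ z x r p = 0 :=
      fun {p q r x} t e => by
        obtain ⟨e1, e2⟩ := relationSpace_exchange' htri hz.1 t x
        exact ⟨e1.trans e, e2.trans e⟩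
    have on2 : ∀ {p q r x}, tri p q r → z x q r = 0 → z x p q = 0 :=
      fun {p q r x} t e => (relationSpace_exchange hz.1 t x).symm.trans e
    have on3 : ∀ {p q r x}, tri p q r → z x r p = 0 → z x p q = 0 :=
      fun {p q r x} t e => (relationSpace_exchange' htri hz.1 t x).2.symm.trans e
    -- The five zeros spread: an entry vanishes once the other two terms of its cyclic sum do, and a
    -- zero on one pair of a line gives all pairs of that line.
    have A1 := on h.abc u1
    have A2 := on h.ab'c' u2
    have A3 := on h.a'bc' u3
    have A4 := on h.a'b'c u4
    have A5 := on h.abc u5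
    have b5 : z b a a' = 0 := third u3 (swap0 u1)
    have b'5 : z b' a a' = 0 := third u4 (swap0 u2)
    have c5 : z c a a' = 0 := third (swap0 A4.2) A1.2
    have c'5 : z c' a a' = 0 := third (swap0 A3.2) A2.2
    have B5 : ∀ {x}, z x a a' = 0 → z x l a = 0 := fun {x} e => on2 h.laa' e
    have B5' : ∀ {x}, z x a a' = 0 → z x a' l = 0 := fun {x} e => (on h.laa' (on2 h.laa' e)).2
    -- The row of `l` is reached through `c` and `c'`, because the columns of `l, c` and `l, c'` are
    -- zero.
    have l1 : z l a c = 0 := third (swap0 (lc a)) (B5 c5)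
    have l2 : z l a c' = 0 := third (swap0 (lc' a)) (B5 c'5)
    have l3 : z l a' c' = 0 := third (swap0 (lc' a')) (swap0 (B5' c'5))
    have l4 : z l a' c = 0 := third (swap0 (lc a')) (swap0 (B5' c5))
    have L1 := on3 h.abc (swap0 l1)
    have L2 := on3 h.ab'c' (swap0 l2)
    have L3 := on3 h.a'bc' (swap0 l3)
    have L4 := on3 h.a'b'c (swap0 l4)
    have c6 : z c l b = 0 := third (on h.abc L1).1 (swap0 (lc b))
    have c'6 : z c' l b = 0 := third (on h.a'bc' L3).1 (swap0 (lc' b))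
    have a6 : z a l b = 0 := third (swap0 L1) (swap0 (B5 b5))
    have a'6 : z a' l b = 0 := third (swap0 L3) (B5' b5)
    have c2 : z c c' a = 0 := third (swap0 A5.2) (cc a)
    have c3 : z c c' b = 0 := third A5.1 (cc b)
    have C2 := on3 h.ab'c' c2
    have C3 := on2 h.a'bc' (swap0 c3)
    have c'4 : z c' c a' = 0 := third (swap0 (on h.a'bc' C3).2) (swap0 (cc a'))
    have C'4 := on3 h.a'b'c c'4
    have b2 : z b a c' = 0 := third (swap0 A3.1) (swap0 u5)
    have b4 : z b a' c = 0 := third (swap0 A1.1) (swap0 C3)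
    have B2 := on3 h.ab'c' (swap0 b2)
    have B4 := on3 h.a'b'c (swap0 b4)
    have b'1 : z b' a c = 0 := third (swap0 A4.1) (swap0 C2)
    have b'3 : z b' a' c' = 0 := third (swap0 A2.1) (swap0 C'4)
    have B'1 := on3 h.abc (swap0 b'1)
    have B'3 := on3 h.a'bc' (swap0 b'3)
    ext x p q
    by_cases hblk : block tri (nonFanoSet a b c a' b' c' l) x p q
    · have diag : ∀ {r r' : ι}, z x r r' = 0 → p ∈ ({r, r'} : Set ι) → q ∈ ({r, r'} : Set ι) →
          z x p q = 0 := by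
        rintro r r' e (rfl | rfl) (rfl | rfl)
        exacts [self0 _ _, e, swap0 e, self0 _ _]
      have k1 := pieceSpace_zero_of_line htri hline hz h.abc (by
        rintro y (rfl | rfl | rfl | rfl | rfl | rfl | rfl) n1 n2 n3
        exacts [L1, absurd rfl n1, absurd rfl n2, absurd rfl n3, u1, B'1, u5]) x
      have k2 := pieceSpace_zero_of_line htri hline hz h.ab'c' (by
        rintro y (rfl | rfl | rfl | rfl | rfl | rfl | rfl) n1 n2 n3
        exacts [L2, absurd rfl n1, B2, C2, u2, absurd rfl n2, absurd rfl n3]) x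
      have k3 := pieceSpace_zero_of_line htri hline hz h.a'bc' (by
        rintro y (rfl | rfl | rfl | rfl | rfl | rfl | rfl) n1 n2 n3
        exacts [L3, u3, absurd rfl n2, C3, absurd rfl n1, B'3, absurd rfl n3]) x
      have k4 := pieceSpace_zero_of_line htri hline hz h.a'b'c (by
        rintro y (rfl | rfl | rfl | rfl | rfl | rfl | rfl) n1 n2 n3
        exacts [L4, u4, B4, absurd rfl n3, absurd rfl n1, absurd rfl n2, C'4]) x
      have k5 := pieceSpace_zero_of_line htri hline hz h.laa' (by
        rintro y (rfl | rfl | rfl | rfl | rfl | rfl | rfl) n1 n2 n3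
        exacts [absurd rfl n1, absurd rfl n2, B5 b5, B5 c5, absurd rfl n3, B5 b'5, B5 c'5]) x
      have k6 := pieceSpace_zero_of_line htri hline hz h.lbb' (by
        rintro y (rfl | rfl | rfl | rfl | rfl | rfl | rfl) n1 n2 n3
        exacts [absurd rfl n1, a6, absurd rfl n2, c6, a'6, absurd rfl n3, c'6]) x
      have kl : ∀ y ∈ paschSet a b c a' b' c', z x l y = 0 := by
        rintro y (rfl | rfl | rfl | rfl | rfl | rfl)
        · exact k5 _ (by simp) _ (by simp)
        · exact k6 _ (by simp) _ (by simp)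
        · exact lc x
        · exact k5 _ (by simp) _ (by simp)
        · exact k6 _ (by simp) _ (by simp)
        · exact lc' x
      obtain ⟨-, hp', hq', -⟩ := hblk
      rcases hp' with rfl | hp'
      · rcases hq' with rfl | hq'
        · exact self0 _ _
        · exact kl q hq'
      · rcases hq' with rfl | hq'
        · exact swap0 (kl p hp')
        · rcases mem_pair_or_mem_line hp' hq' with m | m | m | m | m | m | m
          · exact diag (k5 _ (by simp) _ (by simp)) m.1 m.2
          · exact diag (k6 _ (by simp) _ (by simp)) m.1 m.2
          · exact diag (cc x) m.1 m.2
          · exact k1 p m.1 q m.2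
          · exact k2 p m.1 q m.2
          · exact k3 p m.1 q m.2
          · exact k4 p m.1 q m.2
    · exact hz.2 _ _ _ hblk
  · have hP := h.pasch_pos htri
    have hN := h.pasch_neg htri
    have inv := htri.block_isInvariant hC
    -- The three quadrilaterals offer six parameters for a space of dimension five. Both parameters
    -- of the two quadrilaterals through `l` and one of the third suffice; the coefficients solve
    -- the equations at the five chosen entries.
    refine ⟨_, cutOff_mem htri inv (add_mem (add_mem
      (hP.labelRelation_mem htri (v 3 - v 0) (-v 3))
      (hN.labelRelation_mem htri (v 2 - v 1) (-v 2)))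
      (hp.labelRelation_mem htri 0 (-v 4))), fun k => ?_⟩
    obtain ⟨d1, d2, d3, d4, d5, d6⟩ := hp.label htri
    obtain ⟨p1, p2, p3, p4, p5, p6⟩ := hP.label htri
    obtain ⟨q1, q2, q3, q4, q5, q6⟩ := hN.label htri
    have hl := h.l_not_mem htri
    have p7 : paschLabel c a b l b' a' c' = 3 := by
      refine paschLabel_eq_three ?_
      rintro (e | e | e | e | e | e)
      · exact hp.ne_c e.symm
      · exact htri.ne_three h.ab'c' e.symm
      · exact htri.ne_two h.a'bc' e.symm
      · exact hl (by rw [← e]; simp [paschSet])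
      · exact htri.ne_two h.ab'c' e.symm
      · exact htri.ne_three h.a'bc' e.symm
    have blk : ∀ {x p q t}, tri p q t → x ≠ p → x ≠ q → x ≠ t → x ∈ paschSet a b c a' b' c' →
        p ∈ paschSet a b c a' b' c' → q ∈ paschSet a b c a' b' c' →
        block tri (nonFanoSet a b c a' b' c' l) x p q := by
      intro x p q t ht n1 n2 n3 hx hp hq
      refine ⟨Or.inr hx, Or.inr hp, Or.inr hq, fun ho => ?_⟩
      rw [htri.onLine_iff ht] at ho
      tauto
    fin_cases k
    · refine (cutOff_of (blk h.abc hp.ne_a.symm (htri.ne h.a'bc') (htri.ne_three h.a'b'c)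
        (by simp [paschSet]) (by simp [paschSet]) (by simp [paschSet])) _).trans ?_
      simp [labelRelation, d1, d2, d3, p3, p5, p6, q3, q4, q6, labelForm,
        labelForm₁, labelForm₂]
    · refine (cutOff_of (blk h.ab'c' hp.ne_a.symm (htri.ne h.a'b'c) (htri.ne_three h.a'bc')
        (by simp [paschSet]) (by simp [paschSet]) (by simp [paschSet])) _).trans ?_
      simp [labelRelation, d1, d2, d4, p3, p4, p6, q3, q5, q6, labelForm, labelForm₁, labelForm₂]
    · refine (cutOff_of (blk h.a'bc' hp.ne_a (htri.ne h.abc) (htri.ne_three h.ab'c')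
        (by simp [paschSet]) (by simp [paschSet]) (by simp [paschSet])) _).trans ?_
      simp [labelRelation, d1, d2, d3, p3, p5, p6, q3, q4, q6, labelForm, labelForm₁, labelForm₂]
    · refine (cutOff_of (blk h.a'b'c hp.ne_a (htri.ne h.ab'c') (htri.ne_three h.abc)
        (by simp [paschSet]) (by simp [paschSet]) (by simp [paschSet])) _).trans ?_
      simp [labelRelation, d1, d2, d4, p3, p4, p6, q3, q5, q6, labelForm, labelForm₁, labelForm₂]
    · refine (cutOff_of (blk h.abc (htri.ne_three h.ab'c').symm (htri.ne_two h.a'bc').symm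
        hp.ne_c.symm (by simp [paschSet]) (by simp [paschSet]) (by simp [paschSet])) _).trans ?_
      simp [labelRelation, d1, d3, d6, p7, p3, p5, q1, q3, q4, labelForm, labelForm₁, labelForm₂]

end IsNonFano
end

noncomputable section

namespace SignedGraph

variable {V : Type*}

/-! ### The configurations of symbols that carry local and non-local relations -/

/-- The symbols of a balanced triangle. -/
def triangleSet (u v w : V × ℤˣ) : Set (Symbol V) := {sym u v, sym v w, sym u w}

/-- The symbols of a double edge with a loop at `u`. -/
def doubleLoopSet (u v : V × ℤˣ) : Set (Symbol V) := {sym u v, sym u (opp v), sym u (opp u)}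

/-- The symbols of an edge with loops at both ends. -/
def edgeLoopsSet (u v : V × ℤˣ) : Set (Symbol V) := {sym u v, sym u (opp u), sym v (opp v)}

/-- The symbols of a balanced complete graph on four vertices. -/
def tetraSet (u v w x : V × ℤˣ) : Set (Symbol V) :=
  {sym u v, sym v w, sym u w, sym u x, sym v x, sym w x}

/-- The symbols of a balanced triangle with all loops. -/
def triangleLoopsSet (u v w : V × ℤˣ) : Set (Symbol V) :=
  {sym u v, sym v w, sym u w, sym u (opp u), sym v (opp v), sym w (opp w)}

/-- The symbols of a triangle of double edges. -/
def doubleTriangleSet (u v w : V × ℤˣ) : Set (Symbol V) :=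
  {sym u v, sym u (opp v), sym v w, sym v (opp w), sym u w, sym u (opp w)}

/-- The symbols of two double edges with a common vertex `u`, a loop at `u` and
an edge joining the other two vertices. -/
def circSet (u v w : V × ℤˣ) : Set (Symbol V) :=
  {sym u v, sym u (opp v), sym u w, sym u (opp w), sym v w, sym u (opp u)}

/-- The symbols of a triangle of double edges with a loop at `u`. -/
def doubleTriangleLoopSet (u v w : V × ℤˣ) : Set (Symbol V) :=
  insert (sym v (opp w)) (circSet u v w)

/-- The configurations of six symbols that span non-local relations. -/
def IsPaschConfig (C : Set (Symbol V)) : Prop :=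
  (∃ u v w : V × ℤˣ, u.1 ≠ v.1 ∧ v.1 ≠ w.1 ∧ u.1 ≠ w.1 ∧
    (C = doubleTriangleSet u v w ∨ C = circSet u v w ∨ C = triangleLoopsSet u v w)) ∨
  ∃ u v w x : V × ℤˣ, u.1 ≠ v.1 ∧ v.1 ≠ w.1 ∧ u.1 ≠ w.1 ∧ x.1 ≠ u.1 ∧ x.1 ≠ v.1 ∧ x.1 ≠ w.1 ∧
    C = tetraSet u v w x

/-- A set of symbols without degenerate ones and without double edges with loops at both ends. -/
structure IsAdmissible (A : Set (Symbol V)) : Prop where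
  ne : ∀ u, sym u u ∉ A
  double_loops : ∀ u v, u.1 ≠ v.1 → sym u v ∈ A → sym u (opp v) ∈ A → sym u (opp u) ∈ A →
    sym v (opp v) ∉ A

lemma ne_of_fst_ne {u v : V × ℤˣ} (h : u.1 ≠ v.1) : u ≠ v := fun e => h (by rw [e])

lemma sym_opp_self (u : V × ℤˣ) : sym (opp u) u = sym u (opp u) := sym_comm _ _

lemma sym_opp_right (u v : V × ℤˣ) : sym u (opp v) = sym v (opp u) := by
  rw [← sym_opp_left, sym_comm]

lemma Collinear.eq_of_distinct {u v w : V × ℤˣ} {c : Symbol V}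
    (h : Collinear (sym u v) (sym v w) c) (huv : u.1 ≠ v.1) (hvw : v.1 ≠ w.1) (huw : u.1 ≠ w.1) :
    c = sym u w := by
  rcases h.eq_of_sym_sym (ne_of_fst_ne huv) (ne_of_fst_ne hvw) (ne_of_fst_ne huw) with
    h | ⟨rfl, -⟩ | ⟨rfl, -⟩ | ⟨rfl, -⟩
  · exact h
  · exact absurd rfl hvw
  · exact absurd rfl huv
  · exact absurd rfl huw

lemma Collinear.eq_of_double {u v : V × ℤˣ} {c : Symbol V}
    (h : Collinear (sym u v) (sym u (opp v)) c) (huv : u.1 ≠ v.1) :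
    c = sym u (opp u) ∨ c = sym v (opp v) := by
  rw [← sym_opp_left, sym_comm (opp u)] at h
  rcases h.eq_of_sym_sym (ne_of_fst_ne huv) (ne_of_fst_ne (v := opp u) huv.symm)
    (opp_ne u).symm with h | ⟨h, -⟩ | ⟨rfl, -⟩ | ⟨-, h⟩
  · exact Or.inl h
  · exact absurd (congr_arg Prod.fst h) huv
  · exact absurd rfl huv
  · exact Or.inr h

lemma Collinear.eq_of_loop {u v : V × ℤˣ} {c : Symbol V}
    (h : Collinear (sym u (opp u)) (sym u v) c) (huv : u.1 ≠ v.1) :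
    c = sym u (opp v) ∨ c = sym v (opp v) := by
  rw [← sym_opp_self] at h
  rcases h.eq_of_sym_sym (opp_ne u) (ne_of_fst_ne huv) (ne_of_fst_ne (u := opp u) huv) with
    h | ⟨rfl, -⟩ | ⟨-, h⟩ | ⟨h, -⟩
  · exact Or.inl (h.trans (sym_opp_left _ _))
  · exact absurd rfl huv
  · exact Or.inr h
  · exact absurd (congr_arg Prod.fst h) huv

/-- The three kinds of lines. -/
lemma Collinear.eq_or {a b c : Symbol V} (h : Collinear a b c) (ha : ∀ u, a ≠ sym u u)
    (hb : ∀ u, b ≠ sym u u) (hc : ∀ u, c ≠ sym u u) :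
    (∃ u v w : V × ℤˣ, u.1 ≠ v.1 ∧ v.1 ≠ w.1 ∧ u.1 ≠ w.1 ∧
      ({a, b, c} : Set (Symbol V)) = triangleSet u v w) ∨
    (∃ u v : V × ℤˣ, u.1 ≠ v.1 ∧ ({a, b, c} : Set (Symbol V)) = doubleLoopSet u v) ∨
    ∃ u v : V × ℤˣ, u.1 ≠ v.1 ∧ ({a, b, c} : Set (Symbol V)) = edgeLoopsSet u v := by
  rcases h with ⟨u, v, w, h1, h2, h3, rfl, rfl, rfl⟩ |
    ⟨u, v, h, ⟨rfl, rfl, rfl⟩ | ⟨rfl, rfl, rfl⟩ | ⟨rfl, rfl, rfl⟩⟩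
  · by_cases e1 : u.1 = v.1
    · obtain rfl := (eq_or_eq_opp e1).resolve_left h1
      have e2 : v.1 ≠ w.1 := fun e => by
        rcases eq_or_eq_opp e with rfl | rfl
        · exact h2 rfl
        · simp at h3
      refine Or.inr (Or.inl ⟨v, w, e2, ?_⟩)
      rw [doubleLoopSet, sym_opp_self, sym_comm w, sym_opp_left]
      grind
    · by_cases e2 : v.1 = w.1
      · obtain rfl := (eq_or_eq_opp e2).resolve_left h2
        refine Or.inr (Or.inl ⟨w, u, fun e => e1 e.symm, ?_⟩)
        rw [doubleLoopSet, sym_opp_self, sym_comm w, sym_comm u, sym_opp_left]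
        grind
      · by_cases e3 : u.1 = w.1
        · obtain rfl := (eq_or_eq_opp e3).resolve_left h3
          refine Or.inr (Or.inl ⟨w, v, fun e => e1 e, ?_⟩)
          rw [doubleLoopSet, sym_opp_left, sym_comm v w]
          grind
        · refine Or.inl ⟨u, v, w, e1, e2, e3, ?_⟩
          rw [triangleSet, sym_comm w u]
  · exact Or.inr (Or.inr ⟨u, v, h, rfl⟩)
  · refine Or.inr (Or.inr ⟨u, v, h, ?_⟩)
    rw [edgeLoopsSet]; grind
  · refine Or.inr (Or.inr ⟨u, v, h, ?_⟩)
    rw [edgeLoopsSet]; grind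

/-! ### Admissible sets of symbols are triple systems -/

variable {A : Set (Symbol V)}

namespace IsAdmissible

variable (hA : IsAdmissible A)
include hA

/-- Two lines through the same two symbols arise only from a double edge with loops at both ends,
where four symbols are on one line; admissibility forbids this `B_2`. -/
lemma isTripleSystem : IsTripleSystem A (CollinearIn A) where
  swap := fun ⟨a, b, c, h⟩ => ⟨b, a, c, h.swap⟩
  rotate := fun ⟨a, b, c, h⟩ => ⟨b, c, a, h.rotate⟩
  ne := fun h => h.2.2.2.ne
  mem := fun h => h.1
  unique := by
    rintro a b c d ⟨ha, hb, hc, h⟩ ⟨-, -, hd, h'⟩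
    have k1 : ∀ {x}, x ∈ A → ∀ u, x ≠ sym u u := fun hx u e => hA.ne u (e ▸ hx)
    have k2 : ∀ {u v : V × ℤˣ}, u.1 ≠ v.1 → sym u v ∈ A → sym u (opp v) ∈ A →
      sym u (opp u) ∈ A → sym v (opp v) ∈ A → c = d :=
      fun huv e1 e2 e3 e4 => absurd e4 (hA.double_loops _ _ huv e1 e2 e3)
    -- Without the admissibility condition: either the third points agree or all four symbols of a
    -- `B_2` are present.
    have main : ∀ a b c d, a ∈ A → b ∈ A → c ∈ A → d ∈ A → Collinear a b c → Collinear a b d →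
        c = d ∨ ∃ u v : V × ℤˣ, u.1 ≠ v.1 ∧ sym u v ∈ A ∧ sym u (opp v) ∈ A ∧
          sym u (opp u) ∈ A ∧ sym v (opp v) ∈ A := by
      clear k2 h h' ha hb hc hd
      intro a b c d ha hb hc hd h h'
      have ne := h.ne
      rcases h with ⟨u, v, w, h1, h2, h3, rfl, rfl, rfl⟩ |
        ⟨u, v, h, ⟨rfl, rfl, rfl⟩ | ⟨rfl, rfl, rfl⟩ | ⟨rfl, rfl, rfl⟩⟩
      · by_cases e1 : u.1 = v.1
        · obtain rfl := (eq_or_eq_opp e1).resolve_left h1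
          have e2 : v.1 ≠ w.1 := fun e => by
            rcases eq_or_eq_opp e with rfl | rfl
            · exact h2 rfl
            · simp at h3
          rw [sym_opp_self] at h' ha
          rcases h'.eq_of_loop e2 with rfl | rfl
          · left; rw [sym_comm, sym_opp_left]
          · right; exact ⟨v, w, e2, hb, by rwa [sym_comm, sym_opp_left] at hc, ha, hd⟩
        · by_cases e2 : v.1 = w.1
          · obtain rfl := (eq_or_eq_opp e2).resolve_left h2
            rw [sym_opp_self] at h' hb
            rw [sym_comm, sym_opp_left] at h'
            rw [sym_comm, sym_opp_left] at ha
            have e3 : w.1 ≠ u.1 := fun e => e1 e.symm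
            rcases Collinear.eq_of_loop (v := opp u) h'.swap e3 with rfl | rfl
            · left; rw [opp_opp]
            · right; exact ⟨w, u, e3, hc, ha, hb, by rwa [opp_opp, sym_opp_self] at hd⟩
          · by_cases e3 : u.1 = w.1
            · obtain rfl := (eq_or_eq_opp e3).resolve_left h3
              rw [sym_comm v w] at h' hb
              rw [sym_opp_left] at h' ha
              rcases Collinear.eq_of_double h'.swap e1 with rfl | rfl
              · left; rfl
              · right; exact ⟨w, v, e1, hb, ha, hc, hd⟩
            · left
              rw [h'.eq_of_distinct e1 e2 e3, sym_comm]
      · rcases (Collinear.eq_of_loop h'.swap h) with rfl | rfl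
        · right; exact ⟨u, v, h, ha, hd, hb, hc⟩
        · left; rfl
      · rcases (Collinear.eq_of_loop h' h) with rfl | rfl
        · right; exact ⟨u, v, h, hb, hd, ha, hc⟩
        · left; rfl
      · rcases (Collinear.eq_of_loops h h') with rfl | rfl
        · left; rfl
        · right; exact ⟨u, v, h, hc, hd, ha, hb⟩
    rcases main a b c d ha hb hc hd h h' with h | ⟨u, v, h1, h2, h3, h4, h5⟩
    · exact h
    · exact k2 h1 h2 h3 h4 h5

lemma line_cases {a b c : Symbol V} (h : CollinearIn A a b c) :
    (∃ u v w : V × ℤˣ, u.1 ≠ v.1 ∧ v.1 ≠ w.1 ∧ u.1 ≠ w.1 ∧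
      ({a, b, c} : Set (Symbol V)) = triangleSet u v w) ∨
    (∃ u v : V × ℤˣ, u.1 ≠ v.1 ∧ ({a, b, c} : Set (Symbol V)) = doubleLoopSet u v) ∨
    ∃ u v : V × ℤˣ, u.1 ≠ v.1 ∧ ({a, b, c} : Set (Symbol V)) = edgeLoopsSet u v :=
  h.2.2.2.eq_or (fun u e => hA.ne u (e ▸ h.1)) (fun u e => hA.ne u (e ▸ h.2.1))
    (fun u e => hA.ne u (e ▸ h.2.2.1))

end IsAdmissible

end SignedGraph
end

/-! ### Reduced relations vanish -/

noncomputable section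

namespace SignedGraph

variable {V 𝕜 : Type*} [Field 𝕜] {A : Set (Symbol V)}

/-- A relation without components on lines and on the configurations of six symbols. -/
structure IsReduced (A : Set (Symbol V)) (z : Symbol V → Symbol V → Symbol V → 𝕜) : Prop where
  mem : z ∈ relationSpace 𝕜 A (CollinearIn A)
  line : ∀ h a b, OnLine (CollinearIn A) h a b → z h a b = 0
  config : ∀ C, IsPaschConfig C → C ⊆ A → ∀ h ∈ C, ∀ a ∈ C, ∀ b ∈ C, z h a b = 0

lemma collinear_double {u v : V × ℤˣ} (huv : u.1 ≠ v.1) :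
    Collinear (sym u v) (sym u (opp v)) (sym u (opp u)) := by
  have := collinear_sym (u := u) (v := v) (w := opp u) (ne_of_fst_ne huv)
    (ne_of_fst_ne (v := opp u) huv.symm) (opp_ne u).symm
  rwa [sym_comm v, sym_opp_left] at this

namespace IsReduced

variable {z : Symbol V → Symbol V → Symbol V → 𝕜} (hz : IsReduced A z)
include hz

lemma zero_of_not_mem {h a b : Symbol V} (hh : h ∉ A) : z h a b = 0 := hz.mem.2.2.2.2 _ _ _ hh

lemma zero_of_not {h a b : Symbol V} (hab : ∀ c ∈ A, ¬Collinear a b c) : z h a b = 0 :=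
  hz.mem.2.2.1 _ _ _ fun c hc => hab c hc.2.2.1 hc.2.2.2

lemma zero_of_not_mem_left {h a b : Symbol V} (hh : a ∉ A) : z h a b = 0 :=
  hz.mem.2.2.1 _ _ _ fun _ hc => hh hc.1

lemma zero_of_not_mem_right {h a b : Symbol V} (hh : b ∉ A) : z h a b = 0 :=
  hz.mem.2.2.1 _ _ _ fun _ hc => hh hc.2.1

lemma zero_of_swap {h a b : Symbol V} (h0 : z h b a = 0) : z h a b = 0 := by
  rw [hz.mem.1, h0, neg_zero]

/-- The basic move: through the cyclic equation an entry vanishes with its two companions. The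
lemmas below combine it with exchange along a line and with the vanishing on pairs that lie on no
line; when neither applies, the symbols present fill a configuration on which the relation vanishes
by assumption. -/
lemma zero_of_row {h a b : Symbol V} (h1 : z a b h = 0) (h2 : z b h a = 0) : z h a b = 0 := by
  have := hz.mem.2.2.2.1 h a b
  rwa [h1, h2, add_zero, add_zero] at this

lemma zero_of_exchange {h a b c : Symbol V} (t : Collinear a b c) (hc : c ∈ A)
    (h0 : z h b c = 0) : z h a b = 0 := by
  by_cases ha : a ∈ A
  · by_cases hb : b ∈ A
    · rw [← hz.mem.2.1 h a b c ⟨ha, hb, hc, t⟩, h0]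
    · exact hz.zero_of_not_mem_right hb
  · exact hz.zero_of_not_mem_left ha

lemma zero_of_disjoint {h a b : Symbol V} {u v : V × ℤˣ} (e : a = sym u v) (huv : u.1 ≠ v.1)
    (hu : u.1 ∉ b.1) (hv : v.1 ∉ b.1) : z h a b = 0 := by
  subst e
  exact hz.zero_of_not fun c _ => not_collinear_of_disjoint huv hu hv

lemma zero_of_disjoint' {h a b : Symbol V} {u v : V × ℤˣ} (e : b = sym u v) (huv : u.1 ≠ v.1)
    (hu : u.1 ∉ a.1) (hv : v.1 ∉ a.1) : z h a b = 0 :=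
  hz.zero_of_swap (hz.zero_of_disjoint e huv hu hv)

variable {u v w x : V × ℤˣ}

/-- A loop at `w` and a double edge `uv`. -/
lemma loop_double (huv : u.1 ≠ v.1) (hvw : v.1 ≠ w.1) (huw : u.1 ≠ w.1) :
    z (sym w (opp w)) (sym u v) (sym u (opp v)) = 0 := by
  apply hz.zero_of_row
  · apply hz.zero_of_disjoint (u := u) (v := opp v) rfl <;> simpa [mem_sym]
  · apply hz.zero_of_disjoint' (u := u) (v := v) rfl <;> simpa [mem_sym]

lemma zero_of_third {h : Symbol V} (huv : u.1 ≠ v.1) (hvw : v.1 ≠ w.1) (huw : u.1 ≠ w.1)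
    (hn : sym u w ∉ A) : z h (sym u v) (sym v w) = 0 :=
  hz.zero_of_not fun _ hc t => hn (t.eq_of_distinct huv hvw huw ▸ hc)

/-- A loop at `u` and the edge `uv` can have only two third points, the parallel edge or the loop at
`v`; one hypothesis serves each case. -/
lemma zero_of_loop_edge {h : Symbol V} (huv : u.1 ≠ v.1)
    (h1 : z h (sym u v) (sym u (opp v)) = 0) (h2 : z h (sym u (opp u)) (sym v (opp v)) = 0) :
    z h (sym u (opp u)) (sym u v) = 0 := by
  by_cases h3 : sym u (opp v) ∈ A
  · exact hz.zero_of_exchange (collinear_double huv).rotate.rotate h3 h1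
  · by_cases h4 : sym v (opp v) ∈ A
    · exact hz.zero_of_swap (hz.zero_of_exchange (collinear_loops huv).rotate.rotate h4 h2)
    · apply hz.zero_of_not
      intro c hc t
      rcases t.eq_of_loop huv with rfl | rfl
      exacts [h3 hc, h4 hc]

/-- Two loops can be joined only by one of the two edges between their vertices; `s` runs over the
two lifts of `v`, so that the sign of the edge is absorbed in the lift. -/
lemma zero_of_loops {h : Symbol V} (huv : u.1 ≠ v.1)
    (h1 : ∀ s, s = v ∨ s = opp v → sym u s ∈ A → z h (sym v (opp v)) (sym u s) = 0) :
    z h (sym u (opp u)) (sym v (opp v)) = 0 := by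
  by_cases h2 : sym u v ∈ A
  · exact hz.zero_of_exchange (collinear_loops huv) h2 (h1 _ (Or.inl rfl) h2)
  · by_cases h3 : sym u (opp v) ∈ A
    · refine hz.zero_of_exchange ?_ h3 (h1 _ (Or.inr rfl) h3)
      have := collinear_loops (u := u) (v := opp v) huv
      rwa [opp_opp, sym_opp_self] at this
    · apply hz.zero_of_not
      intro c hc t
      rcases t.eq_of_loops huv with rfl | rfl
      exacts [h2 hc, h3 hc]

/-- An edge `vw` and a double edge `uv` with a loop at `u`. -/
lemma edge_double_of_loop (huv : u.1 ≠ v.1) (hvw : v.1 ≠ w.1) (huw : u.1 ≠ w.1)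
    (hu : sym u (opp u) ∈ A) : z (sym v w) (sym u v) (sym u (opp v)) = 0 := by
  by_cases h1 : sym v w ∈ A
  swap; · exact hz.zero_of_not_mem h1
  by_cases h2 : sym u v ∈ A
  swap; · exact hz.zero_of_not_mem_left h2
  by_cases h3 : sym u (opp v) ∈ A
  swap; · exact hz.zero_of_not_mem_right h3
  by_cases h4 : sym u w ∈ A
  · by_cases h5 : sym u (opp w) ∈ A
    · refine hz.config (circSet u v w) (Or.inl ⟨u, v, w, huv, hvw, huw, by simp⟩) ?_ _ ?_ _ ?_ _ ?_
        <;> simp [circSet, Set.insert_subset_iff, *]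
    -- In the column of `u(-v)` and the loop, one companion pairs the loop with the disjoint edge
    -- `vw`; the other would need the missing `u(-w)` as third point.
    · apply hz.zero_of_exchange (collinear_double huv) hu
      apply hz.zero_of_row
      · refine hz.zero_of_disjoint' rfl hvw ?_ ?_ <;> simpa [mem_sym, eq_comm]
      · rw [← sym_opp_left u v]
        apply hz.zero_of_swap
        apply hz.zero_of_third (u := opp u) huv hvw huw
        rwa [sym_opp_left]
  · apply hz.zero_of_swap
    apply hz.zero_of_exchange (collinear_double huv).swap hu
    apply hz.zero_of_row
    · refine hz.zero_of_disjoint' rfl hvw ?_ ?_ <;> simpa [mem_sym, eq_comm]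
    · exact hz.zero_of_swap (hz.zero_of_third huv hvw huw h4)

/-- An edge `uw` and an edge `uv` with loops at both ends. -/
lemma edge_edgeLoops (huv : u.1 ≠ v.1) (hvw : v.1 ≠ w.1) (huw : u.1 ≠ w.1) :
    z (sym u w) (sym u (opp u)) (sym v (opp v)) = 0 := by
  by_cases h1 : sym u w ∈ A
  swap; · exact hz.zero_of_not_mem h1
  by_cases h3 : sym u (opp u) ∈ A
  swap; · exact hz.zero_of_not_mem_left h3
  by_cases h4 : sym v (opp v) ∈ A
  swap; · exact hz.zero_of_not_mem_right h4
  by_cases h5 : sym w (opp w) ∈ A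
  · apply hz.zero_of_loops huv
    intro s hs h2
    -- The loop at `v` is the same symbol for both lifts, so `v` may be replaced by `s`.
    have hs1 : s.1 = v.1 := by rcases hs with rfl | rfl <;> rfl
    have hs2 : sym v (opp v) = sym s (opp s) := by
      rcases hs with rfl | rfl <;> simp [sym_opp_self]
    rw [hs2] at h4 ⊢
    rw [← hs1] at huv hvw
    by_cases h6 : sym s w ∈ A
    · refine hz.config (triangleLoopsSet u s w) (Or.inl ⟨u, s, w, huv, hvw, huw, by simp⟩)
        ?_ _ ?_ _ ?_ _ ?_ <;> simp [triangleLoopsSet, Set.insert_subset_iff, *]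
    · apply hz.zero_of_row
      · rw [sym_comm u s]
        exact hz.zero_of_third huv.symm huw hvw h6
      · refine hz.zero_of_disjoint rfl huw ?_ ?_ <;> simp [mem_sym, huv, hvw.symm]
  · apply hz.zero_of_row
    · refine hz.zero_of_disjoint' rfl huw ?_ ?_ <;> simpa [mem_sym, eq_comm]
    · apply hz.zero_of_swap
      exact hz.zero_of_loop_edge huw (hz.loop_double huw hvw.symm huv)
        (hz.zero_of_not_mem_right h5)

/-- A loop at `w` and an edge `uv` with loops at both ends. -/
lemma loop_edgeLoops (huv : u.1 ≠ v.1) (hvw : v.1 ≠ w.1) (huw : u.1 ≠ w.1) :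
    z (sym w (opp w)) (sym u (opp u)) (sym v (opp v)) = 0 := by
  apply hz.zero_of_loops huv
  intro s hs h2
  have hs1 : s.1 = v.1 := by rcases hs with rfl | rfl <;> rfl
  have hs2 : sym v (opp v) = sym s (opp s) := by
    rcases hs with rfl | rfl <;> simp [sym_opp_self]
  rw [hs2]
  rw [← hs1] at huv hvw
  apply hz.zero_of_row
  · refine hz.zero_of_disjoint rfl huv ?_ ?_ <;> simp [mem_sym, huw, hvw]
  · rw [sym_comm u s]
    exact hz.zero_of_swap (hz.edge_edgeLoops hvw huw.symm huv.symm)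

/-- A loop at `u` and a triangle `uvw`, in the column of the edges `uv` and `vw`. -/
lemma loop_triangle (huv : u.1 ≠ v.1) (hvw : v.1 ≠ w.1) (huw : u.1 ≠ w.1) :
    z (sym u (opp u)) (sym u v) (sym v w) = 0 := by
  by_cases h1 : sym u (opp u) ∈ A
  swap; · exact hz.zero_of_not_mem h1
  apply hz.zero_of_row
  · refine hz.zero_of_disjoint rfl hvw ?_ ?_ <;> simpa [mem_sym, eq_comm]
  · exact hz.zero_of_loop_edge huv (hz.edge_double_of_loop huv hvw huw h1)
      (hz.zero_of_swap (hz.edge_edgeLoops huv.symm huw hvw))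

/-- A loop at `v` and a triangle `uvw`, in the column of the edges `uv` and `vw`. -/
lemma loop_triangle_middle (huv : u.1 ≠ v.1) (hvw : v.1 ≠ w.1) (huw : u.1 ≠ w.1) :
    z (sym v (opp v)) (sym u v) (sym v w) = 0 := by
  by_cases h1 : sym u w ∈ A
  · apply hz.zero_of_exchange
      (collinear_sym (ne_of_fst_ne huv) (ne_of_fst_ne hvw) (ne_of_fst_ne huw)) h1
    rw [sym_comm u w]
    exact hz.loop_triangle hvw huw.symm huv.symm
  · exact hz.zero_of_third huv hvw huw h1

/-- An edge `uw` and a double edge `uv` with a loop at `u`. -/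
lemma edge_double_of_loop_left (huv : u.1 ≠ v.1) (hvw : v.1 ≠ w.1) (huw : u.1 ≠ w.1)
    (hu : sym u (opp u) ∈ A) : z (sym u w) (sym u v) (sym u (opp v)) = 0 := by
  by_cases h1 : sym u w ∈ A
  swap; · exact hz.zero_of_not_mem h1
  by_cases h2 : sym u v ∈ A
  swap; · exact hz.zero_of_not_mem_left h2
  by_cases h3 : sym u (opp v) ∈ A
  swap; · exact hz.zero_of_not_mem_right h3
  by_cases h4 : sym u (opp w) ∈ A
  · by_cases h5 : sym v w ∈ A
    · refine hz.config (circSet u v w) (Or.inl ⟨u, v, w, huv, hvw, huw, by simp⟩) ?_ _ ?_ _ ?_ _ ?_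
        <;> simp [circSet, Set.insert_subset_iff, *]
    · by_cases h6 : sym v (opp w) ∈ A
      · refine hz.config (circSet u v (opp w)) (Or.inl ⟨u, v, opp w, huv, hvw, huw, by simp⟩)
          ?_ _ ?_ _ ?_ _ ?_
          <;> simp [circSet, Set.insert_subset_iff, *]
      -- With both edges between `v` and `w` missing, neither companion pair has a third point.
      · apply hz.zero_of_row
        · rw [← sym_opp_left u v, sym_comm (opp u) v, ← sym_opp_opp u w]
          apply hz.zero_of_third (u := v) (v := opp u) (w := opp w) huv.symm huw hvw h6
        · rw [sym_comm u w]
          apply hz.zero_of_third huw.symm huv hvw.symm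
          rwa [sym_comm]
  · apply hz.zero_of_exchange (collinear_double huv) hu
    apply hz.zero_of_exchange (collinear_double huv).rotate h2
    apply hz.zero_of_row
    · rw [sym_comm u v]
      exact hz.loop_triangle_middle huv.symm huw hvw
    · exact hz.zero_of_swap (hz.zero_of_loop_edge huw (hz.zero_of_not_mem_right h4)
        (hz.edge_edgeLoops huw hvw.symm huv))

/-- An edge `vw` and a double edge `uv`. -/
lemma edge_double (huv : u.1 ≠ v.1) (hvw : v.1 ≠ w.1) (huw : u.1 ≠ w.1) :
    z (sym v w) (sym u v) (sym u (opp v)) = 0 := by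
  by_cases h1 : sym u (opp u) ∈ A
  · exact hz.edge_double_of_loop huv hvw huw h1
  · by_cases h2 : sym v (opp v) ∈ A
    · rw [sym_comm u v, sym_opp_right]
      exact hz.edge_double_of_loop_left huv.symm huw hvw h2
    · apply hz.zero_of_not
      intro c hc t
      rcases t.eq_of_double huv with rfl | rfl
      exacts [h1 hc, h2 hc]

/-- One companion would need the missing `u(-w)` as third point; the other is an edge against a
double edge. -/
lemma double_triangle_aux (huv : u.1 ≠ v.1) (hvw : v.1 ≠ w.1) (huw : u.1 ≠ w.1)
    (hn : sym u (opp w) ∉ A) : z (sym u (opp v)) (sym u v) (sym v w) = 0 := by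
  apply hz.zero_of_row
  · rw [sym_comm v w, sym_opp_right]
    apply hz.zero_of_third (u := w) (v := v) (w := opp u) hvw.symm huv.symm huw.symm
    rwa [← sym_opp_right]
  · exact hz.zero_of_swap (hz.edge_double huv hvw huw)

/-- A triangle `uvw` and an edge parallel to `uv`. -/
lemma double_triangle (huv : u.1 ≠ v.1) (hvw : v.1 ≠ w.1) (huw : u.1 ≠ w.1) :
    z (sym u (opp v)) (sym u v) (sym v w) = 0 := by
  by_cases h1 : sym u w ∈ A
  swap; · exact hz.zero_of_third huv hvw huw h1
  by_cases h2 : sym u v ∈ A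
  swap; · exact hz.zero_of_not_mem_left h2
  by_cases h3 : sym u (opp v) ∈ A
  swap; · exact hz.zero_of_not_mem h3
  by_cases h4 : sym v w ∈ A
  swap; · exact hz.zero_of_not_mem_right h4
  by_cases h5 : sym u (opp w) ∈ A
  swap; · exact hz.double_triangle_aux huv hvw huw h5
  have t := collinear_sym (ne_of_fst_ne huv) (ne_of_fst_ne hvw) (ne_of_fst_ne huw)
  by_cases h6 : sym v (opp w) ∈ A
  · refine hz.config (doubleTriangleSet u v w) (Or.inl ⟨u, v, w, huv, hvw, huw, by simp⟩)
      ?_ _ ?_ _ ?_ _ ?_ <;> simp [doubleTriangleSet, Set.insert_subset_iff, *]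
  -- Exchanges along the triangle interchange the roles of `u` and `v`, so that the missing edge is
  -- the one required by `double_triangle_aux`.
  · apply hz.zero_of_exchange t h1
    apply hz.zero_of_exchange t.rotate h2
    have := hz.double_triangle_aux huv.symm huw hvw h6
    rw [sym_comm v u, ← sym_opp_right] at this
    exact hz.zero_of_swap this

/-- The edges `vw` and `ux` are disjoint, and `uv`, `ux` would need the missing `vx`. -/
lemma edge_triangle_aux (huv : u.1 ≠ v.1) (hvw : v.1 ≠ w.1)
    (hxu : x.1 ≠ u.1) (hxv : x.1 ≠ v.1) (hxw : x.1 ≠ w.1) (huw : u.1 ≠ w.1)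
    (hn : sym v x ∉ A) : z (sym u x) (sym u v) (sym v w) = 0 := by
  apply hz.zero_of_row
  · refine hz.zero_of_disjoint rfl hvw ?_ ?_ <;>
      simp [mem_sym, huv.symm, hxv.symm, huw.symm, hxw.symm]
  · apply hz.zero_of_swap
    rw [sym_comm u v]
    exact hz.zero_of_third huv.symm hxu.symm hxv.symm hn

/-- A triangle `uvw` and an edge `ux`. -/
lemma edge_triangle (huv : u.1 ≠ v.1) (hvw : v.1 ≠ w.1) (huw : u.1 ≠ w.1)
    (hxu : x.1 ≠ u.1) (hxv : x.1 ≠ v.1) (hxw : x.1 ≠ w.1) :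
    z (sym u x) (sym u v) (sym v w) = 0 := by
  by_cases h1 : sym u w ∈ A
  swap; · exact hz.zero_of_third huv hvw huw h1
  by_cases h2 : sym u v ∈ A
  swap; · exact hz.zero_of_not_mem_left h2
  by_cases h3 : sym u x ∈ A
  swap; · exact hz.zero_of_not_mem h3
  by_cases h4 : sym v w ∈ A
  swap; · exact hz.zero_of_not_mem_right h4
  by_cases h5 : sym v x ∈ A
  swap; · exact hz.edge_triangle_aux huv hvw hxu hxv hxw huw h5
  have t := collinear_sym (ne_of_fst_ne huv) (ne_of_fst_ne hvw) (ne_of_fst_ne huw)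
  by_cases h6 : sym w x ∈ A
  · refine hz.config (tetraSet u v w x)
      (Or.inr ⟨u, v, w, x, huv, hvw, huw, hxu, hxv, hxw, rfl⟩) ?_ _ ?_ _ ?_ _ ?_ <;>
      simp [tetraSet, Set.insert_subset_iff, *]
  · apply hz.zero_of_exchange t h1
    apply hz.zero_of_swap
    rw [sym_comm v w]
    exact hz.edge_triangle_aux huw hvw.symm hxu hxw hxv huv h6

/-- The other end `q` of `h` decides: a loop at `u`, a side of the triangle or an edge parallel to
one, or an edge to a fourth vertex. -/
lemma zero_of_mem_triangle_aux (hA : IsAdmissible A) (huv : u.1 ≠ v.1) (hvw : v.1 ≠ w.1)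
    (huw : u.1 ≠ w.1) (h1 : sym u v ∈ A) (h2 : sym v w ∈ A) (h3 : sym u w ∈ A) {h : Symbol V}
    (hh : h ∈ A) (hu : u.1 ∈ h.1) : z h (sym u v) (sym v w) = 0 := by
  have t := collinear_sym (ne_of_fst_ne huv) (ne_of_fst_ne hvw) (ne_of_fst_ne huw)
  obtain ⟨q, rfl⟩ := exists_eq_sym_of_mem hu
  by_cases e1 : q.1 = u.1
  · rcases eq_or_eq_opp e1 with rfl | rfl
    · exact absurd hh (hA.ne _)
    · exact hz.loop_triangle huv hvw huw
  by_cases e2 : q.1 = v.1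
  · rcases eq_or_eq_opp e2 with rfl | rfl
    · exact hz.line _ _ _ ⟨_, _, _, ⟨h1, h2, h3, t⟩, by simp⟩
    · exact hz.double_triangle huv hvw huw
  by_cases e3 : q.1 = w.1
  · rcases eq_or_eq_opp e3 with rfl | rfl
    · exact hz.line _ _ _ ⟨_, _, _, ⟨h1, h2, h3, t⟩, by simp⟩
    · apply hz.zero_of_exchange t h3
      apply hz.zero_of_swap
      rw [sym_comm v w]
      exact hz.double_triangle huw hvw.symm huv
  · exact hz.edge_triangle huv hvw huw e1 e2 e3

/-- Exchange moves the column to any two sides, so a vertex shared with `h` may be assumed to be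
`u`. If none is shared, both companions pair `h` with a side that misses it. -/
lemma zero_of_mem_triangle (hA : IsAdmissible A) (huv : u.1 ≠ v.1) (hvw : v.1 ≠ w.1)
    (huw : u.1 ≠ w.1) (h1 : sym u v ∈ A) (h2 : sym v w ∈ A) (h3 : sym u w ∈ A) {h : Symbol V}
    (hh : h ∈ A) : z h (sym u v) (sym v w) = 0 := by
  have t := collinear_sym (ne_of_fst_ne huv) (ne_of_fst_ne hvw) (ne_of_fst_ne huw)
  by_cases hu : u.1 ∈ h.1
  · exact hz.zero_of_mem_triangle_aux hA huv hvw huw h1 h2 h3 hh hu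
  by_cases hv : v.1 ∈ h.1
  · apply hz.zero_of_exchange t h3
    rw [sym_comm u w]
    rw [sym_comm] at h1 h3
    exact hz.zero_of_mem_triangle_aux hA hvw huw.symm huv.symm h2 h3 h1 hh hv
  by_cases hw : w.1 ∈ h.1
  · apply hz.zero_of_swap
    rw [sym_comm v w, sym_comm u v]
    rw [sym_comm] at h1 h2 h3
    exact hz.zero_of_mem_triangle_aux hA hvw.symm huv.symm huw.symm h2 h1 h3 hh hw
  · exact hz.zero_of_row (hz.zero_of_disjoint rfl hvw hv hw) (hz.zero_of_disjoint' rfl huv hu hv)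

lemma zero_of_mem_double (hA : IsAdmissible A) (huv : u.1 ≠ v.1)
    (h1 : sym u v ∈ A) (h2 : sym u (opp v) ∈ A) (h3 : sym u (opp u) ∈ A) {h : Symbol V}
    (hh : h ∈ A) : z h (sym u v) (sym u (opp v)) = 0 := by
  have t := collinear_double huv
  by_cases hu : u.1 ∈ h.1
  · obtain ⟨q, rfl⟩ := exists_eq_sym_of_mem hu
    by_cases e1 : q.1 = u.1
    · rcases eq_or_eq_opp e1 with rfl | rfl
      · exact absurd hh (hA.ne _)
      · exact hz.line _ _ _ ⟨_, _, _, ⟨h1, h2, h3, t⟩, by simp⟩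
    by_cases e2 : q.1 = v.1
    · rcases eq_or_eq_opp e2 with rfl | rfl
      · exact hz.line _ _ _ ⟨_, _, _, ⟨h1, h2, h3, t⟩, by simp⟩
      · exact hz.line _ _ _ ⟨_, _, _, ⟨h1, h2, h3, t⟩, by simp⟩
    · exact hz.edge_double_of_loop_left huv (Ne.symm e2) (Ne.symm e1) h3
  by_cases hv : v.1 ∈ h.1
  · obtain ⟨q, rfl⟩ := exists_eq_sym_of_mem hv
    have e1 : u.1 ≠ q.1 := fun e => hu (mem_sym.2 (Or.inr e))
    by_cases e2 : q.1 = v.1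
    · rcases eq_or_eq_opp e2 with rfl | rfl
      · exact absurd hh (hA.ne _)
      · exact absurd hh (hA.double_loops u v huv h1 h2 h3)
    · exact hz.edge_double huv (Ne.symm e2) e1
  · exact hz.zero_of_row (hz.zero_of_disjoint (v := opp v) rfl huv hu hv)
      (hz.zero_of_disjoint' rfl huv hu hv)

lemma zero_of_mem_edgeLoops_aux (hA : IsAdmissible A) (huv : u.1 ≠ v.1)
    (h1 : sym u v ∈ A) (h2 : sym u (opp u) ∈ A) (h3 : sym v (opp v) ∈ A) {h : Symbol V}
    (hh : h ∈ A) (hu : u.1 ∈ h.1) : z h (sym u (opp u)) (sym v (opp v)) = 0 := by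
  have t := collinear_loops huv
  obtain ⟨q, rfl⟩ := exists_eq_sym_of_mem hu
  by_cases e1 : q.1 = u.1
  · rcases eq_or_eq_opp e1 with rfl | rfl
    · exact absurd hh (hA.ne _)
    · exact hz.line _ _ _ ⟨_, _, _, ⟨h2, h3, h1, t⟩, by simp⟩
  by_cases e2 : q.1 = v.1
  · rcases eq_or_eq_opp e2 with rfl | rfl
    · exact hz.line _ _ _ ⟨_, _, _, ⟨h2, h3, h1, t⟩, by simp⟩
    · exact absurd h3 (hA.double_loops u v huv h1 hh h2)
  · exact hz.edge_edgeLoops huv (Ne.symm e2) (Ne.symm e1)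

lemma zero_of_mem_edgeLoops (hA : IsAdmissible A) (huv : u.1 ≠ v.1)
    (h1 : sym u v ∈ A) (h2 : sym u (opp u) ∈ A) (h3 : sym v (opp v) ∈ A) {h : Symbol V}
    (hh : h ∈ A) : z h (sym u (opp u)) (sym v (opp v)) = 0 := by
  by_cases hu : u.1 ∈ h.1
  · exact hz.zero_of_mem_edgeLoops_aux hA huv h1 h2 h3 hh hu
  by_cases hv : v.1 ∈ h.1
  · apply hz.zero_of_swap
    rw [sym_comm u v] at h1
    exact hz.zero_of_mem_edgeLoops_aux hA huv.symm h1 h3 h2 hh hv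
  obtain ⟨p, q, rfl⟩ := exists_eq_sym h
  simp only [mem_sym, not_or] at hu hv
  by_cases e : p.1 = q.1
  · obtain rfl : q = opp p := (eq_or_eq_opp e.symm).resolve_left fun e => hA.ne p (e ▸ hh)
    exact hz.loop_edgeLoops huv hv.1 hu.1
  · apply hz.zero_of_row
    · refine hz.zero_of_disjoint' rfl e ?_ ?_ <;> simp [mem_sym, Ne.symm hv.1, Ne.symm hv.2]
    · refine hz.zero_of_disjoint rfl e ?_ ?_ <;> simp [mem_sym, Ne.symm hu.1, Ne.symm hu.2]

/-- All relations are supported on lines and configurations of six symbols. -/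
theorem eq_zero (hA : IsAdmissible A) : z = 0 := by
  funext h a b
  by_cases hh : h ∈ A
  swap; · exact hz.zero_of_not_mem hh
  by_cases ht : ∃ c, CollinearIn A a b c
  swap; · exact hz.mem.2.2.1 _ _ _ (not_exists.1 ht)
  obtain ⟨c, ht⟩ := ht
  have key : ∀ x y t, x ∈ A → y ∈ A → t ∈ A → Collinear x y t →
      ({a, b, c} : Set (Symbol V)) = {x, y, t} → z h x y = 0 → z h a b = 0 := by
    intro x y t hx hy ht' hc e h0
    refine relationSpace_zero_of_line hA.isTripleSystem hz.mem ⟨hx, hy, ht', hc⟩ h0 a ?_ b ?_ ht.2.2.2.ne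
    · rw [← e]; simp
    · rw [← e]; simp
  have sub : ∀ x ∈ ({a, b, c} : Set (Symbol V)), x ∈ A := by
    rintro x (rfl | rfl | rfl)
    exacts [ht.1, ht.2.1, ht.2.2.1]
  rcases hA.line_cases ht with ⟨u, v, w, huv, hvw, huw, e⟩ | ⟨u, v, huv, e⟩ | ⟨u, v, huv, e⟩
  · simp only [e, triangleSet, Set.mem_insert_iff, Set.mem_singleton_iff, forall_eq_or_imp,
      forall_eq] at sub
    exact key _ _ _ sub.1 sub.2.1 sub.2.2
      (collinear_sym (ne_of_fst_ne huv) (ne_of_fst_ne hvw) (ne_of_fst_ne huw)) e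
      (hz.zero_of_mem_triangle hA huv hvw huw sub.1 sub.2.1 sub.2.2 hh)
  · simp only [e, doubleLoopSet, Set.mem_insert_iff, Set.mem_singleton_iff, forall_eq_or_imp,
      forall_eq] at sub
    exact key _ _ _ sub.1 sub.2.1 sub.2.2 (collinear_double huv) e
      (hz.zero_of_mem_double hA huv sub.1 sub.2.1 sub.2.2 hh)
  · simp only [e, edgeLoopsSet, Set.mem_insert_iff, Set.mem_singleton_iff, forall_eq_or_imp,
      forall_eq] at sub
    refine key _ _ _ sub.2.1 sub.2.2 sub.1 (collinear_loops huv) ?_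
      (hz.zero_of_mem_edgeLoops hA huv sub.1 sub.2.1 sub.2.2 hh)
    rw [e, edgeLoopsSet, Set.insert_comm, Set.pair_comm (sym u v)]

end IsReduced

end SignedGraph
end

/-! ### Generation by a line and a further point -/

noncomputable section

variable {ι : Type*} {A : Set ι} {tri : ι → ι → ι → Prop}

/-- A set that contains with two points of a line also the third one. -/
def IsLineClosed (tri : ι → ι → ι → Prop) (C : Set ι) : Prop :=
  ∀ x y t, tri x y t → x ∈ C → y ∈ C → t ∈ C

/-- A set of points that is generated by each of its lines together with any further point. -/
def IsGeneratedByFlags (tri : ι → ι → ι → Prop) (C : Set ι) : Prop :=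
  ∀ D, IsLineClosed tri D → ∀ p x y t, tri x y t → p ≠ x → p ≠ y → p ≠ t →
    p ∈ C → x ∈ C → y ∈ C → t ∈ C → p ∈ D → x ∈ D → y ∈ D → C ⊆ D

/-- Any one of `a', b', c'` is joined by lines of the quadrilateral to the points of `abc`, and the
third points of these lines are the other two. -/
lemma IsPasch.subset_of_line_subset (htri : IsTripleSystem A tri) {a b c a' b' c' : ι}
    (h : IsPasch tri a b c a' b' c') {D : Set ι} (hD : IsLineClosed tri D) (ha : a ∈ D)
    (hb : b ∈ D) (hc : c ∈ D) {p : ι} (hp : p ∈ paschSet a b c a' b' c') (hpa : p ≠ a)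
    (hpb : p ≠ b) (hpc : p ≠ c) (hpD : p ∈ D) : paschSet a b c a' b' c' ⊆ D := by
  have t1 := h.ab'c'
  have t2 := h.a'bc'
  have t3 := h.a'b'c
  have key : a' ∈ D ∧ b' ∈ D ∧ c' ∈ D := by
    rcases hp with rfl | rfl | rfl | rfl | rfl | rfl
    · exact absurd rfl hpa
    · exact absurd rfl hpb
    · exact absurd rfl hpc
    · exact ⟨hpD, hD _ _ _ (htri.rotate (htri.swap t3)) hpD hc, hD _ _ _ t2 hpD hb⟩
    · exact ⟨hD _ _ _ (htri.rotate t3) hpD hc, hpD, hD _ _ _ t1 ha hpD⟩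
    · exact ⟨hD _ _ _ (htri.rotate t2) hb hpD, hD _ _ _ (htri.swap (htri.rotate (htri.rotate t1))) ha hpD, hpD⟩
  rintro x (rfl | rfl | rfl | rfl | rfl | rfl)
  exacts [ha, hb, hc, key.1, key.2.1, key.2.2]

/-- Two points on a diagonal have no third point inside the set, so the given line is one of the
four; by symmetry it may be taken to be `abc`. -/
lemma IsPasch.isGeneratedByFlags (htri : IsTripleSystem A tri) {a b c a' b' c' : ι}
    (h : IsPasch tri a b c a' b' c') : IsGeneratedByFlags tri (paschSet a b c a' b' c') := by
  intro D hD p x y t ht hpx hpy hpt hp hx hy htC hpD hxD hyD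
  have htD := hD _ _ _ ht hxD hyD
  have hxyt : ({x, y, t} : Set ι) ⊆ D := by
    rintro s (rfl | rfl | rfl) <;> assumption
  have hpxyt : p ∉ ({x, y, t} : Set ι) := by
    rintro (rfl | rfl | rfl) <;> contradiction
  have key : ∀ {a b c a' b' c' : ι}, IsPasch tri a b c a' b' c' → p ∈ paschSet a b c a' b' c' →
      x ∈ ({a, b, c} : Set ι) → y ∈ ({a, b, c} : Set ι) → paschSet a b c a' b' c' ⊆ D := by
    intro a b c a' b' c' h hp hx hy
    have e := htri.eq_of_mem_of_mem ht h.abc hx hy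
    rw [← e] at hxyt hpxyt
    refine h.subset_of_line_subset htri hD (hxyt (by simp)) (hxyt (by simp)) (hxyt (by simp)) hp
      ?_ ?_ ?_ hpD
    all_goals rintro rfl; exact hpxyt (by simp)
  have flip_set : ∀ a b c a' b' c' : ι, paschSet a b' c' a' b c = paschSet a b c a' b' c' := by
    intro a b c a' b' c'
    ext q
    simp only [paschSet, Set.mem_insert_iff, Set.mem_singleton_iff]
    tauto
  have diag : ∀ {a b c a' b' c' : ι}, IsPasch tri a b c a' b' c' → t ∈ paschSet a b c a' b' c' →
      x ∈ ({a, a'} : Set ι) → y ∈ ({a, a'} : Set ι) → False := by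
    intro a b c a' b' c' h htC hx hy
    have n := h.not_tri_diagonal htri t htC
    have := htri.ne ht
    rcases hx with rfl | rfl <;> rcases hy with rfl | rfl
    · exact this rfl
    · exact n ht
    · exact n (htri.swap ht)
    · exact this rfl
  have r1 := h.rotate htri
  have r2 := r1.rotate htri
  have e1 : paschSet b c a b' c' a' = paschSet a b c a' b' c' := IsPasch.rotate_set
  have e2 : paschSet c a b c' a' b' = paschSet a b c a' b' c' := IsPasch.rotate_set.trans e1
  rcases mem_pair_or_mem_line hx hy with ⟨k, k'⟩ | ⟨k, k'⟩ | ⟨k, k'⟩ | ⟨k, k'⟩ | ⟨k, k'⟩ | ⟨k, k'⟩ |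
    ⟨k, k'⟩
  · exact (diag h htC k k').elim
  · exact (diag r1 (e1 ▸ htC) k k').elim
  · exact (diag r2 (e2 ▸ htC) k k').elim
  · exact key h hp k k'
  · rw [← flip_set] at hp ⊢
    exact key h.flip hp k k'
  · rw [← e1, ← flip_set] at hp ⊢
    have e : ({a', b, c'} : Set ι) = {b, c', a'} := by
      ext q; simp only [Set.mem_insert_iff, Set.mem_singleton_iff]; tauto
    rw [e] at k k'
    exact key r1.flip hp k k'
  · rw [← e2, ← flip_set] at hp ⊢
    have e : ({a', b', c} : Set ι) = {c, a', b'} := by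
      ext q; simp only [Set.mem_insert_iff, Set.mem_singleton_iff]; tauto
    rw [e] at k k'
    exact key r2.flip hp k k'

/-- A line contains at most one of `l`, `c`, `c'`, so a line and a further point avoid at least one
of the three and lie in the quadrilateral left after removing it. That quadrilateral contains `a,
a', b, b'`, which generate the rest. -/
lemma IsNonFano.isGeneratedByFlags (htri : IsTripleSystem A tri) {a b c a' b' c' l : ι}
    (h : IsNonFano tri a b c a' b' c' l) : IsGeneratedByFlags tri (nonFanoSet a b c a' b' c' l) := by
  intro D hD p x y t ht hpx hpy hpt hp hx hy htC hpD hxD hyD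
  have hp1 := h.pasch_pos htri
  have hp2 := h.pasch_neg htri
  have m0 : ∀ q ∈ nonFanoSet a b c a' b' c' l, q ≠ l → q ∈ paschSet a b c a' b' c' :=
    fun q hq hql => hq.resolve_left hql
  have m1 : ∀ q ∈ nonFanoSet a b c a' b' c' l, q ≠ c' → q ∈ paschSet c a b l b' a' := by
    intro q hq hqc
    simp only [nonFanoSet, paschSet, Set.mem_insert_iff, Set.mem_singleton_iff] at hq ⊢
    tauto
  have m2 : ∀ q ∈ nonFanoSet a b c a' b' c' l, q ≠ c → q ∈ paschSet c' a b' l b a' := by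
    intro q hq hqc
    simp only [nonFanoSet, paschSet, Set.mem_insert_iff, Set.mem_singleton_iff] at hq ⊢
    tauto
  have fin : a ∈ D → b ∈ D → b' ∈ D → a' ∈ D → nonFanoSet a b c a' b' c' l ⊆ D := by
    intro ha hb hb' ha'
    have hc := hD _ _ _ h.abc ha hb
    have hc' := hD _ _ _ h.ab'c' ha hb'
    have hl := hD _ _ _ (htri.rotate h.laa') ha ha'
    rintro q (rfl | rfl | rfl | rfl | rfl | rfl | rfl) <;> assumption
  have line : ∀ q ∈ ({x, y, t} : Set ι), ∀ r ∈ ({x, y, t} : Set ι), q ≠ r →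
      ∃ s ∈ nonFanoSet a b c a' b' c' l, tri q r s := by
    have r1 := htri.rotate ht
    have r2 := htri.rotate r1
    rintro q (rfl | rfl | rfl) r (rfl | rfl | rfl) hqr
    exacts [absurd rfl hqr, ⟨_, htC, ht⟩, ⟨_, hy, htri.swap r2⟩, ⟨_, htC, htri.swap ht⟩,
      absurd rfl hqr, ⟨_, hx, r1⟩, ⟨_, hy, r2⟩, ⟨_, hx, htri.swap r1⟩, absurd rfl hqr]
  have hlc : l ≠ c := fun e => h.l_not_mem htri (by simp [paschSet, e])
  have hlc' : l ≠ c' := fun e => h.l_not_mem htri (by simp [paschSet, e])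
  have s1 : ¬(l ∈ ({x, y, t} : Set ι) ∧ c ∈ ({x, y, t} : Set ι)) := fun ⟨k, k'⟩ => by
    obtain ⟨s, hs, hs'⟩ := line _ k _ k' hlc
    exact (h.not_tri_l htri).1 s hs hs'
  have s2 : ¬(l ∈ ({x, y, t} : Set ι) ∧ c' ∈ ({x, y, t} : Set ι)) := fun ⟨k, k'⟩ => by
    obtain ⟨s, hs, hs'⟩ := line _ k _ k' hlc'
    exact (h.not_tri_l htri).2 s hs hs'
  have s3 : ¬(c ∈ ({x, y, t} : Set ι) ∧ c' ∈ ({x, y, t} : Set ι)) := fun ⟨k, k'⟩ => by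
    obtain ⟨s, hs, hs'⟩ := line _ k _ k' h.ne_c
    exact h.not_tri_third htri s hs hs'
  simp only [Set.mem_insert_iff, Set.mem_singleton_iff] at s1 s2 s3
  by_cases k0 : p ≠ l ∧ x ≠ l ∧ y ≠ l ∧ t ≠ l
  · have := h.toIsPasch.isGeneratedByFlags htri D hD p x y t ht hpx hpy hpt (m0 _ hp k0.1)
      (m0 _ hx k0.2.1) (m0 _ hy k0.2.2.1) (m0 _ htC k0.2.2.2) hpD hxD hyD
    apply fin <;> exact this (by simp [paschSet])
  by_cases k1 : p ≠ c' ∧ x ≠ c' ∧ y ≠ c' ∧ t ≠ c'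
  · have := hp1.isGeneratedByFlags htri D hD p x y t ht hpx hpy hpt (m1 _ hp k1.1)
      (m1 _ hx k1.2.1) (m1 _ hy k1.2.2.1) (m1 _ htC k1.2.2.2) hpD hxD hyD
    apply fin <;> exact this (by simp [paschSet])
  by_cases k2 : p ≠ c ∧ x ≠ c ∧ y ≠ c ∧ t ≠ c
  · have := hp2.isGeneratedByFlags htri D hD p x y t ht hpx hpy hpt (m2 _ hp k2.1)
      (m2 _ hx k2.2.1) (m2 _ hy k2.2.2.1) (m2 _ htC k2.2.2.2) hpD hxD hyD
    have hb := this (show b' ∈ _ by simp [paschSet])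
    apply fin <;> exact this (by simp [paschSet])
  -- Otherwise `l`, `c`, `c'` all occur among `p, x, y, t`, and at least two of them are on the
  -- line.
  have := h.ne_c
  grind

end

/-! ### Quadrilaterals and non-Fano configurations among symbols, and their closedness -/

noncomputable section

lemma IsPasch.isLineClosed {ι : Type*} {A : Set ι} {tri : ι → ι → ι → Prop}
    (htri : IsTripleSystem A tri) {a b c a' b' c' : ι} (h : IsPasch tri a b c a' b' c')
    (ha : ∀ t, ¬tri a a' t) (hb : ∀ t, ¬tri b b' t) (hc : ∀ t, ¬tri c c' t) :
    IsLineClosed tri (paschSet a b c a' b' c') := by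
  intro x y t ht hx hy
  have diag : ∀ a a' : ι, (∀ t, ¬tri a a' t) → x ∈ ({a, a'} : Set ι) → y ∈ ({a, a'} : Set ι) →
      False := by
    intro a a' n hx hy
    have := htri.ne ht
    rcases hx with rfl | rfl <;> rcases hy with rfl | rfl
    · exact this rfl
    · exact n _ ht
    · exact n _ (htri.swap ht)
    · exact this rfl
  have line : ∀ a b c : ι, tri a b c → x ∈ ({a, b, c} : Set ι) → y ∈ ({a, b, c} : Set ι) →
      t ∈ ({a, b, c} : Set ι) := by
    intro a b c h hx hy
    rw [htri.eq_of_mem_of_mem ht h hx hy]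
    simp
  rcases mem_pair_or_mem_line hx hy with ⟨k, k'⟩ | ⟨k, k'⟩ | ⟨k, k'⟩ | ⟨k, k'⟩ | ⟨k, k'⟩ | ⟨k, k'⟩ |
    ⟨k, k'⟩
  · exact (diag _ _ ha k k').elim
  · exact (diag _ _ hb k k').elim
  · exact (diag _ _ hc k k').elim
  · have := line _ _ _ h.abc k k'
    simp only [paschSet, Set.mem_insert_iff, Set.mem_singleton_iff] at this ⊢
    tauto
  · have := line _ _ _ h.ab'c' k k'
    simp only [paschSet, Set.mem_insert_iff, Set.mem_singleton_iff] at this ⊢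
    tauto
  · have := line _ _ _ h.a'bc' k k'
    simp only [paschSet, Set.mem_insert_iff, Set.mem_singleton_iff] at this ⊢
    tauto
  · have := line _ _ _ h.a'b'c k k'
    simp only [paschSet, Set.mem_insert_iff, Set.mem_singleton_iff] at this ⊢
    tauto

namespace SignedGraph

variable {V : Type*} {A : Set (Symbol V)}

lemma sym_opp_ne (u v : V × ℤˣ) : sym u v ≠ sym u (opp v) := by
  intro h
  have := congr_arg Prod.snd h
  rcases Int.units_eq_one_or u.2 with h1 | h1 <;> rcases Int.units_eq_one_or v.2 with h2 | h2 <;>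
    simp [sym, opp, h1, h2] at this

lemma sym_ne_of_not_mem {u v : V × ℤˣ} {x : Symbol V} (h : u.1 ∉ x.1) : sym u v ≠ x := by
  rintro rfl
  exact h (mem_sym.2 (Or.inl rfl))

variable {u v w x : V × ℤˣ}

/-- Parallel edges are opposite points; the four lines are the balanced triangles. -/
lemma isPasch_doubleTriangle (huv : u.1 ≠ v.1) (hvw : v.1 ≠ w.1) (huw : u.1 ≠ w.1)
    (h : doubleTriangleSet u v w ⊆ A) :
    IsPasch (CollinearIn A) (sym u v) (sym v w) (sym u w) (sym u (opp v)) (sym v (opp w))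
      (sym u (opp w)) := by
  simp only [doubleTriangleSet, Set.insert_subset_iff, Set.singleton_subset_iff] at h
  obtain ⟨h1, h2, h3, h4, h5, h6⟩ := h
  refine ⟨⟨h1, h3, h5, ?_⟩, ⟨h1, h4, h6, ?_⟩, ⟨h2, h3, h6, ?_⟩, ⟨h2, h4, h5, ?_⟩, sym_opp_ne _ _,
    sym_opp_ne _ _, sym_opp_ne _ _⟩
  · exact collinear_sym (ne_of_fst_ne huv) (ne_of_fst_ne hvw) (ne_of_fst_ne huw)
  · exact collinear_sym (ne_of_fst_ne huv) (ne_of_fst_ne (v := opp w) hvw)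
      (ne_of_fst_ne (v := opp w) huw)
  · rw [← sym_opp_opp v w]
    exact collinear_sym (ne_of_fst_ne (v := opp v) huv)
      (ne_of_fst_ne (u := opp v) (v := opp w) hvw) (ne_of_fst_ne (v := opp w) huw)
  · rw [← sym_opp_left v w]
    exact collinear_sym (ne_of_fst_ne (v := opp v) huv) (ne_of_fst_ne (u := opp v) hvw)
      (ne_of_fst_ne huw)

/-- The point opposite to an edge is the loop at the remaining vertex. -/
lemma isPasch_triangleLoops (huv : u.1 ≠ v.1) (hvw : v.1 ≠ w.1) (huw : u.1 ≠ w.1)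
    (h : triangleLoopsSet u v w ⊆ A) :
    IsPasch (CollinearIn A) (sym u v) (sym v w) (sym u w) (sym w (opp w)) (sym u (opp u))
      (sym v (opp v)) := by
  simp only [triangleLoopsSet, Set.insert_subset_iff, Set.singleton_subset_iff] at h
  obtain ⟨h1, h2, h3, h4, h5, h6⟩ := h
  refine ⟨⟨h1, h2, h3, ?_⟩, ⟨h1, h4, h5, ?_⟩, ⟨h6, h2, h5, ?_⟩, ⟨h6, h4, h3, ?_⟩, ?_, ?_, ?_⟩
  · exact collinear_sym (ne_of_fst_ne huv) (ne_of_fst_ne hvw) (ne_of_fst_ne huw)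
  · exact (collinear_loops huv).rotate.rotate
  · exact (collinear_loops hvw).rotate
  · exact (collinear_loops huw).swap
  · exact sym_ne_of_not_mem (by simp [mem_sym, huw])
  · exact sym_ne_of_not_mem (by simp [mem_sym, huv.symm])
  · exact sym_ne_of_not_mem (by simp [mem_sym, huv])

/-- The loop at `u` is opposite to `vw`, and an edge `uv` is opposite to the edge between `u` and
`w` that does not close a balanced triangle with it and `vw`. -/
lemma isPasch_circ (huv : u.1 ≠ v.1) (hvw : v.1 ≠ w.1) (huw : u.1 ≠ w.1)
    (h : circSet u v w ⊆ A) :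
    IsPasch (CollinearIn A) (sym v w) (sym u v) (sym u w) (sym u (opp u)) (sym u (opp w))
      (sym u (opp v)) := by
  simp only [circSet, Set.insert_subset_iff, Set.singleton_subset_iff] at h
  obtain ⟨h1, h2, h3, h4, h5, h6⟩ := h
  refine ⟨⟨h5, h1, h3, ?_⟩, ⟨h5, h4, h2, ?_⟩, ⟨h6, h1, h2, ?_⟩, ⟨h6, h4, h3, ?_⟩, ?_, ?_, ?_⟩
  · exact (collinear_sym (ne_of_fst_ne huv) (ne_of_fst_ne hvw) (ne_of_fst_ne huw)).swap
  · rw [sym_opp_right u w, sym_opp_right u v]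
    exact collinear_sym (ne_of_fst_ne hvw) (ne_of_fst_ne (v := opp u) huw.symm)
      (ne_of_fst_ne (v := opp u) huv.symm)
  · exact (collinear_double huv).rotate.rotate
  · exact (collinear_double huw).swap.rotate.rotate
  · exact sym_ne_of_not_mem (by simp [mem_sym, huv.symm])
  · rw [sym_comm u v]; exact sym_ne_of_not_mem (by simp [mem_sym, huv.symm, hvw])
  · rw [sym_comm u w]; exact sym_ne_of_not_mem (by simp [mem_sym, huw.symm, hvw.symm])

/-- Opposite points are disjoint edges of the complete graph. -/
lemma isPasch_tetra (huv : u.1 ≠ v.1) (hvw : v.1 ≠ w.1) (huw : u.1 ≠ w.1) (hxu : x.1 ≠ u.1)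
    (hxv : x.1 ≠ v.1) (hxw : x.1 ≠ w.1) (h : tetraSet u v w x ⊆ A) :
    IsPasch (CollinearIn A) (sym u v) (sym v w) (sym u w) (sym w x) (sym u x) (sym v x) := by
  simp only [tetraSet, Set.insert_subset_iff, Set.singleton_subset_iff] at h
  obtain ⟨h1, h2, h3, h4, h5, h6⟩ := h
  refine ⟨⟨h1, h2, h3, ?_⟩, ⟨h1, h4, h5, ?_⟩, ⟨h6, h2, h5, ?_⟩, ⟨h6, h4, h3, ?_⟩, ?_, ?_, ?_⟩
  · exact collinear_sym (ne_of_fst_ne huv) (ne_of_fst_ne hvw) (ne_of_fst_ne huw)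
  · rw [sym_comm u v]
    exact collinear_sym (ne_of_fst_ne huv.symm) (ne_of_fst_ne hxu.symm) (ne_of_fst_ne hxv.symm)
  · exact (collinear_sym (ne_of_fst_ne hvw) (ne_of_fst_ne hxw.symm) (ne_of_fst_ne hxv.symm)).swap
  · rw [sym_comm u w]
    exact (collinear_sym (ne_of_fst_ne huw.symm) (ne_of_fst_ne hxu.symm)
      (ne_of_fst_ne hxw.symm)).rotate.swap
  · exact sym_ne_of_not_mem (by simp [mem_sym, huw, hxu.symm])
  · exact sym_ne_of_not_mem (by simp [mem_sym, huv.symm, hxv.symm])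
  · exact sym_ne_of_not_mem (by simp [mem_sym, huv, hxu.symm])

/-- The loop at `u` is the third point on the diagonals of the double edges at `u`; the third
diagonal joins `v` to `w` and misses `u`. -/
lemma isNonFano_doubleTriangleLoop (huv : u.1 ≠ v.1) (hvw : v.1 ≠ w.1) (huw : u.1 ≠ w.1)
    (h : doubleTriangleLoopSet u v w ⊆ A) :
    IsNonFano (CollinearIn A) (sym u v) (sym u w) (sym v w) (sym u (opp v)) (sym u (opp w))
      (sym v (opp w)) (sym u (opp u)) := by
  simp only [doubleTriangleLoopSet, circSet, Set.insert_subset_iff, Set.singleton_subset_iff] at h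
  obtain ⟨h0, h1, h2, h3, h4, h5, h6⟩ := h
  refine ⟨⟨⟨h1, h3, h5, ?_⟩, ⟨h1, h4, h0, ?_⟩, ⟨h2, h3, h0, ?_⟩, ⟨h2, h4, h5, ?_⟩, sym_opp_ne _ _,
    sym_opp_ne _ _, sym_opp_ne _ _⟩, ⟨h6, h1, h2, (collinear_double huv).rotate.rotate⟩,
    ⟨h6, h3, h4, (collinear_double huw).rotate.rotate⟩, fun ⟨_, _, _, h⟩ =>
    not_collinear_of_disjoint (u := v) (v := w) (c := sym v (opp w)) hvw ?_ ?_ h.swap⟩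
  · rw [sym_comm u v]
    exact collinear_sym (ne_of_fst_ne huv.symm) (ne_of_fst_ne huw) (ne_of_fst_ne hvw)
  · rw [sym_comm u v]
    exact collinear_sym (ne_of_fst_ne huv.symm) (ne_of_fst_ne (v := opp w) huw)
      (ne_of_fst_ne (v := opp w) hvw)
  · rw [sym_comm u (opp v), ← sym_opp_left v w]
    exact collinear_sym (ne_of_fst_ne (u := opp v) huv.symm) (ne_of_fst_ne huw)
      (ne_of_fst_ne (u := opp v) hvw)
  · rw [sym_comm u (opp v), ← sym_opp_opp v w]
    exact collinear_sym (ne_of_fst_ne (u := opp v) huv.symm) (ne_of_fst_ne (v := opp w) huw)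
      (ne_of_fst_ne (u := opp v) (v := opp w) hvw)
  · simp [mem_sym, huv.symm]
  · simp [mem_sym, huw.symm]

/-- The symbols on three given vertices. -/
lemma mem_of_support (hA : IsAdmissible A) (huv : u.1 ≠ v.1) (hvw : v.1 ≠ w.1) (huw : u.1 ≠ w.1)
    {s : Symbol V} (hs : s ∈ A) (h : ∀ i ∈ s.1, i ∈ ({u.1, v.1, w.1} : Set V)) :
    s ∈ ({sym u v, sym u (opp v), sym v w, sym v (opp w), sym u w, sym u (opp w), sym u (opp u),
      sym v (opp v), sym w (opp w)} : Set (Symbol V)) := by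
  have loop : ∀ r : V × ℤˣ, (∀ i ∈ s.1, i = r.1) → s = sym r (opp r) := by
    intro r hr
    obtain ⟨p, q, rfl⟩ := exists_eq_sym s
    rcases eq_or_eq_opp (hr p.1 (by simp [mem_sym])) with rfl | rfl <;>
    rcases eq_or_eq_opp (hr q.1 (by simp [mem_sym])) with rfl | rfl
    · exact absurd hs (hA.ne _)
    · rfl
    · exact sym_comm _ _
    · exact absurd hs (hA.ne _)
  by_cases hu : u.1 ∈ s.1 <;> by_cases hv : v.1 ∈ s.1
  · rcases eq_sym_of_mem_of_mem huv hu hv with rfl | rfl <;> simp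
  · by_cases hw : w.1 ∈ s.1
    · rcases eq_sym_of_mem_of_mem huw hu hw with rfl | rfl <;> simp
    · rw [loop u]
      · simp
      · intro i hi
        rcases h i hi with rfl | rfl | rfl
        exacts [rfl, absurd hi hv, absurd hi hw]
  · by_cases hw : w.1 ∈ s.1
    · rcases eq_sym_of_mem_of_mem hvw hv hw with rfl | rfl <;> simp
    · rw [loop v]
      · simp
      · intro i hi
        rcases h i hi with rfl | rfl | rfl
        exacts [absurd hi hu, rfl, absurd hi hw]
  · rw [loop w]
    · simp
    · intro i hi
      rcases h i hi with rfl | rfl | rfl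
      exacts [absurd hi hu, absurd hi hv, rfl]

/-- Every vertex of a third point belongs to one of the first two points, so lines never leave a set
of vertices. For three vertices, closedness reduces to listing the symbols present on them. -/
lemma isLineClosed_of_support {C : Set (Symbol V)} {S : Set V}
    (hS : ∀ s ∈ C, ∀ i ∈ s.1, i ∈ S) (h : ∀ s ∈ A, (∀ i ∈ s.1, i ∈ S) → s ∈ C) :
    IsLineClosed (CollinearIn A) C := by
  rintro x y t ⟨-, -, ht, hc⟩ hx hy
  refine h t ht fun i hi => ?_
  rcases hc.rotate.rotate.mem_or_mem hi with h | h
  exacts [hS x hx i h, hS y hy i h]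

lemma paschSet_doubleTriangle (u v w : V × ℤˣ) : paschSet (sym u v) (sym v w) (sym u w)
    (sym u (opp v)) (sym v (opp w)) (sym u (opp w)) = doubleTriangleSet u v w := by
  ext s
  simp only [paschSet, doubleTriangleSet, Set.mem_insert_iff, Set.mem_singleton_iff]
  tauto

lemma paschSet_triangleLoops (u v w : V × ℤˣ) : paschSet (sym u v) (sym v w) (sym u w)
    (sym w (opp w)) (sym u (opp u)) (sym v (opp v)) = triangleLoopsSet u v w := by
  ext s
  simp only [paschSet, triangleLoopsSet, Set.mem_insert_iff, Set.mem_singleton_iff]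
  tauto

lemma paschSet_circ (u v w : V × ℤˣ) : paschSet (sym v w) (sym u v) (sym u w) (sym u (opp u))
    (sym u (opp w)) (sym u (opp v)) = circSet u v w := by
  ext s
  simp only [paschSet, circSet, Set.mem_insert_iff, Set.mem_singleton_iff]
  tauto

lemma paschSet_tetra (u v w x : V × ℤˣ) : paschSet (sym u v) (sym v w) (sym u w) (sym w x)
    (sym u x) (sym v x) = tetraSet u v w x := by
  ext s
  simp only [paschSet, tetraSet, Set.mem_insert_iff, Set.mem_singleton_iff]
  tauto

lemma nonFanoSet_doubleTriangleLoop (u v w : V × ℤˣ) : nonFanoSet (sym u v) (sym u w) (sym v w)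
    (sym u (opp v)) (sym u (opp w)) (sym v (opp w)) (sym u (opp u)) =
      doubleTriangleLoopSet u v w := by
  ext s
  simp only [nonFanoSet, paschSet, doubleTriangleLoopSet, circSet, Set.mem_insert_iff,
    Set.mem_singleton_iff]
  tauto

lemma isLineClosed_tetra (hA : IsAdmissible A) (huv : u.1 ≠ v.1) (hvw : v.1 ≠ w.1)
    (huw : u.1 ≠ w.1) (hxu : x.1 ≠ u.1) (hxv : x.1 ≠ v.1) (hxw : x.1 ≠ w.1)
    (hC : tetraSet u v w x ⊆ A) : IsLineClosed (CollinearIn A) (tetraSet u v w x) := by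
  have h := isPasch_tetra huv hvw huw hxu hxv hxw hC
  rw [← paschSet_tetra]
  apply h.isLineClosed hA.isTripleSystem <;> rintro t ⟨-, -, -, ht⟩ <;>
    refine not_collinear_of_disjoint ?_ ?_ ?_ ht <;>
    simp [mem_sym, huv, huv.symm, hvw, hvw.symm, huw, huw.symm, hxu.symm, hxv.symm, hxw.symm]

lemma isLineClosed_triangleLoops (hA : IsAdmissible A) (huv : u.1 ≠ v.1) (hvw : v.1 ≠ w.1)
    (huw : u.1 ≠ w.1) (hC : triangleLoopsSet u v w ⊆ A) :
    IsLineClosed (CollinearIn A) (triangleLoopsSet u v w) := by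
  have hC' := hC
  simp only [triangleLoopsSet, Set.insert_subset_iff, Set.singleton_subset_iff] at hC'
  obtain ⟨h1, h2, h3, h4, h5, h6⟩ := hC'
  refine isLineClosed_of_support (S := {u.1, v.1, w.1}) ?_ fun s hs hS => ?_
  · simp [triangleLoopsSet, mem_sym]
  · rcases mem_of_support hA huv hvw huw hs hS with
      rfl | rfl | rfl | rfl | rfl | rfl | rfl | rfl | rfl
    -- An edge parallel to a side would complete a `B_2` with the loops at its ends.
    case inr.inl => exact absurd h5 (hA.double_loops u v huv h1 hs h4)
    case inr.inr.inr.inl => exact absurd h6 (hA.double_loops v w hvw h2 hs h5)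
    case inr.inr.inr.inr.inr.inl => exact absurd h6 (hA.double_loops u w huw h3 hs h4)
    all_goals simp [triangleLoopsSet]

lemma isLineClosed_doubleTriangle (hA : IsAdmissible A) (huv : u.1 ≠ v.1) (hvw : v.1 ≠ w.1)
    (huw : u.1 ≠ w.1) (hu : sym u (opp u) ∉ A)
    (hv : sym v (opp v) ∉ A) (hw : sym w (opp w) ∉ A) :
    IsLineClosed (CollinearIn A) (doubleTriangleSet u v w) := by
  refine isLineClosed_of_support (S := {u.1, v.1, w.1}) ?_ fun s hs hS => ?_
  · simp [doubleTriangleSet, mem_sym]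
  · rcases mem_of_support hA huv hvw huw hs hS with
      rfl | rfl | rfl | rfl | rfl | rfl | rfl | rfl | rfl
    all_goals first | contradiction | simp [doubleTriangleSet]

lemma isLineClosed_circ (hA : IsAdmissible A) (huv : u.1 ≠ v.1) (hvw : v.1 ≠ w.1)
    (huw : u.1 ≠ w.1) (hC : circSet u v w ⊆ A) (hn : sym v (opp w) ∉ A) :
    IsLineClosed (CollinearIn A) (circSet u v w) := by
  have hC' := hC
  simp only [circSet, Set.insert_subset_iff, Set.singleton_subset_iff] at hC'
  obtain ⟨h1, h2, h3, h4, h5, h6⟩ := hC'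
  have hv := hA.double_loops u v huv h1 h2 h6
  have hw := hA.double_loops u w huw h3 h4 h6
  refine isLineClosed_of_support (S := {u.1, v.1, w.1}) ?_ fun s hs hS => ?_
  · simp [circSet, mem_sym]
  · rcases mem_of_support hA huv hvw huw hs hS with
      rfl | rfl | rfl | rfl | rfl | rfl | rfl | rfl | rfl
    all_goals first | contradiction | simp [circSet]

lemma isLineClosed_doubleTriangleLoop (hA : IsAdmissible A) (huv : u.1 ≠ v.1) (hvw : v.1 ≠ w.1)
    (huw : u.1 ≠ w.1) (hC : doubleTriangleLoopSet u v w ⊆ A) :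
    IsLineClosed (CollinearIn A) (doubleTriangleLoopSet u v w) := by
  have hC' := hC
  simp only [doubleTriangleLoopSet, circSet, Set.insert_subset_iff, Set.singleton_subset_iff] at hC'
  obtain ⟨h0, h1, h2, h3, h4, h5, h6⟩ := hC'
  have hv := hA.double_loops u v huv h1 h2 h6
  have hw := hA.double_loops u w huw h3 h4 h6
  refine isLineClosed_of_support (S := {u.1, v.1, w.1}) ?_ fun s hs hS => ?_
  · simp [doubleTriangleLoopSet, circSet, mem_sym]
  · rcases mem_of_support hA huv hvw huw hs hS with
      rfl | rfl | rfl | rfl | rfl | rfl | rfl | rfl | rfl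
    all_goals first | contradiction | simp [doubleTriangleLoopSet, circSet]

end SignedGraph
end

noncomputable section

namespace SignedGraph

variable {V : Type*}

/-! ### The configurations in a set of symbols -/

def triangles (A : Set (Symbol V)) : Set (Set (Symbol V)) :=
  {C | C ⊆ A ∧ ∃ u v w : V × ℤˣ, u.1 ≠ v.1 ∧ v.1 ≠ w.1 ∧ u.1 ≠ w.1 ∧ C = triangleSet u v w}

def doubleLoops (A : Set (Symbol V)) : Set (Set (Symbol V)) :=
  {C | C ⊆ A ∧ ∃ u v : V × ℤˣ, u.1 ≠ v.1 ∧ C = doubleLoopSet u v}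

def edgeLoops (A : Set (Symbol V)) : Set (Set (Symbol V)) :=
  {C | C ⊆ A ∧ ∃ u v : V × ℤˣ, u.1 ≠ v.1 ∧ C = edgeLoopsSet u v}

def tetras (A : Set (Symbol V)) : Set (Set (Symbol V)) :=
  {C | C ⊆ A ∧ ∃ u v w x : V × ℤˣ, u.1 ≠ v.1 ∧ v.1 ≠ w.1 ∧ u.1 ≠ w.1 ∧ x.1 ≠ u.1 ∧ x.1 ≠ v.1 ∧
    x.1 ≠ w.1 ∧ C = tetraSet u v w x}

def triangleLoops (A : Set (Symbol V)) : Set (Set (Symbol V)) :=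
  {C | C ⊆ A ∧ ∃ u v w : V × ℤˣ, u.1 ≠ v.1 ∧ v.1 ≠ w.1 ∧ u.1 ≠ w.1 ∧ C = triangleLoopsSet u v w}

def doubleTriangleLoops (A : Set (Symbol V)) : Set (Set (Symbol V)) :=
  {C | C ⊆ A ∧ ∃ u v w : V × ℤˣ, u.1 ≠ v.1 ∧ v.1 ≠ w.1 ∧ u.1 ≠ w.1 ∧
    C = doubleTriangleLoopSet u v w}

def doubleTriangles (A : Set (Symbol V)) : Set (Set (Symbol V)) :=
  {C | C ⊆ A ∧ ∃ u v w : V × ℤˣ, u.1 ≠ v.1 ∧ v.1 ≠ w.1 ∧ u.1 ≠ w.1 ∧ C = doubleTriangleSet u v w}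

def circs (A : Set (Symbol V)) : Set (Set (Symbol V)) :=
  {C | C ⊆ A ∧ ∃ u v w : V × ℤˣ, u.1 ≠ v.1 ∧ v.1 ≠ w.1 ∧ u.1 ≠ w.1 ∧ C = circSet u v w}

/-- The members of a family of configurations that are not contained in a triangle of double edges
with a loop. -/
def proper (A : Set (Symbol V)) (F : Set (Set (Symbol V))) : Set (Set (Symbol V)) :=
  {C | C ∈ F ∧ ¬∃ C' ∈ doubleTriangleLoops A, C ⊆ C'}

/-- The configurations that carry relations. -/
def components (A : Set (Symbol V)) : Fin 8 → Set (Set (Symbol V)) :=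
  ![triangles A, doubleLoops A, edgeLoops A, tetras A, triangleLoops A,
    proper A (doubleTriangles A), proper A (circs A), doubleTriangleLoops A]

/-! ### The eight families: dimensions and disjointness -/

variable {A : Set (Symbol V)} {C : Set (Symbol V)}

lemma isLine_of_mem_triangles (h : C ∈ triangles A) : IsLine (CollinearIn A) C := by
  obtain ⟨hC, u, v, w, huv, hvw, huw, rfl⟩ := h
  simp only [triangleSet, Set.insert_subset_iff, Set.singleton_subset_iff] at hC
  exact ⟨_, _, _, ⟨hC.1, hC.2.1, hC.2.2, collinear_sym (ne_of_fst_ne huv) (ne_of_fst_ne hvw)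
    (ne_of_fst_ne huw)⟩, rfl⟩

lemma isLine_of_mem_doubleLoops (h : C ∈ doubleLoops A) : IsLine (CollinearIn A) C := by
  obtain ⟨hC, u, v, huv, rfl⟩ := h
  simp only [doubleLoopSet, Set.insert_subset_iff, Set.singleton_subset_iff] at hC
  exact ⟨_, _, _, ⟨hC.1, hC.2.1, hC.2.2, collinear_double huv⟩, rfl⟩

lemma isLine_of_mem_edgeLoops (h : C ∈ edgeLoops A) : IsLine (CollinearIn A) C := by
  obtain ⟨hC, u, v, huv, rfl⟩ := h
  simp only [edgeLoopsSet, Set.insert_subset_iff, Set.singleton_subset_iff] at hC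
  exact ⟨_, _, _, ⟨hC.1, hC.2.1, hC.2.2, (collinear_loops huv).rotate.rotate⟩, rfl⟩

lemma mem_lines (hA : IsAdmissible A) (h : IsLine (CollinearIn A) C) :
    C ∈ triangles A ∨ C ∈ doubleLoops A ∨ C ∈ edgeLoops A := by
  obtain ⟨x, y, t, ht, rfl⟩ := h
  have sub : ({x, y, t} : Set (Symbol V)) ⊆ A := by
    rintro s (rfl | rfl | rfl)
    exacts [ht.1, ht.2.1, ht.2.2.1]
  rcases hA.line_cases ht with h | h | h
  exacts [Or.inl ⟨sub, h⟩, Or.inr (Or.inl ⟨sub, h⟩), Or.inr (Or.inr ⟨sub, h⟩)]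

/-- A set of symbols that is not a line, but is generated by each of its lines together with any
further symbol. -/
structure IsNonlocal (A C : Set (Symbol V)) : Prop where
  closed : IsLineClosed (CollinearIn A) C
  generated : IsGeneratedByFlags (CollinearIn A) C
  not_isLine : ¬IsLine (CollinearIn A) C

lemma isNonlocal_tetras (𝕜 : Type*) [Field 𝕜] (hA : IsAdmissible A) (h : C ∈ tetras A) : IsNonlocal A C ∧
    Module.finrank 𝕜 (pieceSpace 𝕜 A (CollinearIn A)
      (block (CollinearIn A) C)) = 2 := by
  obtain ⟨hC, u, v, w, x, huv, hvw, huw, hxu, hxv, hxw, rfl⟩ := h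
  have htri := hA.isTripleSystem
  have hp := isPasch_tetra huv hvw huw hxu hxv hxw hC
  have hc := isLineClosed_tetra hA huv hvw huw hxu hxv hxw hC
  rw [← paschSet_tetra] at hc ⊢
  exact ⟨⟨hc, hp.isGeneratedByFlags htri, hp.not_isLine htri subset_rfl⟩,
    hp.finrank_pieceSpace htri hc⟩

lemma isNonlocal_triangleLoops (𝕜 : Type*) [Field 𝕜] (hA : IsAdmissible A) (h : C ∈ triangleLoops A) :
    IsNonlocal A C ∧ Module.finrank 𝕜 (pieceSpace 𝕜 A (CollinearIn A)
      (block (CollinearIn A) C)) = 2 := by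
  obtain ⟨hC, u, v, w, huv, hvw, huw, rfl⟩ := h
  have htri := hA.isTripleSystem
  have hp := isPasch_triangleLoops huv hvw huw hC
  have hc := isLineClosed_triangleLoops hA huv hvw huw hC
  rw [← paschSet_triangleLoops] at hc ⊢
  exact ⟨⟨hc, hp.isGeneratedByFlags htri, hp.not_isLine htri subset_rfl⟩,
    hp.finrank_pieceSpace htri hc⟩

lemma isNonlocal_doubleTriangleLoops (𝕜 : Type*) [Field 𝕜] (hA : IsAdmissible A)
    (h : C ∈ doubleTriangleLoops A) :
    IsNonlocal A C ∧ Module.finrank 𝕜 (pieceSpace 𝕜 A (CollinearIn A)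
      (block (CollinearIn A) C)) = 5 := by
  obtain ⟨hC, u, v, w, huv, hvw, huw, rfl⟩ := h
  have htri := hA.isTripleSystem
  have hp := isNonFano_doubleTriangleLoop huv hvw huw hC
  have hc := isLineClosed_doubleTriangleLoop hA huv hvw huw hC
  rw [← nonFanoSet_doubleTriangleLoop] at hc ⊢
  exact ⟨⟨hc, hp.isGeneratedByFlags htri, hp.not_isLine htri (Set.subset_insert _ _)⟩,
    hp.finrank_pieceSpace htri hc⟩

/-- Properness means that `v(-w)` is absent; otherwise it would be the third point on the line
through `uv` and `u(-w)`, and the closure would be a `D_3^1`. -/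
lemma isNonlocal_circs (𝕜 : Type*) [Field 𝕜] (hA : IsAdmissible A) (h : C ∈ proper A (circs A)) :
    IsNonlocal A C ∧ Module.finrank 𝕜 (pieceSpace 𝕜 A (CollinearIn A)
      (block (CollinearIn A) C)) = 2 := by
  obtain ⟨⟨hC, u, v, w, huv, hvw, huw, rfl⟩, hn⟩ := h
  have htri := hA.isTripleSystem
  have hp := isPasch_circ huv hvw huw hC
  have hc := isLineClosed_circ hA huv hvw huw hC fun hs => hn ⟨doubleTriangleLoopSet u v w,
    ⟨Set.insert_subset hs hC, u, v, w, huv, hvw, huw, rfl⟩, Set.subset_insert _ _⟩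
  rw [← paschSet_circ] at hc ⊢
  exact ⟨⟨hc, hp.isGeneratedByFlags htri, hp.not_isLine htri subset_rfl⟩,
    hp.finrank_pieceSpace htri hc⟩

lemma doubleTriangleLoopSet_eq (u v w : V × ℤˣ) :
    doubleTriangleLoopSet u v w = insert (sym u (opp u)) (doubleTriangleSet u v w) := by
  ext s
  simp only [doubleTriangleLoopSet, circSet, doubleTriangleSet, Set.mem_insert_iff,
    Set.mem_singleton_iff]
  tauto

lemma doubleTriangleSet_swap (u v w : V × ℤˣ) :
    doubleTriangleSet v u w = doubleTriangleSet u v w := by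
  ext s
  simp only [doubleTriangleSet, Set.mem_insert_iff, Set.mem_singleton_iff, sym_comm v u,
    sym_opp_right v u]
  tauto

lemma doubleTriangleSet_rotate (u v w : V × ℤˣ) :
    doubleTriangleSet w u v = doubleTriangleSet u v w := by
  ext s
  simp only [doubleTriangleSet, Set.mem_insert_iff, Set.mem_singleton_iff, sym_comm w u,
    sym_opp_right w u, sym_comm w v, sym_opp_right w v]
  tauto

/-- Properness excludes loops at all three vertices. A loop could sit at any of them, so the
symmetry of the triangle is used to present the larger configuration with its loop first. -/
lemma isNonlocal_doubleTriangles (𝕜 : Type*) [Field 𝕜] (hA : IsAdmissible A)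
    (h : C ∈ proper A (doubleTriangles A)) :
    IsNonlocal A C ∧ Module.finrank 𝕜 (pieceSpace 𝕜 A (CollinearIn A)
      (block (CollinearIn A) C)) = 2 := by
  obtain ⟨⟨hC, u, v, w, huv, hvw, huw, rfl⟩, hn⟩ := h
  have htri := hA.isTripleSystem
  have hp := isPasch_doubleTriangle huv hvw huw hC
  have hu : sym u (opp u) ∉ A := fun hs => hn ⟨_, ⟨doubleTriangleLoopSet_eq u v w ▸
    Set.insert_subset hs hC, u, v, w, huv, hvw, huw, rfl⟩,
    doubleTriangleLoopSet_eq u v w ▸ Set.subset_insert _ _⟩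
  have hv : sym v (opp v) ∉ A := fun hs => hn ⟨_, ⟨doubleTriangleLoopSet_eq v u w ▸
    Set.insert_subset hs (doubleTriangleSet_swap u v w ▸ hC), v, u, w, huv.symm, huw, hvw, rfl⟩,
    doubleTriangleLoopSet_eq v u w ▸ doubleTriangleSet_swap u v w ▸ Set.subset_insert _ _⟩
  have hw : sym w (opp w) ∉ A := fun hs => hn ⟨_, ⟨doubleTriangleLoopSet_eq w u v ▸
    Set.insert_subset hs (doubleTriangleSet_rotate u v w ▸ hC), w, u, v, huw.symm, huv, hvw.symm,
    rfl⟩, doubleTriangleLoopSet_eq w u v ▸ doubleTriangleSet_rotate u v w ▸ Set.subset_insert _ _⟩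
  have hc := isLineClosed_doubleTriangle hA huv hvw huw hu hv hw
  rw [← paschSet_doubleTriangle] at hc ⊢
  exact ⟨⟨hc, hp.isGeneratedByFlags htri, hp.not_isLine htri subset_rfl⟩,
    hp.finrank_pieceSpace htri hc⟩

/-- The vertices of a set of symbols. -/
def support (C : Set (Symbol V)) : Set V := {i | ∃ s ∈ C, i ∈ s.1}

/-- The vertices of the loops of a set of symbols. -/
def loopSupport (C : Set (Symbol V)) : Set V := {i | ∃ s ∈ C, s.1 = s(i, i)}

lemma sym_fst_eq_diag {u v : V × ℤˣ} {i : V} : (sym u v).1 = s(i, i) ↔ u.1 = i ∧ v.1 = i := by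
  simp [sym]

lemma ncard_of_mem_triangles (h : C ∈ triangles A) :
    (support C).ncard = 3 ∧ (loopSupport C).ncard = 0 := by
  obtain ⟨-, u, v, w, huv, hvw, huw, rfl⟩ := h
  have e1 : support (triangleSet u v w) = {u.1, v.1, w.1} := by
    ext i; simp [support, triangleSet, mem_sym]; tauto
  have e2 : loopSupport (triangleSet u v w) = ∅ := by
    ext i; simp [loopSupport, triangleSet, sym_fst_eq_diag]; grind
  rw [e1, e2, Set.ncard_eq_three]
  exact ⟨⟨_, _, _, huv, huw, hvw, rfl⟩, Set.ncard_empty _⟩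

lemma ncard_of_mem_doubleLoops (h : C ∈ doubleLoops A) :
    (support C).ncard = 2 ∧ (loopSupport C).ncard = 1 := by
  obtain ⟨-, u, v, huv, rfl⟩ := h
  have e1 : support (doubleLoopSet u v) = {u.1, v.1} := by
    ext i; simp [support, doubleLoopSet, mem_sym]; tauto
  have e2 : loopSupport (doubleLoopSet u v) = {u.1} := by
    ext i; simp [loopSupport, doubleLoopSet, sym_fst_eq_diag]; grind
  rw [e1, e2]
  exact ⟨Set.ncard_pair huv, Set.ncard_singleton _⟩

lemma ncard_of_mem_edgeLoops (h : C ∈ edgeLoops A) :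
    (support C).ncard = 2 ∧ (loopSupport C).ncard = 2 := by
  obtain ⟨-, u, v, huv, rfl⟩ := h
  have e1 : support (edgeLoopsSet u v) = {u.1, v.1} := by
    ext i; simp [support, edgeLoopsSet, mem_sym]
  have e2 : loopSupport (edgeLoopsSet u v) = {u.1, v.1} := by
    ext i; simp [loopSupport, edgeLoopsSet, sym_fst_eq_diag]; grind
  rw [e1, e2]
  exact ⟨Set.ncard_pair huv, Set.ncard_pair huv⟩

lemma ncard_of_mem_tetras (h : C ∈ tetras A) :
    (support C).ncard = 4 ∧ (loopSupport C).ncard = 0 := by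
  obtain ⟨-, u, v, w, x, huv, hvw, huw, hxu, hxv, hxw, rfl⟩ := h
  have e1 : support (tetraSet u v w x) = {x.1, u.1, v.1, w.1} := by
    ext i; simp [support, tetraSet, mem_sym]; tauto
  have e2 : loopSupport (tetraSet u v w x) = ∅ := by
    ext i; simp [loopSupport, tetraSet, sym_fst_eq_diag]; grind
  rw [e1, e2, Set.ncard_insert_of_notMem (by simp [hxu, hxv, hxw]),
    Set.ncard_eq_three.2 ⟨_, _, _, huv, huw, hvw, rfl⟩]
  simp

lemma ncard_of_mem_triangleLoops (h : C ∈ triangleLoops A) :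
    (support C).ncard = 3 ∧ (loopSupport C).ncard = 3 := by
  obtain ⟨-, u, v, w, huv, hvw, huw, rfl⟩ := h
  have e1 : support (triangleLoopsSet u v w) = {u.1, v.1, w.1} := by
    ext i; simp [support, triangleLoopsSet, mem_sym]; tauto
  have e2 : loopSupport (triangleLoopsSet u v w) = {u.1, v.1, w.1} := by
    ext i; simp [loopSupport, triangleLoopsSet, sym_fst_eq_diag]; grind
  rw [e1, e2, Set.ncard_eq_three]
  exact ⟨⟨_, _, _, huv, huw, hvw, rfl⟩, ⟨_, _, _, huv, huw, hvw, rfl⟩⟩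

lemma ncard_of_mem_doubleTriangles (h : C ∈ doubleTriangles A) :
    (support C).ncard = 3 ∧ (loopSupport C).ncard = 0 := by
  obtain ⟨-, u, v, w, huv, hvw, huw, rfl⟩ := h
  have e1 : support (doubleTriangleSet u v w) = {u.1, v.1, w.1} := by
    ext i; simp [support, doubleTriangleSet, mem_sym]; tauto
  have e2 : loopSupport (doubleTriangleSet u v w) = ∅ := by
    ext i; simp [loopSupport, doubleTriangleSet, sym_fst_eq_diag]; grind
  rw [e1, e2, Set.ncard_eq_three]
  exact ⟨⟨_, _, _, huv, huw, hvw, rfl⟩, Set.ncard_empty _⟩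

lemma ncard_of_mem_circs (h : C ∈ circs A) :
    (support C).ncard = 3 ∧ (loopSupport C).ncard = 1 := by
  obtain ⟨-, u, v, w, huv, hvw, huw, rfl⟩ := h
  have e1 : support (circSet u v w) = {u.1, v.1, w.1} := by
    ext i; simp [support, circSet, mem_sym]; tauto
  have e2 : loopSupport (circSet u v w) = {u.1} := by
    ext i; simp [loopSupport, circSet, sym_fst_eq_diag]; grind
  rw [e1, e2, Set.ncard_eq_three]
  exact ⟨⟨_, _, _, huv, huw, hvw, rfl⟩, Set.ncard_singleton _⟩

lemma ncard_of_mem_doubleTriangleLoops (h : C ∈ doubleTriangleLoops A) :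
    (support C).ncard = 3 ∧ (loopSupport C).ncard = 1 := by
  obtain ⟨-, u, v, w, huv, hvw, huw, rfl⟩ := h
  have e1 : support (doubleTriangleLoopSet u v w) = {u.1, v.1, w.1} := by
    ext i; simp [support, doubleTriangleLoopSet, circSet, mem_sym]; tauto
  have e2 : loopSupport (doubleTriangleLoopSet u v w) = {u.1} := by
    ext i; simp [loopSupport, doubleTriangleLoopSet, circSet, sym_fst_eq_diag]; grind
  rw [e1, e2, Set.ncard_eq_three]
  exact ⟨⟨_, _, _, huv, huw, hvw, rfl⟩, Set.ncard_singleton _⟩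

lemma isLine_or_isNonlocal (𝕜 : Type*) [Field 𝕜] (hA : IsAdmissible A) (j : Fin 8)
    (h : C ∈ components A j) : (IsLine (CollinearIn A) C ∨ IsNonlocal A C) ∧
    Module.finrank 𝕜 (pieceSpace 𝕜 A (CollinearIn A) (block (CollinearIn A) C)) =
      if j = 7 then 5 else 2 := by
  have htri := hA.isTripleSystem
  have line : IsLine (CollinearIn A) C → (IsLine (CollinearIn A) C ∨ IsNonlocal A C) ∧
    Module.finrank 𝕜 (pieceSpace 𝕜 A (CollinearIn A) (block (CollinearIn A) C)) = 2 :=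
    fun h => ⟨Or.inl h, finrank_pieceSpace_line htri h⟩
  fin_cases j
  · exact line (isLine_of_mem_triangles h)
  · exact line (isLine_of_mem_doubleLoops h)
  · exact line (isLine_of_mem_edgeLoops h)
  · exact (isNonlocal_tetras 𝕜 hA h).imp_left Or.inr
  · exact (isNonlocal_triangleLoops 𝕜 hA h).imp_left Or.inr
  · exact (isNonlocal_doubleTriangles 𝕜 hA h).imp_left Or.inr
  · exact (isNonlocal_circs 𝕜 hA h).imp_left Or.inr
  · exact (isNonlocal_doubleTriangleLoops 𝕜 hA h).imp_left Or.inr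

/-- The numbers of vertices and of loops separate the families except for two pairs. A triangle
differs from a triangle of double edges by being a line, and a proper `G_∘` is by definition not in
a `D_3^1`. -/
lemma components_disjoint (hA : IsAdmissible A) {j k : Fin 8} (hj : C ∈ components A j)
    (hk : C ∈ components A k) : j = k := by
  have key : ∀ i : Fin 8, C ∈ components A i →
      ((support C).ncard = (![3, 2, 2, 4, 3, 3, 3, 3] : Fin 8 → ℕ) i ∧
        (loopSupport C).ncard = (![0, 1, 2, 0, 3, 0, 1, 1] : Fin 8 → ℕ) i) ∧
      (i = 0 → IsLine (CollinearIn A) C) ∧ (i = 5 → ¬IsLine (CollinearIn A) C) ∧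
      (i = 6 → C ∉ doubleTriangleLoops A) ∧ (i = 7 → C ∈ doubleTriangleLoops A) := by
    intro i hi
    refine ⟨?_, ?_, ?_, ?_, ?_⟩
    · fin_cases i
      exacts [ncard_of_mem_triangles hi, ncard_of_mem_doubleLoops hi, ncard_of_mem_edgeLoops hi,
        ncard_of_mem_tetras hi, ncard_of_mem_triangleLoops hi, ncard_of_mem_doubleTriangles hi.1,
        ncard_of_mem_circs hi.1, ncard_of_mem_doubleTriangleLoops hi]
    · rintro rfl; exact isLine_of_mem_triangles hi
    · rintro rfl; exact (isNonlocal_doubleTriangles ℚ hA hi).1.not_isLine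
    · rintro rfl h; exact hi.2 ⟨C, h, subset_rfl⟩
    · rintro rfl; exact hi
  obtain ⟨⟨j1, j2⟩, j3, j4, j5, j6⟩ := key j hj
  obtain ⟨⟨k1, k2⟩, k3, k4, k5, k6⟩ := key k hk
  rw [j1] at k1
  rw [j2] at k2
  clear hj hk j1 j2 key
  fin_cases j <;> fin_cases k <;> first | rfl | (simp at k1; done) | (simp at k2; done) | simp_all

end SignedGraph
end

/-! ### Decomposition of the relation space -/

noncomputable section

namespace SignedGraph

variable {V : Type*} {A : Set (Symbol V)}

lemma isLineClosed_of_mem_components (hA : IsAdmissible A) {j : Fin 8} {C : Set (Symbol V)}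
    (h : C ∈ components A j) : IsLineClosed (CollinearIn A) C := by
  rcases (isLine_or_isNonlocal ℚ hA j h).1 with h | h
  · exact hA.isTripleSystem.closed_of_isLine h
  · exact h.closed

lemma exists_component_of_isPaschConfig {C : Set (Symbol V)} (h : IsPaschConfig C) (hC : C ⊆ A) :
    ∃ (j : Fin 8) (D : Set (Symbol V)), D ∈ components A j ∧ C ⊆ D := by
  rcases h with ⟨u, v, w, huv, hvw, huw, h⟩ | h
  · by_cases hD : ∃ D ∈ doubleTriangleLoops A, C ⊆ D
    · obtain ⟨D, hD, hCD⟩ := hD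
      exact ⟨7, D, hD, hCD⟩
    · rcases h with h | h | h
      · exact ⟨5, C, ⟨⟨hC, u, v, w, huv, hvw, huw, h⟩, hD⟩, subset_rfl⟩
      · exact ⟨6, C, ⟨⟨hC, u, v, w, huv, hvw, huw, h⟩, hD⟩, subset_rfl⟩
      · exact ⟨4, C, ⟨hC, u, v, w, huv, hvw, huw, h⟩, subset_rfl⟩
  · exact ⟨3, C, ⟨hC, h⟩, subset_rfl⟩

lemma exists_component_of_isLine (hA : IsAdmissible A) {C : Set (Symbol V)}
    (h : IsLine (CollinearIn A) C) : ∃ j : Fin 8, C ∈ components A j := by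
  rcases mem_lines hA h with h | h | h
  exacts [⟨0, h⟩, ⟨1, h⟩, ⟨2, h⟩]

variable {𝕜 : Type*} [Field 𝕜]

/-- The part of a relation outside all blocks is again a relation, because the complement of the
blocks is invariant. It is reduced, hence zero. -/
lemma exists_component_of_ne_zero (hA : IsAdmissible A) {z : Symbol V → Symbol V → Symbol V → 𝕜}
    (hz : z ∈ relationSpace 𝕜 A (CollinearIn A)) {h a b : Symbol V} (h0 : z h a b ≠ 0) :
    ∃ i : Σ j, components A j, block (CollinearIn A) i.2.1 h a b := by
  have htri := hA.isTripleSystem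
  have hinv : ∀ i : Σ j, components A j, IsInvariantBlock (CollinearIn A)
      (block (CollinearIn A) i.2.1) := fun i =>
    htri.block_isInvariant (isLineClosed_of_mem_components hA i.2.2)
  let blk : Symbol V → Symbol V → Symbol V → Prop := fun h a b =>
    ¬∃ i : Σ j, components A j, block (CollinearIn A) i.2.1 h a b
  have hblk : IsInvariantBlock (CollinearIn A) blk :=
    { swap := fun hb ⟨i, hi⟩ => hb ⟨i, (hinv i).swap hi⟩
      rotate := fun hb ⟨i, hi⟩ => hb ⟨i, (hinv i).rotate ((hinv i).rotate hi)⟩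
      exchange := fun t hb ⟨i, hi⟩ => hb ⟨i, (hinv i).exchange (htri.rotate (htri.rotate t))
        ((hinv i).exchange (htri.rotate t) hi)⟩ }
  by_contra hn
  have hline : ∀ h a b, OnLine (CollinearIn A) h a b → ¬blk h a b := by
    rintro h a b ⟨x, y, t, ht, hh, ha, hb⟩ hbl
    have hl : IsLine (CollinearIn A) {x, y, t} := ⟨x, y, t, ht, rfl⟩
    obtain ⟨j, hj⟩ := exists_component_of_isLine hA hl
    exact hbl ⟨⟨j, _, hj⟩, hh, ha, hb, fun _ => hl⟩
  have hred : IsReduced A (cutOff blk z) :=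
    { mem := (cutOff_mem htri hblk hz).1
      line := fun h a b hl => cutOff_of_not (hline h a b hl) z
      config := by
        intro C hC hCA h hh a ha b hb
        apply cutOff_of_not
        by_cases hl : OnLine (CollinearIn A) h a b
        · exact hline h a b hl
        · obtain ⟨j, D, hD, hCD⟩ := exists_component_of_isPaschConfig hC hCA
          exact fun hbl => hbl ⟨⟨j, D, hD⟩, hCD hh, hCD ha, hCD hb, fun hl' => absurd hl' hl⟩ }
  apply h0
  rw [← cutOff_of (show blk h a b from hn) z, hred.eq_zero hA]
  rfl

/-- If `h, a, b` are on one line, both components are that line. If not, both are nonlocal, and each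
is generated by `h` and the line through `a, b`, so each contains the other. -/
lemma component_eq (hA : IsAdmissible A) (i i' : Σ j, components A j) {h a b c : Symbol V}
    (t : CollinearIn A a b c) (hi : block (CollinearIn A) i.2.1 h a b)
    (hi' : block (CollinearIn A) i'.2.1 h a b) : i = i' := by
  have htri := hA.isTripleSystem
  obtain ⟨j, C, hC⟩ := i
  obtain ⟨j', C', hC'⟩ := i'
  obtain ⟨h1, h2, h3, h4⟩ := hi
  obtain ⟨h1', h2', h3', h4'⟩ := hi'
  dsimp only at *
  have hcl := isLineClosed_of_mem_components hA hC
  have hcl' := isLineClosed_of_mem_components hA hC'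
  have e : C = C' := by
    by_cases hl : OnLine (CollinearIn A) h a b
    · obtain ⟨x, y, s, hs, rfl⟩ := h4 hl
      obtain ⟨x', y', s', hs', rfl⟩ := h4' hl
      rw [htri.eq_of_mem_of_mem t hs h2 h3, htri.eq_of_mem_of_mem t hs' h2' h3']
    · have hl' := hl
      rw [htri.onLine_iff t, not_or, not_or] at hl'
      have sub : ∀ {j : Fin 8} {C D : Set (Symbol V)}, C ∈ components A j → h ∈ C → a ∈ C →
          b ∈ C → IsLineClosed (CollinearIn A) D → h ∈ D → a ∈ D → b ∈ D → C ⊆ D := by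
        intro j C D hC h1 h2 h3 hD h1' h2' h3'
        rcases (isLine_or_isNonlocal ℚ hA j hC).1 with hC | hC
        · obtain ⟨x, y, s, hs, rfl⟩ := hC
          exact absurd ⟨x, y, s, hs, h1, h2, h3⟩ hl
        · exact hC.generated D hD h a b c t hl'.1 hl'.2.1 hl'.2.2 h1 h2 h3
            (hC.closed _ _ _ t h2 h3) h1' h2' h3'
      exact (sub hC h1 h2 h3 hcl' h1' h2' h3').antisymm (sub hC' h1' h2' h3' hcl h1 h2 h3)
  subst e
  obtain rfl := components_disjoint hA hC hC'
  rfl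

/-- The dimension of the space of relations, in terms of the configurations. -/
theorem finrank_relationSpace [Finite V] (hA : IsAdmissible A) :
    Module.finrank 𝕜 (relationSpace 𝕜 A (CollinearIn A)) =
      2 * ((triangles A).ncard + (tetras A).ncard + (proper A (doubleTriangles A)).ncard +
        (doubleLoops A).ncard + (edgeLoops A).ncard + (triangleLoops A).ncard +
        (proper A (circs A)).ncard) + 5 * (doubleTriangleLoops A).ncard := by
  classical
  have htri := hA.isTripleSystem
  have : Finite (Symbol V) := inferInstance
  have fin : ∀ j, Fintype (components A j) := fun j => Fintype.ofFinite _
  rw [finrank_relationSpace_eq_sum htri (I := Σ j, components A j)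
    (fun i => block (CollinearIn A) i.2.1)
    (fun i => htri.block_isInvariant (isLineClosed_of_mem_components hA i.2.2))
    (fun i j h a b c t hi hj => component_eq hA i j t hi hj)
    (fun z hz h a b h0 => exists_component_of_ne_zero hA hz h0), Fintype.sum_sigma]
  have : ∀ j, (∑ C : components A j, Module.finrank 𝕜 (pieceSpace 𝕜 A (CollinearIn A)
      (block (CollinearIn A) C.1))) = (components A j).ncard * if j = 7 then 5 else 2 := by
    intro j
    rw [Finset.sum_congr rfl fun C _ => (isLine_or_isNonlocal 𝕜 hA j C.2).2, Finset.sum_const,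
      Finset.card_univ, smul_eq_mul, ← Nat.card_eq_fintype_card, Nat.card_coe_set_eq]
  simp only [this, Fin.sum_univ_eight]
  simp [components]
  ring

end SignedGraph
end

/-! ### Subgraphs as sets of symbols, switching copies as images -/

noncomputable section

namespace SignedGraph

variable {V W : Type*}

lemma mem_symbols_iff {G : SignedGraph V} {x : Symbol V} : x ∈ G.symbols ↔
    (∃ a b, G.pos.Adj a b ∧ x = (s(a, b), 1)) ∨ (∃ a b, G.neg.Adj a b ∧ x = (s(a, b), -1)) ∨
      ∃ a ∈ G.loops, x = (s(a, a), -1) := by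
  constructor
  · rintro ⟨⟨i, s⟩, ⟨j, t⟩, h, rfl⟩
    rcases h with ⟨h1, h2⟩ | ⟨h1, h2⟩ | ⟨h1, h2⟩
    · obtain rfl : s = t := h1
      exact Or.inl ⟨i, j, h2, by simp [sym]⟩
    · refine Or.inr (Or.inl ⟨i, j, h2, ?_⟩)
      rcases Int.units_eq_one_or s with rfl | rfl <;>
      rcases Int.units_eq_one_or t with rfl | rfl <;> simp_all [sym]
    · simp only [opp, Prod.mk.injEq] at h1
      obtain ⟨rfl, rfl⟩ := h1
      exact Or.inr (Or.inr ⟨i, h2, by simp [sym]⟩)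
  · rintro (⟨a, b, h, rfl⟩ | ⟨a, b, h, rfl⟩ | ⟨a, h, rfl⟩)
    · exact ⟨(a, 1), (b, 1), Or.inl ⟨rfl, h⟩, by simp [sym]⟩
    · exact ⟨(a, 1), (b, -1), Or.inr (Or.inl ⟨by simp, h⟩), by simp [sym]⟩
    · exact ⟨(a, 1), (a, -1), Or.inr (Or.inr ⟨by simp [opp], h⟩), by simp [sym]⟩

lemma pos_mem_symbols {G : SignedGraph V} {a b : V} : (s(a, b), 1) ∈ G.symbols ↔ G.pos.Adj a b := by
  have h := sym_mem_symbols (G := G) (u := (a, 1)) (v := (b, 1))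
  simp only [sym, mul_one] at h
  rw [h]
  simp [Adj, opp]

/-- For `a = b` the same symbol stands for a loop, hence the hypothesis. -/
lemma neg_mem_symbols {G : SignedGraph V} {a b : V} (hab : a ≠ b) :
    (s(a, b), -1) ∈ G.symbols ↔ G.neg.Adj a b := by
  have h := sym_mem_symbols (G := G) (u := (a, 1)) (v := (b, -1))
  simp only [sym, one_mul] at h
  rw [h]
  simp [Adj, opp, hab]

lemma loop_mem_symbols {G : SignedGraph V} {a : V} : (s(a, a), -1) ∈ G.symbols ↔ a ∈ G.loops := by
  have h := sym_mem_symbols (G := G) (u := (a, 1)) (v := (a, -1))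
  simp only [sym, one_mul] at h
  rw [h]
  simp [Adj, opp]

/-- The symbols of the image of `K` under a map to the signed vertices. -/
def mapSymbols (K : SignedGraph W) (u : W → V × ℤˣ) : Set (Symbol V) :=
  {x | (∃ i j, K.pos.Adj i j ∧ x = sym (u i) (u j)) ∨
    (∃ i j, K.neg.Adj i j ∧ x = sym (u i) (opp (u j))) ∨ ∃ i ∈ K.loops, x = sym (u i) (opp (u i))}

/-- The sets of symbols in `A` that are images of `K`. -/
def images (A : Set (Symbol V)) (K : SignedGraph W) : Set (Set (Symbol V)) :=
  {C | C ⊆ A ∧ ∃ u : W → V × ℤˣ, Function.Injective (fun i => (u i).1) ∧ C = mapSymbols K u}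

lemma support_mono {C D : Set (Symbol V)} (h : C ⊆ D) : support C ⊆ support D :=
  fun _ ⟨s, hs, hi⟩ => ⟨s, h hs, hi⟩

/-- No vertex of `K` is isolated, so the edges remember all vertices; this is the role of `hK`
throughout the correspondence. -/
lemma support_mapSymbols {K : SignedGraph W} (hK : ∀ i, ∃ j, K.pos.Adj i j) (u : W → V × ℤˣ) :
    support (mapSymbols K u) = Set.range fun i => (u i).1 := by
  ext a
  constructor
  · rintro ⟨s, ⟨i, j, -, rfl⟩ | ⟨i, j, -, rfl⟩ | ⟨i, -, rfl⟩, h⟩ <;>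
    rcases mem_sym.1 h with rfl | rfl
    exacts [⟨i, rfl⟩, ⟨j, rfl⟩, ⟨i, rfl⟩, ⟨j, rfl⟩, ⟨i, rfl⟩, ⟨i, rfl⟩]
  · rintro ⟨i, rfl⟩
    obtain ⟨j, hj⟩ := hK i
    exact ⟨_, Or.inl ⟨i, j, hj, rfl⟩, mem_sym.2 (Or.inl rfl)⟩

variable {G : SignedGraph V}

namespace Subgraph

/-- The symbols of the edges and loops of a subgraph. -/
def symbols (H : G.Subgraph) : Set (Symbol V) := (⟨H.pos, H.neg, H.loops⟩ : SignedGraph V).symbols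

lemma symbols_subset (H : G.Subgraph) : H.symbols ⊆ G.symbols := by
  intro x hx
  rcases mem_symbols_iff.1 hx with ⟨a, b, h, rfl⟩ | ⟨a, b, h, rfl⟩ | ⟨a, h, rfl⟩
  · exact mem_symbols_iff.2 (Or.inl ⟨a, b, H.pos_le h, rfl⟩)
  · exact mem_symbols_iff.2 (Or.inr (Or.inl ⟨a, b, H.neg_le h, rfl⟩))
  · exact mem_symbols_iff.2 (Or.inr (Or.inr ⟨a, H.loops_subset h, rfl⟩))

lemma isContainedIn_iff {H H' : G.Subgraph} (hH : H.verts = support H.symbols)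
    (hH' : H'.verts = support H'.symbols) : H.IsContainedIn H' ↔ H.symbols ⊆ H'.symbols := by
  constructor
  · rintro ⟨-, h1, h2, h3⟩ x hx
    rcases mem_symbols_iff.1 hx with ⟨a, b, h, rfl⟩ | ⟨a, b, h, rfl⟩ | ⟨a, h, rfl⟩
    · exact mem_symbols_iff.2 (Or.inl ⟨a, b, h1 h, rfl⟩)
    · exact mem_symbols_iff.2 (Or.inr (Or.inl ⟨a, b, h2 h, rfl⟩))
    · exact mem_symbols_iff.2 (Or.inr (Or.inr ⟨a, h3 h, rfl⟩))
  · intro h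
    refine ⟨hH ▸ hH' ▸ support_mono h, fun a b hab => ?_, fun a b hab => ?_, fun a ha => ?_⟩
    · exact pos_mem_symbols.1 (h (pos_mem_symbols.2 hab))
    · exact (neg_mem_symbols hab.ne).1 (h ((neg_mem_symbols hab.ne).2 hab))
    · exact loop_mem_symbols.1 (h (loop_mem_symbols.2 ha))

lemma eq_of_symbols_eq {H H' : G.Subgraph} (hH : H.verts = support H.symbols)
    (hH' : H'.verts = support H'.symbols) (h : H.symbols = H'.symbols) : H = H' := by
  obtain ⟨h1, h2, h3, h4⟩ := (isContainedIn_iff hH hH').2 h.subset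
  obtain ⟨k1, k2, k3, k4⟩ := (isContainedIn_iff hH' hH).2 h.symm.subset
  exact Subgraph.ext (h1.antisymm k1) (h2.antisymm k2) (h3.antisymm k3) (h4.antisymm k4)

/-- The subgraph with given symbols. -/
def ofSymbols (C : Set (Symbol V)) (hC : C ⊆ G.symbols) : G.Subgraph where
  verts := support C
  pos := { Adj := fun a b => (s(a, b), 1) ∈ C
           symm := ⟨fun a b h => by rwa [Sym2.eq_swap]⟩
           loopless := ⟨fun a h => G.pos.loopless.irrefl a (pos_mem_symbols.1 (hC h))⟩ }
  -- The negative symbol on `s(a, a)` is a loop and must not be read as an edge.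
  neg := { Adj := fun a b => a ≠ b ∧ (s(a, b), -1) ∈ C
           symm := ⟨fun a b h => ⟨h.1.symm, by rw [Sym2.eq_swap]; exact h.2⟩⟩
           loopless := ⟨fun a h => h.1 rfl⟩ }
  loops := {a | (s(a, a), -1) ∈ C}
  pos_le := fun _ _ h => pos_mem_symbols.1 (hC h)
  neg_le := fun _ _ h => (neg_mem_symbols h.1).1 (hC h.2)
  loops_subset := fun _ h => loop_mem_symbols.1 (hC h)
  pos_verts := fun a b h => ⟨⟨_, h, by simp⟩, ⟨_, h, by simp⟩⟩
  neg_verts := fun a b h => ⟨⟨_, h.2, by simp⟩, ⟨_, h.2, by simp⟩⟩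
  loops_verts := fun a h => ⟨_, h, by simp⟩

lemma symbols_ofSymbols (C : Set (Symbol V)) (hC : C ⊆ G.symbols) :
    (ofSymbols C hC).symbols = C := by
  ext x
  constructor
  · intro hx
    rcases mem_symbols_iff.1 hx with ⟨a, b, h, rfl⟩ | ⟨a, b, h, rfl⟩ | ⟨a, h, rfl⟩
    exacts [h, h.2, h]
  · intro hx
    rcases mem_symbols_iff.1 (hC hx) with ⟨a, b, h, rfl⟩ | ⟨a, b, h, rfl⟩ | ⟨a, h, rfl⟩
    · exact mem_symbols_iff.2 (Or.inl ⟨a, b, hx, rfl⟩)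
    · exact mem_symbols_iff.2 (Or.inr (Or.inl ⟨a, b, ⟨h.ne, hx⟩, rfl⟩))
    · exact mem_symbols_iff.2 (Or.inr (Or.inr ⟨a, hx, rfl⟩))

end Subgraph

lemma eq_neg_of_units_ne {s t : ℤˣ} (h : s ≠ t) : s * t = -1 := by
  rcases Int.units_eq_one_or s with rfl | rfl <;>
  rcases Int.units_eq_one_or t with rfl | rfl <;> simp_all

lemma one_eq_mul_units {s t : ℤˣ} : 1 = s * t ↔ s = t := by
  rcases Int.units_eq_one_or s with rfl | rfl <;>
  rcases Int.units_eq_one_or t with rfl | rfl <;> simp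

lemma neg_one_eq_mul_units {s t : ℤˣ} : -1 = s * t ↔ s ≠ t := by
  rcases Int.units_eq_one_or s with rfl | rfl <;>
  rcases Int.units_eq_one_or t with rfl | rfl <;> simp

/-- A map to signed vertices encodes both data of a switching copy: its first component is the
inverse of the isomorphism, its second the switching function. -/
lemma exists_of_mem_switchingCopies {K : SignedGraph W} {H : G.Subgraph}
    (h : H ∈ G.switchingCopies K) : ∃ u : W → V × ℤˣ, Function.Injective (fun i => (u i).1) ∧
      H.verts = Set.range (fun i => (u i).1) ∧ H.symbols = mapSymbols K u := by
  obtain ⟨σ, e, h1, h2, h3⟩ := h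
  refine ⟨fun i => (e.symm i, σ i), fun i j h => e.symm.injective (Subtype.ext h), ?_, ?_⟩
  · ext a
    exact ⟨fun ha => ⟨e ⟨a, ha⟩, by simp⟩, by rintro ⟨i, rfl⟩; exact (e.symm i).2⟩
  · ext x
    rw [Subgraph.symbols, mem_symbols_iff]
    constructor
    · rintro (⟨a, b, h, rfl⟩ | ⟨a, b, h, rfl⟩ | ⟨a, h, rfl⟩)
      · obtain ⟨ha, hb⟩ := H.pos_verts a b h
        rcases (h1 ⟨a, ha⟩ ⟨b, hb⟩).1 h with ⟨hs, hk⟩ | ⟨hs, hk⟩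
        · exact Or.inl ⟨_, _, hk, by simp [sym, hs]⟩
        · refine Or.inr (Or.inl ⟨_, _, hk, ?_⟩)
          simp [sym, opp, eq_neg_of_units_ne hs]
      · obtain ⟨ha, hb⟩ := H.neg_verts a b h
        rcases (h2 ⟨a, ha⟩ ⟨b, hb⟩).1 h with ⟨hs, hk⟩ | ⟨hs, hk⟩
        · refine Or.inr (Or.inl ⟨_, _, hk, ?_⟩)
          simp [sym, opp, hs]
        · exact Or.inl ⟨_, _, hk, by simp [sym, eq_neg_of_units_ne hs]⟩
      · have ha := H.loops_verts h
        exact Or.inr (Or.inr ⟨_, (h3 ⟨a, ha⟩).1 h, by simp [sym, opp]⟩)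
    · rintro (⟨i, j, hk, rfl⟩ | ⟨i, j, hk, rfl⟩ | ⟨i, hk, rfl⟩)
      · by_cases hs : σ i = σ j
        · refine Or.inl ⟨e.symm i, e.symm j, (h1 (e.symm i) (e.symm j)).2 (Or.inl ?_), ?_⟩
          · simpa using ⟨hs, hk⟩
          · simp [sym, hs]
        · refine Or.inr (Or.inl ⟨e.symm i, e.symm j, (h2 (e.symm i) (e.symm j)).2 (Or.inr ?_), ?_⟩)
          · simpa using ⟨hs, hk⟩
          · simp [sym, eq_neg_of_units_ne hs]
      · by_cases hs : σ i = σ j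
        · refine Or.inr (Or.inl ⟨e.symm i, e.symm j, (h2 (e.symm i) (e.symm j)).2 (Or.inl ?_), ?_⟩)
          · simpa using ⟨hs, hk⟩
          · simp [sym, opp, hs]
        · refine Or.inl ⟨e.symm i, e.symm j, (h1 (e.symm i) (e.symm j)).2 (Or.inr ?_), ?_⟩
          · simpa using ⟨hs, hk⟩
          · simp [sym, opp, eq_neg_of_units_ne hs]
      · refine Or.inr (Or.inr ⟨e.symm i, (h3 (e.symm i)).2 ?_, by simp [sym, opp]⟩)
        rw [e.apply_symm_apply]
        exact hk

lemma verts_of_mem_switchingCopies {K : SignedGraph W} (hK : ∀ i, ∃ j, K.pos.Adj i j)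
    {H : G.Subgraph} (h : H ∈ G.switchingCopies K) : H.verts = support H.symbols := by
  obtain ⟨u, -, h1, h2⟩ := exists_of_mem_switchingCopies h
  rw [h1, h2, support_mapSymbols hK]

lemma mem_mapSymbols {K : SignedGraph W} {u : W → V × ℤˣ}
    (hu : Function.Injective (fun i => (u i).1)) {i j : W} (hij : i ≠ j) {ε : ℤˣ} :
    (s((u i).1, (u j).1), ε) ∈ mapSymbols K u ↔
      (ε = (u i).2 * (u j).2 ∧ K.pos.Adj i j) ∨ (ε = -((u i).2 * (u j).2) ∧ K.neg.Adj i j) := by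
  have inj : ∀ {k l}, (u k).1 = (u l).1 → k = l := fun h => hu h
  constructor
  · rintro (⟨k, l, hk, h⟩ | ⟨k, l, hk, h⟩ | ⟨k, -, h⟩)
    · simp only [sym, Prod.mk.injEq, Sym2.eq_iff] at h
      obtain ⟨⟨h1, h2⟩ | ⟨h1, h2⟩, rfl⟩ := h <;> obtain rfl := inj h1 <;> obtain rfl := inj h2
      exacts [Or.inl ⟨rfl, hk⟩, Or.inl ⟨mul_comm _ _, hk.symm⟩]
    · simp only [sym, opp, Prod.mk.injEq, Sym2.eq_iff, mul_neg] at h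
      obtain ⟨⟨h1, h2⟩ | ⟨h1, h2⟩, rfl⟩ := h <;> obtain rfl := inj h1 <;> obtain rfl := inj h2
      exacts [Or.inr ⟨rfl, hk⟩, Or.inr ⟨by rw [mul_comm], hk.symm⟩]
    · simp only [sym, opp, Prod.mk.injEq, Sym2.eq_iff] at h
      obtain ⟨⟨h1, h2⟩ | ⟨h1, h2⟩, rfl⟩ := h <;> exact absurd ((inj h1).trans (inj h2).symm) hij
  · rintro (⟨rfl, h⟩ | ⟨rfl, h⟩)
    · exact Or.inl ⟨i, j, h, rfl⟩
    · exact Or.inr (Or.inl ⟨i, j, h, by simp [sym, opp]⟩)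

lemma loop_mem_mapSymbols {K : SignedGraph W} {u : W → V × ℤˣ}
    (hu : Function.Injective (fun i => (u i).1)) {i : W} :
    (s((u i).1, (u i).1), -1) ∈ mapSymbols K u ↔ i ∈ K.loops := by
  have inj : ∀ {k l}, (u k).1 = (u l).1 → k = l := fun h => hu h
  constructor
  · rintro (⟨k, l, hk, h⟩ | ⟨k, l, hk, h⟩ | ⟨k, hk, h⟩)
    · simp only [sym, Prod.mk.injEq, Sym2.eq_iff] at h
      obtain ⟨⟨h1, h2⟩ | ⟨h1, h2⟩, -⟩ := h
      exacts [absurd ((inj h1).symm.trans (inj h2)) hk.ne,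
        absurd ((inj h2).symm.trans (inj h1)) hk.ne]
    · simp only [sym, opp, Prod.mk.injEq, Sym2.eq_iff] at h
      obtain ⟨⟨h1, h2⟩ | ⟨h1, h2⟩, -⟩ := h
      exacts [absurd ((inj h1).symm.trans (inj h2)) hk.ne,
        absurd ((inj h2).symm.trans (inj h1)) hk.ne]
    · simp only [sym, opp, Prod.mk.injEq, Sym2.eq_iff] at h
      obtain ⟨⟨h1, -⟩ | ⟨h1, -⟩, -⟩ := h <;> rwa [inj h1]
  · exact fun h => Or.inr (Or.inr ⟨i, h, by simp [sym, opp]⟩)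

/-- Converse of `exists_of_mem_switchingCopies`: the second component of `u` is the switching
function. -/
lemma ofSymbols_mem_switchingCopies {K : SignedGraph W} (hK : ∀ i, ∃ j, K.pos.Adj i j)
    {u : W → V × ℤˣ} (hu : Function.Injective (fun i => (u i).1))
    (hC : mapSymbols K u ⊆ G.symbols) :
    Subgraph.ofSymbols (mapSymbols K u) hC ∈ G.switchingCopies K := by
  have hr : (Subgraph.ofSymbols (mapSymbols K u) hC).verts = Set.range fun i => (u i).1 :=
    support_mapSymbols hK u
  let e : (Subgraph.ofSymbols (mapSymbols K u) hC).verts ≃ W :=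
    (Equiv.setCongr hr).trans (Equiv.ofInjective _ hu).symm
  have he : ∀ a, (u (e a)).1 = a := fun a =>
    congr_arg Subtype.val ((Equiv.ofInjective _ hu).apply_symm_apply (Equiv.setCongr hr a))
  refine ⟨fun i => (u i).2, e, fun a b => ?_, fun a b => ?_, fun a => ?_⟩
  · change (s((a : V), (b : V)), 1) ∈ mapSymbols K u ↔ _
    by_cases hab : e a = e b
    · obtain rfl := e.injective hab
      simp only [SimpleGraph.irrefl, iff_false]
      exact fun h => G.pos.loopless.irrefl a (pos_mem_symbols.1 (hC h))
    · rw [← he a, ← he b, mem_mapSymbols hu hab]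
      rw [one_eq_mul_units, ← neg_eq_iff_eq_neg, neg_one_eq_mul_units]
      rfl
  · change ((a : V) ≠ b ∧ (s((a : V), (b : V)), -1) ∈ mapSymbols K u) ↔ _
    by_cases hab : e a = e b
    · obtain rfl := e.injective hab
      simp
    · have hab' : (a : V) ≠ b := fun h => hab (congr_arg e (Subtype.ext h))
      rw [and_iff_right hab', ← he a, ← he b, mem_mapSymbols hu hab, neg_one_eq_mul_units, neg_inj,
        one_eq_mul_units, or_comm]
      rfl
  · change (s((a : V), (a : V)), -1) ∈ mapSymbols K u ↔ _
    rw [← he a, loop_mem_mapSymbols hu]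
    rfl

variable (G) in
lemma bijOn_symbols {K : SignedGraph W} (hK : ∀ i, ∃ j, K.pos.Adj i j) :
    Set.BijOn Subgraph.symbols (G.switchingCopies K) (images G.symbols K) := by
  refine ⟨fun H hH => ?_, fun H hH H' hH' h => ?_, ?_⟩
  · obtain ⟨u, hu, -, h⟩ := exists_of_mem_switchingCopies hH
    exact ⟨H.symbols_subset, u, hu, h⟩
  · exact Subgraph.eq_of_symbols_eq (verts_of_mem_switchingCopies hK hH)
      (verts_of_mem_switchingCopies hK hH') h
  · rintro _ ⟨hC, u, hu, rfl⟩
    exact ⟨_, ofSymbols_mem_switchingCopies hK hu hC, Subgraph.symbols_ofSymbols _ hC⟩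

lemma ncard_switchingCopies {K : SignedGraph W} (hK : ∀ i, ∃ j, K.pos.Adj i j) :
    (G.switchingCopies K).ncard = (images G.symbols K).ncard := by
  rw [← (bijOn_symbols G hK).image_eq, (bijOn_symbols G hK).injOn.ncard_image]

lemma ncard_proper {W' : Type*} {K : SignedGraph W} {K' : SignedGraph W'}
    (hK : ∀ i, ∃ j, K.pos.Adj i j) (hK' : ∀ i, ∃ j, K'.pos.Adj i j) :
    {H | H ∈ G.switchingCopies K ∧
      ¬∃ H' ∈ G.switchingCopies K', H.IsContainedIn H'}.ncard =
    {C | C ∈ images G.symbols K ∧ ¬∃ C' ∈ images G.symbols K', C ⊆ C'}.ncard := by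
  have b := bijOn_symbols G hK
  have b' := bijOn_symbols G hK'
  have key : ∀ H ∈ G.switchingCopies K, (∃ H' ∈ G.switchingCopies K', H.IsContainedIn H') ↔
      ∃ C' ∈ images G.symbols K', H.symbols ⊆ C' := by
    intro H hH
    rw [← b'.image_eq, Set.exists_mem_image]
    exact exists_congr fun H' => and_congr_right fun hH' =>
      Subgraph.isContainedIn_iff (verts_of_mem_switchingCopies hK hH)
        (verts_of_mem_switchingCopies hK' hH')
  rw [← Set.InjOn.ncard_image (f := Subgraph.symbols) (b.injOn.mono fun H hH => hH.1)]
  congr 1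
  ext C
  constructor
  · rintro ⟨H, ⟨hH, hn⟩, rfl⟩
    exact ⟨b.mapsTo hH, fun h => hn ((key H hH).2 h)⟩
  · rintro ⟨hC, hn⟩
    obtain ⟨H, hH, rfl⟩ := b.surjOn hC
    exact ⟨H, ⟨hH, fun h => hn ((key H hH).1 h)⟩, rfl⟩

/-- For signed graphs with only double edges switching has no effect. -/
lemma copies_eq_switchingCopies {K : SignedGraph W} (hK : K.pos = K.neg) :
    G.copies K = G.switchingCopies K := by
  have h : ∀ σ : W → ℤˣ, K.switch σ = K := by
    intro σ
    apply SignedGraph.ext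
    · ext i j
      simp only [switch, ← hK]
      tauto
    · ext i j
      simp only [switch, ← hK]
      tauto
    · rfl
  ext H
  exact ⟨fun hH => ⟨1, by rw [h]; exact hH⟩, fun ⟨σ, hH⟩ => by rw [h] at hH; exact hH⟩

end SignedGraph
end

/-! ### The configurations as images of the named signed graphs, and the count -/

noncomputable section

namespace SignedGraph

variable {V : Type*} {A : Set (Symbol V)}

lemma images_fin_two {K : SignedGraph (Fin 2)} {F : V × ℤˣ → V × ℤˣ → Set (Symbol V)}
    (h : ∀ u : Fin 2 → V × ℤˣ, mapSymbols K u = F (u 0) (u 1)) :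
    images A K = {C | C ⊆ A ∧ ∃ u v : V × ℤˣ, u.1 ≠ v.1 ∧ C = F u v} := by
  ext C
  refine and_congr_right fun _ => ⟨?_, ?_⟩
  · rintro ⟨u, hu, rfl⟩
    exact ⟨u 0, u 1, fun e => absurd (hu e) (by decide), h u⟩
  · rintro ⟨u, v, huv, rfl⟩
    refine ⟨![u, v], fun i j hij => ?_, (h ![u, v]).symm⟩
    fin_cases i <;> fin_cases j <;> first | rfl | exact absurd hij huv | exact absurd hij huv.symm

lemma images_fin_three {K : SignedGraph (Fin 3)}
    {F : V × ℤˣ → V × ℤˣ → V × ℤˣ → Set (Symbol V)}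
    (h : ∀ u : Fin 3 → V × ℤˣ, mapSymbols K u = F (u 0) (u 1) (u 2)) :
    images A K = {C | C ⊆ A ∧ ∃ u v w : V × ℤˣ, u.1 ≠ v.1 ∧ v.1 ≠ w.1 ∧ u.1 ≠ w.1 ∧
      C = F u v w} := by
  ext C
  refine and_congr_right fun _ => ⟨?_, ?_⟩
  · rintro ⟨u, hu, rfl⟩
    exact ⟨u 0, u 1, u 2, fun e => absurd (hu e) (by decide), fun e => absurd (hu e) (by decide),
      fun e => absurd (hu e) (by decide), h u⟩
  · rintro ⟨u, v, w, huv, hvw, huw, rfl⟩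
    refine ⟨![u, v, w], fun i j hij => ?_, (h ![u, v, w]).symm⟩
    fin_cases i <;> fin_cases j <;> first
      | rfl
      | exact absurd hij huv | exact absurd hij huv.symm
      | exact absurd hij hvw | exact absurd hij hvw.symm
      | exact absurd hij huw | exact absurd hij huw.symm

lemma images_fin_four {K : SignedGraph (Fin 4)}
    {F : V × ℤˣ → V × ℤˣ → V × ℤˣ → V × ℤˣ → Set (Symbol V)}
    (h : ∀ u : Fin 4 → V × ℤˣ, mapSymbols K u = F (u 0) (u 1) (u 2) (u 3)) :
    images A K = {C | C ⊆ A ∧ ∃ u v w x : V × ℤˣ, u.1 ≠ v.1 ∧ v.1 ≠ w.1 ∧ u.1 ≠ w.1 ∧ x.1 ≠ u.1 ∧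
      x.1 ≠ v.1 ∧ x.1 ≠ w.1 ∧ C = F u v w x} := by
  ext C
  refine and_congr_right fun _ => ⟨?_, ?_⟩
  · rintro ⟨u, hu, rfl⟩
    exact ⟨u 0, u 1, u 2, u 3, fun e => absurd (hu e) (by decide),
      fun e => absurd (hu e) (by decide), fun e => absurd (hu e) (by decide),
      fun e => absurd (hu e) (by decide), fun e => absurd (hu e) (by decide),
      fun e => absurd (hu e) (by decide), h u⟩
  · rintro ⟨u, v, w, x, huv, hvw, huw, hxu, hxv, hxw, rfl⟩
    refine ⟨![u, v, w, x], fun i j hij => ?_, (h ![u, v, w, x]).symm⟩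
    fin_cases i <;> fin_cases j <;> first
      | rfl
      | exact absurd hij huv | exact absurd hij huv.symm
      | exact absurd hij hvw | exact absurd hij hvw.symm
      | exact absurd hij huw | exact absurd hij huw.symm
      | exact absurd hij hxu | exact absurd hij hxu.symm
      | exact absurd hij hxv | exact absurd hij hxv.symm
      | exact absurd hij hxw | exact absurd hij hxw.symm

/-- Ordered pairs `i < j` list each edge once, so that small cases can be expanded explicitly. -/
lemma mem_mapSymbols_top {n : ℕ} {neg : SimpleGraph (Fin n)} {loops : Set (Fin n)}
    {u : Fin n → V × ℤˣ} {x : Symbol V} :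
    x ∈ mapSymbols ⟨⊤, neg, loops⟩ u ↔ (∃ i j, i < j ∧ x = sym (u i) (u j)) ∨
      (∃ i j, i < j ∧ neg.Adj i j ∧ x = sym (u i) (opp (u j))) ∨
      ∃ i ∈ loops, x = sym (u i) (opp (u i)) := by
  constructor
  · rintro (⟨i, j, hij, rfl⟩ | ⟨i, j, hij, rfl⟩ | h)
    · rcases lt_or_gt_of_ne hij with h | h
      exacts [Or.inl ⟨i, j, h, rfl⟩, Or.inl ⟨j, i, h, sym_comm _ _⟩]
    · rcases lt_or_gt_of_ne hij.ne with h | h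
      exacts [Or.inr (Or.inl ⟨i, j, h, hij, rfl⟩),
        Or.inr (Or.inl ⟨j, i, h, hij.symm, sym_opp_right _ _⟩)]
    · exact Or.inr (Or.inr h)
  · rintro (⟨i, j, hij, rfl⟩ | ⟨i, j, hij, h, rfl⟩ | h)
    exacts [Or.inl ⟨i, j, hij.ne, rfl⟩, Or.inr (Or.inl ⟨i, j, h, rfl⟩), Or.inr (Or.inr h)]

lemma mapSymbols_K_three (u : Fin 3 → V × ℤˣ) :
    mapSymbols (K 3) u = triangleSet (u 0) (u 1) (u 2) := by
  ext x
  rw [K, mem_mapSymbols_top]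
  simp [Fin.exists_fin_succ, triangleSet]
  tauto

lemma mapSymbols_K_four (u : Fin 4 → V × ℤˣ) :
    mapSymbols (K 4) u = tetraSet (u 0) (u 1) (u 2) (u 3) := by
  ext x
  rw [K, mem_mapSymbols_top]
  simp [Fin.exists_fin_succ, tetraSet]
  tauto

lemma mapSymbols_KLoops_two (u : Fin 2 → V × ℤˣ) :
    mapSymbols (KLoops 2) u = edgeLoopsSet (u 0) (u 1) := by
  ext x
  rw [KLoops, mem_mapSymbols_top]
  simp [Fin.exists_fin_succ, edgeLoopsSet]

lemma mapSymbols_KLoops_three (u : Fin 3 → V × ℤˣ) :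
    mapSymbols (KLoops 3) u = triangleLoopsSet (u 0) (u 1) (u 2) := by
  ext x
  rw [KLoops, mem_mapSymbols_top]
  simp [Fin.exists_fin_succ, triangleLoopsSet]
  tauto

lemma mapSymbols_D_three (u : Fin 3 → V × ℤˣ) :
    mapSymbols (D 3) u = doubleTriangleSet (u 0) (u 1) (u 2) := by
  ext x
  rw [D, mem_mapSymbols_top]
  simp [Fin.exists_fin_succ, doubleTriangleSet]
  tauto

lemma mapSymbols_DLoop_two (u : Fin 2 → V × ℤˣ) :
    mapSymbols (DLoop 2) u = doubleLoopSet (u 0) (u 1) := by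
  ext x
  rw [DLoop, mem_mapSymbols_top]
  simp [Fin.exists_fin_succ, doubleLoopSet]

lemma mapSymbols_DLoop_three (u : Fin 3 → V × ℤˣ) :
    mapSymbols (DLoop 3) u = doubleTriangleLoopSet (u 0) (u 1) (u 2) := by
  ext x
  rw [DLoop, mem_mapSymbols_top]
  simp [Fin.exists_fin_succ, doubleTriangleLoopSet, circSet]
  tauto

lemma mapSymbols_GCirc (u : Fin 3 → V × ℤˣ) :
    mapSymbols GCirc u = circSet (u 1) (u 0) (u 2) := by
  ext x
  rw [GCirc, mem_mapSymbols_top]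
  simp [Fin.exists_fin_succ, circSet, sym_comm (u 1) (u 0), sym_opp_right (u 1) (u 0)]
  tauto

lemma images_GCirc : images A GCirc = circs A := by
  rw [images_fin_three (F := fun u v w => circSet v u w) mapSymbols_GCirc]
  ext C
  refine and_congr_right fun _ => ⟨?_, ?_⟩
  · rintro ⟨u, v, w, huv, hvw, huw, rfl⟩
    exact ⟨v, u, w, huv.symm, huw, hvw, rfl⟩
  · rintro ⟨u, v, w, huv, hvw, huw, rfl⟩
    exact ⟨v, u, w, huv.symm, huw, hvw, rfl⟩

lemma exists_adj_top {n : ℕ} (i : Fin (n + 2)) : ∃ j, (⊤ : SimpleGraph (Fin (n + 2))).Adj i j := by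
  obtain ⟨j, hj⟩ := exists_ne i
  exact ⟨j, hj.symm⟩

variable {G : SignedGraph V}

/-- A double edge with loops at both ends is exactly an image of `B_2`. -/
lemma isAdmissible_symbols (hG : G.copies (B 2) = ∅) : IsAdmissible G.symbols where
  ne := fun u hu => symbols_ne hu u rfl
  double_loops := by
    intro u v huv h1 h2 h3 h4
    have hu : Function.Injective (fun i => ((![u, v] : Fin 2 → V × ℤˣ) i).1) := by
      intro i j hij
      fin_cases i <;> fin_cases j <;> first | rfl | exact absurd hij huv | exact absurd hij huv.symm
    have hC : mapSymbols (B 2) ![u, v] ⊆ G.symbols := by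
      intro x hx
      rw [B, mem_mapSymbols_top] at hx
      simp only [Fin.exists_fin_two, Set.mem_univ, true_and] at hx
      simp at hx
      rcases hx with rfl | rfl | rfl | rfl <;> assumption
    have := ofSymbols_mem_switchingCopies (G := G) (K := B 2) exists_adj_top hu hC
    rw [← copies_eq_switchingCopies rfl, hG] at this
    exact this

theorem falkInvariant_arrangement_eq [Finite V] (hG : G.copies (B 2) = ∅) :
    Arrangement.falkInvariant (G.arrangement ℂ) =
      2 * (G.numK 3 + G.numK 4 + G.numD 3 + G.numDLoop 2 + G.numKLoops 2 + G.numKLoops 3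
        + G.numGCirc) + 5 * G.numDLoop 3 := by
  have hA := isAdmissible_symbols hG
  have k3 : G.numK 3 = (triangles G.symbols).ncard := by
    rw [numK, ncard_switchingCopies exists_adj_top, images_fin_three mapSymbols_K_three, triangles]
  have k4 : G.numK 4 = (tetras G.symbols).ncard := by
    rw [numK, ncard_switchingCopies exists_adj_top, images_fin_four mapSymbols_K_four, tetras]
  have k22 : G.numKLoops 2 = (edgeLoops G.symbols).ncard := by
    rw [numKLoops, ncard_switchingCopies exists_adj_top, images_fin_two mapSymbols_KLoops_two,
      edgeLoops]
  have k33 : G.numKLoops 3 = (triangleLoops G.symbols).ncard := by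
    rw [numKLoops, ncard_switchingCopies exists_adj_top, images_fin_three mapSymbols_KLoops_three,
      triangleLoops]
  have d21 : G.numDLoop 2 = (doubleLoops G.symbols).ncard := by
    rw [numDLoop, copies_eq_switchingCopies rfl, ncard_switchingCopies exists_adj_top,
      images_fin_two mapSymbols_DLoop_two, doubleLoops]
  have d31 : G.numDLoop 3 = (doubleTriangleLoops G.symbols).ncard := by
    rw [numDLoop, copies_eq_switchingCopies rfl, ncard_switchingCopies exists_adj_top,
      images_fin_three mapSymbols_DLoop_three, doubleTriangleLoops]
  have e3 : images G.symbols (DLoop 3) = doubleTriangleLoops G.symbols :=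
    images_fin_three mapSymbols_DLoop_three
  have d3 : G.numD 3 = (proper G.symbols (doubleTriangles G.symbols)).ncard := by
    rw [numD, copies_eq_switchingCopies rfl, copies_eq_switchingCopies rfl,
      ncard_proper exists_adj_top exists_adj_top, e3, images_fin_three mapSymbols_D_three]
    rfl
  have g : G.numGCirc = (proper G.symbols (circs G.symbols)).ncard := by
    rw [numGCirc, copies_eq_switchingCopies rfl, ncard_proper exists_adj_top exists_adj_top, e3,
      images_GCirc]
    rfl
  rw [falkInvariant_arrangement G fun a b c d h h' => hA.isTripleSystem.unique h h',
    finrank_relationSpace hA, k3, k4, d3, d21, k22, k33, g, d31]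

end SignedGraph
end

theorem theorem4p1 {V : Type*} [Finite V] (G : SignedGraph V)
    (hG : G.copies (SignedGraph.B 2) = ∅) :
    Arrangement.falkInvariant (G.arrangement ℂ) =
      2 * (G.numK 3 + G.numK 4 + G.numD 3 + G.numDLoop 2 + G.numKLoops 2 + G.numKLoops 3
        + G.numGCirc) + 5 * G.numDLoop 3 :=
  SignedGraph.falkInvariant_arrangement_eq hG
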